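/- Characters are natural numbers; let $A$ be a finite alphabet of size $\sigma$ and let $T\in A^*$ be a text of length $n$. The LZD+ factorization of $T$ is the factorization $T=F_1\cdots F_z$ in which, for every $x$, with $R=F_xF_{x+1}\cdots F_z$ the remaining text and $F_0=\varepsilon$, the factor $F_x$ is produced by a rule of maximum length $\ell$ among the following: (1) combination: $(UV)[1..\ell]$, where $U$ is the longest prefix of $R$ in $\{F_1,\dots,F_{x-1}\}\cup A$, $V\in\{F_0,\dots,F_{x-1}\}\cup A$, $1\le \ell\le |U|+|V|$, and $(UV)[1..\ell]$ is a prefix of $R$; (2) truncation: $F_y[1..\ell]$, where $1\le y<x$, $1\le\ell\le|F_y|$, and $F_y[1..\ell]$ is a prefix of $R$. Among the rules of maximum length, combinations are preferred to truncations; a reference of length one, or of which only the first character is used, is given as a single character; and a second reference of which nothing is used is given as $F_0$. The model is a word RAM whose words have $w$ bits (arithmetic, bitwise and comparison operations on words, indirect memory access, and drawing a uniformly random word, each in unit time), with a fixed program that depends on none of $w$, $A$, $T$. The text is revealed online, character by character, without knowledge of $n$ or $A$, and what has been revealed is read-only. Words have $\Omega(\lg n)$ bits: for a constant $c$ that depends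 only on the program, $w\ge c\lg(n+2)$ and $w\ge c\lg(a+2)$ for every $a\in A$. The LZD+ factorization can be computed online in this model, that is, the rule of each factor is output when at most one character after the end of that factor has been revealed: (i) by a randomized program that is correct for all random choices, in expected time $O(n+1)$, and (ii) by a deterministic program, in worst-case time $O((n+1)(1+\lg\sigma))$. Both programs use $O(z+1)$ words of working space on top of the text, hence $O(n+1)$ words including the text. The constants depend only on the program. -/

import Mathlib

open MeasureTheory
open scoped ENNReal

/-! ## The LZD+ factorization

Characters are natural numbers, an alphabet is a finite set `A` of characters, and strings are
lists. A list `F` of strings is the list `F_1, ..., F_k` of factors found so far. -/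

namespace LZDPlus

/-- A reference: a single character, or the factor `F_y` (where `F_0` is the empty string). -/
inductive Ref where
  | char (a : ℕ)
  | factor (y : ℕ)

/-- The string that a reference stands for, given the factors `F_1, ..., F_k`. -/
def Ref.str (F : List (List ℕ)) : Ref → List ℕ
  | .char a => [a]
  | .factor 0 => []
  | .factor (y + 1) => F.getD y []

/-- `r` is an element of `{F_0, F_1, ..., F_k} ∪ A`. -/
def Ref.Valid (A : Finset ℕ) (F : List (List ℕ)) : Ref → Prop
  | .char a => a ∈ A
  | .factor y => y ≤ F.length

/-- `r` is an element of `{F_1, ..., F_k} ∪ A`. -/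
def Ref.ValidNonempty (A : Finset ℕ) (F : List (List ℕ)) (r : Ref) : Prop :=
  r.Valid A F ∧ r ≠ .factor 0

/-- `r` is a single character. -/
def Ref.IsChar : Ref → Prop
  | .char _ => True
  | .factor _ => False

/-- The two production rules: the combination `(r₁ r₂)[1..ℓ]` and the truncation `F_y[1..ℓ]`. -/
inductive Production where
  | comb (r₁ r₂ : Ref) (ℓ : ℕ)
  | trunc (y ℓ : ℕ)

/-- The length of the produced factor. -/
def Production.len : Production → ℕ
  | .comb _ _ ℓ => ℓ
  | .trunc _ ℓ => ℓ

/-- The produced factor. -/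
def Production.str (F : List (List ℕ)) : Production → List ℕ
  | .comb r₁ r₂ ℓ => (r₁.str F ++ r₂.str F).take ℓ
  | .trunc y ℓ => ((Ref.factor y).str F).take ℓ

/-- `r` is the longest prefix of the remaining text `R` among `{F_1, ..., F_k} ∪ A`. -/
def IsLongestRef (A : Finset ℕ) (F : List (List ℕ)) (R : List ℕ) (r : Ref) : Prop :=
  r.ValidNonempty A F ∧ r.str F <+: R ∧
    ∀ r' : Ref, r'.ValidNonempty A F → r'.str F <+: R → (r'.str F).length ≤ (r.str F).length

/-- The productions that are possible when `F` is the list of the previous factors and `R` is the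
remaining text. -/
def IsCandidate (A : Finset ℕ) (F : List (List ℕ)) (R : List ℕ) : Production → Prop
  | .comb r₁ r₂ ℓ =>
      IsLongestRef A F R r₁ ∧ r₂.Valid A F ∧
        1 ≤ ℓ ∧ ℓ ≤ (r₁.str F).length + (r₂.str F).length ∧
        (Production.comb r₁ r₂ ℓ).str F <+: R
  | .trunc y ℓ =>
      1 ≤ y ∧ y ≤ F.length ∧ 1 ≤ ℓ ∧ ℓ ≤ ((Ref.factor y).str F).length ∧
        (Production.trunc y ℓ).str F <+: R

/-- The conventions among productions of maximum length: a reference of length one, or truncated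
to length one, is given as a single character, a second reference of which nothing is used is `F_0`,
and combinations are preferred to truncations. -/
def IsPreferred (A : Finset ℕ) (F : List (List ℕ)) (R : List ℕ) : Production → Prop
  | .comb r₁ r₂ ℓ =>
      ((r₁.str F).length = 1 → r₁.IsChar) ∧
        ((r₂.str F).length = 1 ∨ ℓ = (r₁.str F).length + 1 → r₂.IsChar) ∧
        (ℓ = (r₁.str F).length → r₂ = .factor 0)
  | .trunc _ ℓ =>
      ∀ (r₁ r₂ : Ref) (m : ℕ), IsCandidate A F R (.comb r₁ r₂ m) → m < ℓ

/-- `p` is a greedy choice: a possible production of maximum length, subject to the conventions. -/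
def IsChoice (A : Finset ℕ) (F : List (List ℕ)) (R : List ℕ) (p : Production) : Prop :=
  IsCandidate A F R p ∧ (∀ q : Production, IsCandidate A F R q → q.len ≤ p.len) ∧
    IsPreferred A F R p

/-- `F = [F_1, ..., F_z]` is the LZD+ factorization of the text `T` over the alphabet `A`, and
`P = [P_1, ..., P_z]` are productions of its factors. In the last clause, the index `x` counts from
zero, `F.take x` are the previous factors and `(F.drop x).flatten` is the remaining text. -/
def IsFactorization (A : Finset ℕ) (T : List ℕ) (F : List (List ℕ)) (P : List Production) : Prop :=
  F.flatten = T ∧ P.length = F.length ∧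
    ∀ (x : ℕ) (hF : x < F.length) (hP : x < P.length),
      IsChoice A (F.take x) ((F.drop x).flatten) P[x] ∧ F[x] = P[x].str (F.take x)

/-- A reference, written as two words. -/
def Ref.encode : Ref → List ℕ
  | .char a => [0, a]
  | .factor y => [1, y]

/-- A production, written as a record of at most six words. -/
def Production.encode : Production → List ℕ
  | .comb r₁ r₂ ℓ => 0 :: (r₁.encode ++ r₂.encode ++ [ℓ])
  | .trunc y ℓ => [1, y, ℓ]

end LZDPlus

/-! ## The word RAM

A machine with words of `w` bits, finitely many registers (those that its program mentions), a
working memory of words that is initially zero, a source of independent uniformly random words, a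
write-only output and an input text. The text arrives online: its characters are revealed one by
one, its length is not known before its end is reached, and only the part that has been revealed
can be read (at random positions, but never written). Every elementary operation costs one unit of
time. -/

namespace WordRAM

/-- The binary operations on words. -/
inductive BinOp where
  | add | sub | mul | div | mod | and | or | xor | shl | shr | lt | eq

/-- Arithmetic on words is modulo `2 ^ w`; comparisons return `1` or `0`. -/
def BinOp.eval (w : ℕ) : BinOp → ℕ → ℕ → ℕ
  | .add, a, b => (a + b) % 2 ^ w
  | .sub, a, b => (a + (2 ^ w - b)) % 2 ^ w
  | .mul, a, b => a * b % 2 ^ w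
  | .div, a, b => a / b
  | .mod, a, b => a % b
  | .and, a, b => a &&& b
  | .or, a, b => a ||| b
  | .xor, a, b => a ^^^ b
  | .shl, a, b => (a <<< b) % 2 ^ w
  | .shr, a, b => a >>> b
  | .lt, a, b => if a < b then 1 else 0
  | .eq, a, b => if a = b then 1 else 0

/-- Expressions over constants and registers. -/
inductive Expr where
  | const (k : ℕ)
  | reg (x : ℕ)
  | bin (o : BinOp) (e₁ e₂ : Expr)

/-- The value of an expression, given the contents of the registers. -/
def Expr.eval (w : ℕ) (ρ : ℕ → ℕ) : Expr → ℕ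
  | .const k => k % 2 ^ w
  | .reg x => ρ x
  | .bin o e₁ e₂ => o.eval w (e₁.eval w ρ) (e₂.eval w ρ)

/-- The time to evaluate an expression: the number of its constants, registers and operations. -/
def Expr.cost : Expr → ℕ
  | .const _ => 1
  | .reg _ => 1
  | .bin _ e₁ e₂ => e₁.cost + e₂.cost + 1

/-- The elementary instructions. -/
inductive Instr where
  /-- `x := e` -/
  | assign (x : ℕ) (e : Expr)
  /-- `x := M[e]` -/
  | load (x : ℕ) (e : Expr)
  /-- `M[a] := e` -/
  | store (a e : Expr)
  /-- `x := T[e]` (counted from zero), where `T[e]` must have been revealed -/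
  | text (x : ℕ) (e : Expr)
  /-- reveal the next character of the text; `x := 1` if there is one, and `x := 0` at its end -/
  | next (x : ℕ)
  /-- `x :=` a fresh random word -/
  | rand (x : ℕ)
  /-- output the record of the values of the expressions `es` -/
  | emit (es : List Expr)

/-- The time that an instruction takes. -/
def Instr.cost : Instr → ℕ
  | .assign _ e => e.cost + 1
  | .load _ e => e.cost + 1
  | .store a e => a.cost + e.cost + 1
  | .text _ e => e.cost + 1
  | .next _ => 1
  | .rand _ => 1
  | .emit es => (es.map Expr.cost).sum + 1

/-- The state of the machine. -/
structure State where
  /-- the registers -/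
  reg : ℕ → ℕ
  /-- the working memory -/
  mem : ℕ → ℕ
  /-- the number of characters of the text that have been revealed -/
  revealed : ℕ
  /-- the number of random words that have been used -/
  drawn : ℕ
  /-- the records that have been output, first one first, each with the number of characters that
  had been revealed when it was output -/
  out : List (List ℕ × ℕ)
  /-- the time that has passed -/
  time : ℕ
  /-- the number of words of working memory in use: all addresses accessed are less than it -/
  space : ℕ

/-- The initial state. -/
def State.init : State where
  reg := fun _ => 0
  mem := fun _ => 0
  revealed := 0
  drawn := 0
  out := []
  time := 0
  space := 0

/-- Let `t` units of time pass. -/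
def State.tick (s : State) (t : ℕ) : State := { s with time := s.time + t }

/-- Write `v` into the register `x`. -/
def State.setReg (s : State) (x v : ℕ) : State := { s with reg := Function.update s.reg x v }

/-- Record an access to the address `a` of the working memory. -/
def State.touch (s : State) (a : ℕ) : State := { s with space := max s.space (a + 1) }

/-- The effect of an instruction, up to its cost, on a machine with words of `w` bits, on the text
`T`, when the source of randomness produces the words `ω 0, ω 1, ...`. -/
def Instr.effect (w : ℕ) (T : List ℕ) (ω : ℕ → ℕ) (s : State) : Instr → State
  | .assign x e => s.setReg x (e.eval w s.reg)
  | .load x e => (s.touch (e.eval w s.reg)).setReg x (s.mem (e.eval w s.reg))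
  | .store a e =>
      { s.touch (a.eval w s.reg) with
        mem := Function.update s.mem (a.eval w s.reg) (e.eval w s.reg) }
  | .text x e =>
      s.setReg x (if e.eval w s.reg < s.revealed then T.getD (e.eval w s.reg) 0 else 0)
  | .next x =>
      if s.revealed < T.length then { s.setReg x 1 with revealed := s.revealed + 1 }
      else s.setReg x 0
  | .rand x => { s.setReg x (ω s.drawn) with drawn := s.drawn + 1 }
  | .emit es => { s with out := s.out ++ [(es.map (Expr.eval w s.reg), s.revealed)] }

/-- Programs. Conditions are false if and only if they evaluate to zero. -/
inductive Program where
  | skip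
  | instr (i : Instr)
  | seq (p q : Program)
  | ite (e : Expr) (p q : Program)
  | loop (e : Expr) (p : Program)

/-- A program is deterministic if it has no instruction that draws a random word. -/
def Program.Deterministic : Program → Prop
  | .skip => True
  | .instr i => ∀ x, i ≠ .rand x
  | .seq p q => p.Deterministic ∧ q.Deterministic
  | .ite _ p q => p.Deterministic ∧ q.Deterministic
  | .loop _ p => p.Deterministic

/-- `Exec w T ω p s s'`: the program `p`, started in the state `s`, halts in the state `s'`. -/
inductive Exec (w : ℕ) (T : List ℕ) (ω : ℕ → ℕ) : Program → State → State → Prop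
  | skip (s : State) : Exec w T ω .skip s s
  | instr (i : Instr) (s : State) :
      Exec w T ω (.instr i) s ((i.effect w T ω s).tick i.cost)
  | seq {p q : Program} {s s' s'' : State} :
      Exec w T ω p s s' → Exec w T ω q s' s'' → Exec w T ω (.seq p q) s s''
  | ite_true {e : Expr} {p q : Program} {s s' : State} : e.eval w s.reg ≠ 0 →
      Exec w T ω p (s.tick (e.cost + 1)) s' → Exec w T ω (.ite e p q) s s'
  | ite_false {e : Expr} {p q : Program} {s s' : State} : e.eval w s.reg = 0 →
      Exec w T ω q (s.tick (e.cost + 1)) s' → Exec w T ω (.ite e p q) s s'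
  | loop_true {e : Expr} {p : Program} {s s' s'' : State} : e.eval w s.reg ≠ 0 →
      Exec w T ω p (s.tick (e.cost + 1)) s' → Exec w T ω (.loop e p) s' s'' →
      Exec w T ω (.loop e p) s s''
  | loop_false {e : Expr} {p : Program} {s : State} : e.eval w s.reg = 0 →
      Exec w T ω (.loop e p) s (s.tick (e.cost + 1))

/-- A program has at most one final state. -/
theorem Exec.unique {w : ℕ} {T : List ℕ} {ω : ℕ → ℕ} {p : Program} {s s₁ s₂ : State}
    (h₁ : Exec w T ω p s s₁) (h₂ : Exec w T ω p s s₂) : s₁ = s₂ := by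
  induction h₁ generalizing s₂ with
  | skip s => cases h₂; rfl
  | instr i s => cases h₂; rfl
  | seq _ _ ih₁ ih₂ =>
    cases h₂ with
    | seq a b => obtain rfl := ih₁ a; exact ih₂ b
  | ite_true h _ ih =>
    cases h₂ with
    | ite_true _ a => exact ih a
    | ite_false h' _ => exact absurd h' h
  | ite_false h _ ih =>
    cases h₂ with
    | ite_true h' _ => exact absurd h h'
    | ite_false _ a => exact ih a
  | loop_true h _ _ ih₁ ih₂ =>
    cases h₂ with
    | loop_true _ a b => obtain rfl := ih₁ a; exact ih₂ b
    | loop_false h' => exact absurd h' h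
  | loop_false h =>
    cases h₂ with
    | loop_true h' _ _ => exact absurd h h'
    | loop_false _ => rfl

/-- The running time of `p` on the text `T`, infinite if `p` does not halt. -/
noncomputable def runTime (p : Program) (w : ℕ) (T : List ℕ) (ω : ℕ → ℕ) : ℝ≥0∞ :=
  ⨅ (s : State) (_ : Exec w T ω p State.init s), (s.time : ℝ≥0∞)

/-- The law of a sequence of independent random words, each uniform among all `2 ^ w` words. -/
noncomputable def randomWords (w : ℕ) : Measure (ℕ → Fin (2 ^ w)) :=
  Measure.infinitePi fun _ => (PMF.uniformOfFintype (Fin (2 ^ w))).toMeasure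

/-- The expected running time of `p` on the text `T`. -/
noncomputable def expectedTime (p : Program) (w : ℕ) (T : List ℕ) : ℝ≥0∞ :=
  ∫⁻ ω, runTime p w T (fun k => (ω k : ℕ)) ∂(randomWords w)

/-- Words of `w` bits suffice for texts of length `n` over `A`, with the factor `c`: the word length
`w` is at least `c * log₂ (n + 2)`, and at least `c * log₂ (a + 2)` for every character `a`. -/
def WordsSuffice (c w n : ℕ) (A : Finset ℕ) : Prop :=
  (n + 2) ^ c ≤ 2 ^ w ∧ ∀ a ∈ A, (a + 2) ^ c ≤ 2 ^ w

end WordRAM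

namespace LZDPlus

open WordRAM

/-- The final state `s` of a machine shows that it has computed the LZD+ factorization of the text
`T` over `A` online and in small space. With `F_1, ..., F_z` the factors and `n` the length of `T`:
the `x`-th record output is a production of `F_x`; it was output when at most one character after
the end of `F_x` had been revealed; the working space is at most `C * (z + 1)` words in addition to
the text, and at most `C * (n + 1)` words including the text. -/
def ComputedOnline (C : ℕ) (A : Finset ℕ) (T : List ℕ) (s : State) : Prop :=
  ∃ (F : List (List ℕ)) (P : List Production),
    IsFactorization A T F P ∧
    s.out.map Prod.fst = P.map Production.encode ∧
    (∀ (x : ℕ) (hx : x < s.out.length), s.out[x].2 ≤ (F.take (x + 1)).flatten.length + 1) ∧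
    s.space ≤ C * (F.length + 1) ∧
    T.length + s.space ≤ C * (T.length + 1)

end LZDPlus

/-! The factors found so far are kept in a compact trie whose nodes store their strings as intervals
of the text. Three lengths decide a greedy choice for the remaining text R. A descent in the trie
along R stops after t characters, where t is the length of the longest prefix of R that is a prefix
of a factor, hence the best truncation. The deepest marked node passed on the way is the longest
factor that is a prefix of R; it is the first reference, unless a single character does as well. A
second descent, along the text after the first reference, gives the best second reference.
Maximality of all three lengths comes from `Locus.le_of_stuck`; `isChoice_comb` and `isChoice_trunc`
turn them into a greedy choice.

The new factor has a length l that is at least t, so it leaves the trie exactly where the first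
descent stopped. Inserting it takes at most one split of an edge and one new leaf, or a mark
(`Trie.split`, `Trie.leaf`, `Trie.mark`). This gives at most two nodes per factor, hence linear
space in the number of factors. Both descents match at most l characters, so a factor costs O(l)
steps and dictionary operations, and the lengths sum to that of the text. No descent reads more than
one character beyond the end of the factor (`findFactor_spec`, `insertFactor_spec`,
`mainLoop_spec`).

The only operation that is not of constant time is finding the edge of a node by a character, which
is left to a `Dictionary`. Its answers depend only on the sequence of inserted keys and not on the
random words. So one abstract run describes the runs for all random words at once, and
`CExec.simulate` sums their times over the finite family of random words; this sum is the
expectation up to a factor. No probability theory is needed before the very end.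

For the worst case, every trie node has a balanced skip list of its edges. Its keys are characters
and a sentinel, so its height is at most log₂(σ + 1); insertion splits full nodes on the way down
(`skipInsertSpec`). For the expected case, the keys are hashed by a random linear form modulo 2 ^ w
whose value is divided by a block size. Two keys share a list with probability at most 10 / M when
there are M lists (`card_collision`), so a list that is searched has bounded expected length.
Doubling the table is paid for by a potential (`hashInsert_spec`). -/

namespace WordRAM

/-! ## Weakest preconditions -/

/-- `p`, started in `s`, halts in a state with the property `Q`. -/
def Program.wp (w : ℕ) (T : List ℕ) (ω : ℕ → ℕ) (p : Program) (Q : State → Prop) (s : State) :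
    Prop :=
  ∃ s', Exec w T ω p s s' ∧ Q s'

section wp

variable {w : ℕ} {T : List ℕ} {ω : ℕ → ℕ} {Q : State → Prop} {s : State}

theorem wp_skip : Program.wp w T ω .skip Q s ↔ Q s :=
  ⟨fun ⟨_, h, hQ⟩ => by cases h; exact hQ, fun h => ⟨_, .skip _, h⟩⟩

theorem wp_instr {i : Instr} :
    Program.wp w T ω (.instr i) Q s ↔ Q ((i.effect w T ω s).tick i.cost) :=
  ⟨fun ⟨_, h, hQ⟩ => by cases h; exact hQ, fun h => ⟨_, .instr _ _, h⟩⟩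

theorem wp_seq {p q : Program} :
    Program.wp w T ω (.seq p q) Q s ↔ Program.wp w T ω p (Program.wp w T ω q Q) s := by
  constructor
  · rintro ⟨_, h, hQ⟩
    cases h with
    | seq a b => exact ⟨_, a, _, b, hQ⟩
  · rintro ⟨_, a, _, b, hQ⟩
    exact ⟨_, .seq a b, hQ⟩

theorem wp_ite {e : Expr} {p q : Program} :
    Program.wp w T ω (.ite e p q) Q s ↔
      (e.eval w s.reg ≠ 0 → Program.wp w T ω p Q (s.tick (e.cost + 1))) ∧
      (e.eval w s.reg = 0 → Program.wp w T ω q Q (s.tick (e.cost + 1))) := by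
  constructor
  · rintro ⟨_, h, hQ⟩
    cases h with
    | ite_true h a => exact ⟨fun _ => ⟨_, a, hQ⟩, fun h' => absurd h' h⟩
    | ite_false h a => exact ⟨fun h' => absurd h h', fun _ => ⟨_, a, hQ⟩⟩
  · rintro ⟨h₁, h₂⟩
    by_cases h : e.eval w s.reg = 0
    · obtain ⟨_, a, hQ⟩ := h₂ h
      exact ⟨_, .ite_false h a, hQ⟩
    · obtain ⟨_, a, hQ⟩ := h₁ h
      exact ⟨_, .ite_true h a, hQ⟩

theorem wp_loop {e : Expr} {p : Program} :
    Program.wp w T ω (.loop e p) Q s ↔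
      (e.eval w s.reg ≠ 0 →
        Program.wp w T ω p (Program.wp w T ω (.loop e p) Q) (s.tick (e.cost + 1))) ∧
      (e.eval w s.reg = 0 → Q (s.tick (e.cost + 1))) := by
  constructor
  · rintro ⟨_, h, hQ⟩
    cases h with
    | loop_true h a b => exact ⟨fun _ => ⟨_, a, _, b, hQ⟩, fun h' => absurd h' h⟩
    | loop_false h => exact ⟨fun h' => absurd h h', fun _ => hQ⟩
  · rintro ⟨h₁, h₂⟩
    by_cases h : e.eval w s.reg = 0
    · exact ⟨_, .loop_false h, h₂ h⟩
    · obtain ⟨_, a, _, b, hQ⟩ := h₁ h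
      exact ⟨_, .loop_true h a b, hQ⟩

theorem Program.wp_mono {p : Program} {Q' : State → Prop} (h : Program.wp w T ω p Q s)
    (hQ : ∀ s, Q s → Q' s) : Program.wp w T ω p Q' s :=
  h.imp fun _ ⟨a, b⟩ => ⟨a, hQ _ b⟩

end wp

theorem Exec.drawn_le {w : ℕ} {T : List ℕ} {ω : ℕ → ℕ} {p : Program} {s s' : State}
    (h : Exec w T ω p s s') : s.drawn ≤ s'.drawn := by
  induction h with
  | skip s => exact le_rfl
  | instr i s =>
    cases i <;> simp [Instr.effect, State.tick, State.setReg, State.touch]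
    split <;> simp
  | seq _ _ h₁ h₂ => exact h₁.trans h₂
  | ite_true _ _ h => exact h
  | ite_false _ _ h => exact h
  | loop_true _ _ _ h₁ h₂ => exact le_trans h₁ h₂
  | loop_false _ => exact le_rfl

/-- A run depends only on the random words that it draws. -/
theorem Exec.congr_words {w : ℕ} {T : List ℕ} {ω ω' : ℕ → ℕ} {p : Program} {s s' : State}
    (h : Exec w T ω p s s') (hω : ∀ k < s'.drawn, ω k = ω' k) : Exec w T ω' p s s' := by
  induction h with
  | skip s => exact .skip s
  | instr i s =>
    have : i.effect w T ω s = i.effect w T ω' s := by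
      cases i <;> try rfl
      simp only [Instr.effect]
      rw [hω _ (by simp [Instr.effect, State.tick])]
    rw [this]
    exact .instr i s
  | seq _ b h₁ h₂ => exact .seq (h₁ fun k hk => hω k (hk.trans_le b.drawn_le)) (h₂ hω)
  | ite_true h _ ih => exact .ite_true h (ih hω)
  | ite_false h _ ih => exact .ite_false h (ih hω)
  | loop_true h _ b h₁ h₂ =>
    exact .loop_true h (h₁ fun k hk => hω k (hk.trans_le b.drawn_le)) (h₂ hω)
  | loop_false h => exact .loop_false h

/-! ## Two clients that share a machine

The registers below 50 and the even addresses belong to the main program, the other registers and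
the odd addresses belong to a dictionary. -/

/-- The main program sees no difference between `s` and `s'`. -/
structure MainAgree (s s' : State) : Prop where
  reg : ∀ x < 50, s'.reg x = s.reg x
  mem : ∀ i, s'.mem (2 * i) = s.mem (2 * i)
  revealed : s'.revealed = s.revealed
  drawn : s'.drawn = s.drawn
  out : s'.out = s.out

theorem MainAgree.refl (s : State) : MainAgree s s := ⟨fun _ _ => rfl, fun _ => rfl, rfl, rfl, rfl⟩

/-- The dictionary sees no difference between `s` and `s'`. -/
structure DictAgree (s s' : State) : Prop where
  reg : ∀ x, 50 ≤ x → s'.reg x = s.reg x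
  mem : ∀ i, s'.mem (2 * i + 1) = s.mem (2 * i + 1)

/-- The position of `k` in the list, counted from one, and zero if there is none. -/
def keyIndex (ks : List (ℕ × ℕ)) (k : ℕ × ℕ) : ℕ := if k ∈ ks then ks.idxOf k + 1 else 0

theorem keyIndex_eq_zero {ks : List (ℕ × ℕ)} {k : ℕ × ℕ} : keyIndex ks k = 0 ↔ k ∉ ks := by
  unfold keyIndex; split <;> simp_all

theorem keyIndex_le {ks : List (ℕ × ℕ)} {k : ℕ × ℕ} : keyIndex ks k ≤ ks.length := by
  unfold keyIndex; split
  · have := List.idxOf_lt_length_of_mem ‹_›; omega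
  · omega

theorem keyIndex_inj {ks : List (ℕ × ℕ)} {k k' : ℕ × ℕ} (h : keyIndex ks k = keyIndex ks k')
    (h0 : keyIndex ks k ≠ 0) : k = k' := by
  have h0' := h ▸ h0
  have hk : k ∈ ks := by_contra fun H => h0 (keyIndex_eq_zero.2 H)
  have hk' : k' ∈ ks := by_contra fun H => h0' (keyIndex_eq_zero.2 H)
  simp only [keyIndex, hk, hk', if_true, Nat.add_right_cancel_iff] at h
  exact (List.idxOf_inj hk).1 h

theorem keyIndex_append_of_ne {ks : List (ℕ × ℕ)} {k k' : ℕ × ℕ} (h : k ≠ k') :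
    keyIndex (ks ++ [k']) k = keyIndex ks k := by
  unfold keyIndex
  by_cases hk : k ∈ ks <;> simp [hk, h, List.idxOf_append]

theorem keyIndex_append_self {ks : List (ℕ × ℕ)} {k : ℕ × ℕ} (h : k ∉ ks) :
    keyIndex (ks ++ [k]) k = ks.length + 1 := by
  unfold keyIndex
  simp [h, List.idxOf_append]

theorem keyIndex_of_getElem {ks : List (ℕ × ℕ)} (hn : ks.Nodup) {i : ℕ} (hi : i < ks.length) :
    keyIndex ks ks[i] = i + 1 := by
  unfold keyIndex
  simp [hn.idxOf_getElem]

/-- The lists of keys that occur in a dictionary: pairs of a small number and a character. -/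
structure Legal (A : Finset ℕ) (L : ℕ) (ks : List (ℕ × ℕ)) : Prop where
  nodup : ks.Nodup
  length_le : ks.length ≤ L
  bound : ∀ k ∈ ks, k.1 ≤ ks.length ∧ k.2 ∈ A

/-- A dictionary that maps the keys of a list to their positions, for a family of machines that use
the random words `ω a`. Searches cost at most `K` on average over the family. Insertions cost at
most `K` in the amortized sense. -/
structure Dictionary (w : ℕ) (T : List ℕ) (A : Finset ℕ) (L : ℕ) {ι : Type} [Fintype ι]
    (ω : ι → ℕ → ℕ) (K d₀ : ℕ) (init find insert : Program) where
  Inv : ι → List (ℕ × ℕ) → State → Prop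
  credit : ℕ → ℕ
  cost : ι → List (ℕ × ℕ) → ℕ × ℕ → ℕ
  inv_congr : ∀ {a ks s s'}, Inv a ks s → DictAgree s s' → Inv a ks s'
  cost_le : ∀ {ks k}, Legal A L ks → k.1 ≤ ks.length + 1 → k.2 ∈ A →
    ∑ a, cost a ks k ≤ Fintype.card ι * K
  init_spec : ∀ a, ∃ s, Exec w T (ω a) init State.init s ∧ Inv a [] s ∧
    MainAgree { State.init with drawn := d₀ } s ∧ s.time + credit 0 ≤ K ∧ s.space ≤ 256
  find_spec : ∀ {a ks k s}, Inv a ks s → Legal A L ks → k.1 ≤ ks.length + 1 → k.2 ∈ A →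
    s.reg 40 = k.1 → s.reg 41 = k.2 →
    ∃ s', Exec w T (ω a) find s s' ∧ Inv a ks s' ∧
      MainAgree (s.setReg 42 (keyIndex ks k)) s' ∧ s'.time ≤ s.time + cost a ks k ∧
      s'.space ≤ max s.space (128 * (ks.length + 2))
  insert_spec : ∀ {a ks k s}, Inv a ks s → Legal A L (ks ++ [k]) →
    s.reg 40 = k.1 → s.reg 41 = k.2 → s.reg 43 = ks.length + 1 →
    ∃ s', Exec w T (ω a) insert s s' ∧ Inv a (ks ++ [k]) s' ∧ MainAgree s s' ∧
      s'.time + credit (ks.length + 1) ≤ s.time + credit ks.length + K ∧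
      s'.space ≤ max s.space (128 * (ks.length + 3))

/-! ## Programs that use a dictionary -/

/-- Commands of a program that uses a dictionary. Its own memory consists of records. -/
inductive Cmd where
  | skip
  | set (x : ℕ) (e : Expr)
  | load (x j : ℕ) (e : Expr)
  | store (j : ℕ) (a e : Expr)
  | text (x : ℕ) (e : Expr)
  | next (x : ℕ)
  | emit (es : List Expr)
  | find
  | insert
  | seq (p q : Cmd)
  | ite (e : Expr) (p q : Cmd)
  | loop (e : Expr) (p : Cmd)

/-- The address of the field `j` of the record `e`. -/
def fieldAddr (j : ℕ) (e : Expr) : Expr := .bin .add (.bin .mul (.const 16) e) (.const j)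

/-- Translation to the machine, given the programs of a dictionary. -/
def Cmd.compile (f g : Program) : Cmd → Program
  | .skip => .skip
  | .set x e => .instr (.assign x e)
  | .load x j e => .instr (.load x (fieldAddr (2 * j) e))
  | .store j a e => .instr (.store (fieldAddr (2 * j) a) e)
  | .text x e => .instr (.text x e)
  | .next x => .instr (.next x)
  | .emit es => .instr (.emit es)
  | .find => f
  | .insert => g
  | .seq p q => .seq (p.compile f g) (q.compile f g)
  | .ite e p q => .ite e (p.compile f g) (q.compile f g)
  | .loop e p => .loop e (p.compile f g)

/-- All registers of an expression are less than 50. -/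
def Expr.isMain : Expr → Bool
  | .const _ => true
  | .reg x => decide (x < 50)
  | .bin _ e₁ e₂ => e₁.isMain && e₂.isMain

/-- All registers are less than 50, and records have at most eight fields. -/
def Cmd.isMain : Cmd → Bool
  | .skip => true
  | .set x e => decide (x < 50) && e.isMain
  | .load x j e => decide (x < 50) && decide (j < 8) && e.isMain
  | .store j a e => decide (j < 8) && a.isMain && e.isMain
  | .text x e => decide (x < 50) && e.isMain
  | .next x => decide (x < 50)
  | .emit es => es.all Expr.isMain
  | .find => true
  | .insert => true
  | .seq p q => p.isMain && q.isMain
  | .ite e p q => e.isMain && p.isMain && q.isMain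
  | .loop e p => e.isMain && p.isMain

/-- What a program that uses a dictionary sees of the machine: `nd j i` is the field `j` of the
record `i`, and `keys` are the keys of the dictionary. -/
structure View where
  reg : ℕ → ℕ
  nd : ℕ → ℕ → ℕ
  revealed : ℕ
  out : List (List ℕ × ℕ)
  keys : List (ℕ × ℕ)
  time : ℕ

def View.tick (v : View) (t : ℕ) : View := { v with time := v.time + t }

def View.setReg (v : View) (x y : ℕ) : View := { v with reg := Function.update v.reg x y }

def View.setNd (v : View) (j i y : ℕ) : View :=
  { v with nd := Function.update v.nd j (Function.update (v.nd j) i y) }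

/-- The field of a record can be addressed. -/
def View.Addressable (w : ℕ) (v : View) (i : ℕ) : Prop :=
  16 * i + 16 ≤ 2 ^ w ∧ i ≤ v.keys.length + 2

/-- `CExec c v v'`: the command `c` leads from `v` to `v'`, if a dictionary operation costs `K`. -/
inductive CExec (w : ℕ) (T : List ℕ) (A : Finset ℕ) (L K : ℕ) : Cmd → View → View → Prop
  | skip (v) : CExec w T A L K .skip v v
  | set (x e v) : CExec w T A L K (.set x e) v ((v.setReg x (e.eval w v.reg)).tick (e.cost + 1))
  | load (x j e v) : v.Addressable w (e.eval w v.reg) →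
      CExec w T A L K (.load x j e) v
        ((v.setReg x (v.nd j (e.eval w v.reg))).tick (e.cost + 5))
  | store (j a e v) : v.Addressable w (a.eval w v.reg) →
      CExec w T A L K (.store j a e) v
        ((v.setNd j (a.eval w v.reg) (e.eval w v.reg)).tick (a.cost + e.cost + 5))
  | text (x e v) :
      CExec w T A L K (.text x e) v
        ((v.setReg x (if e.eval w v.reg < v.revealed then T.getD (e.eval w v.reg) 0 else 0)).tick
          (e.cost + 1))
  | next_true (x v) : v.revealed < T.length →
      CExec w T A L K (.next x) v ({ v.setReg x 1 with revealed := v.revealed + 1 }.tick 1)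
  | next_false (x v) : ¬ v.revealed < T.length →
      CExec w T A L K (.next x) v ((v.setReg x 0).tick 1)
  | emit (es v) :
      CExec w T A L K (.emit es) v
        ({ v with out := v.out ++ [(es.map (Expr.eval w v.reg), v.revealed)] }.tick
          ((es.map Expr.cost).sum + 1))
  | find (v) : v.reg 40 ≤ v.keys.length + 1 → v.reg 41 ∈ A →
      CExec w T A L K .find v ((v.setReg 42 (keyIndex v.keys (v.reg 40, v.reg 41))).tick K)
  | insert (v) : Legal A L (v.keys ++ [(v.reg 40, v.reg 41)]) → v.reg 43 = v.keys.length + 1 →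
      CExec w T A L K .insert v ({ v with keys := v.keys ++ [(v.reg 40, v.reg 41)] }.tick K)
  | seq {p q v v' v''} : CExec w T A L K p v v' → CExec w T A L K q v' v'' →
      CExec w T A L K (.seq p q) v v''
  | ite_true {e p q v v'} : e.eval w v.reg ≠ 0 → CExec w T A L K p (v.tick (e.cost + 1)) v' →
      CExec w T A L K (.ite e p q) v v'
  | ite_false {e p q v v'} : e.eval w v.reg = 0 → CExec w T A L K q (v.tick (e.cost + 1)) v' →
      CExec w T A L K (.ite e p q) v v'
  | loop_true {e p v v' v''} : e.eval w v.reg ≠ 0 → CExec w T A L K p (v.tick (e.cost + 1)) v' →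
      CExec w T A L K (.loop e p) v' v'' → CExec w T A L K (.loop e p) v v''
  | loop_false {e p v} : e.eval w v.reg = 0 →
      CExec w T A L K (.loop e p) v (v.tick (e.cost + 1))

/-- The command `c`, started in `v`, halts in a view with the property `Q`. -/
def Cmd.wp (w : ℕ) (T : List ℕ) (A : Finset ℕ) (L K : ℕ) (c : Cmd) (Q : View → Prop) (v : View) :
    Prop :=
  ∃ v', CExec w T A L K c v v' ∧ Q v'

section cwp

variable {w : ℕ} {T : List ℕ} {A : Finset ℕ} {L K : ℕ} {Q : View → Prop} {v : View}

theorem cwp_skip : Cmd.wp w T A L K .skip Q v ↔ Q v :=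
  ⟨fun ⟨_, h, hQ⟩ => by cases h; exact hQ, fun h => ⟨_, .skip _, h⟩⟩

theorem cwp_set {x : ℕ} {e : Expr} : Cmd.wp w T A L K (.set x e) Q v ↔
    Q ((v.setReg x (e.eval w v.reg)).tick (e.cost + 1)) :=
  ⟨fun ⟨_, h, hQ⟩ => by cases h; exact hQ, fun h => ⟨_, .set _ _ _, h⟩⟩

theorem cwp_load {x j : ℕ} {e : Expr} : Cmd.wp w T A L K (.load x j e) Q v ↔
    v.Addressable w (e.eval w v.reg) ∧
      Q ((v.setReg x (v.nd j (e.eval w v.reg))).tick (e.cost + 5)) :=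
  ⟨fun ⟨_, h, hQ⟩ => by cases h; exact ⟨by assumption, hQ⟩, fun h => ⟨_, .load _ _ _ _ h.1, h.2⟩⟩

theorem cwp_store {j : ℕ} {a e : Expr} : Cmd.wp w T A L K (.store j a e) Q v ↔
    v.Addressable w (a.eval w v.reg) ∧
      Q ((v.setNd j (a.eval w v.reg) (e.eval w v.reg)).tick (a.cost + e.cost + 5)) :=
  ⟨fun ⟨_, h, hQ⟩ => by cases h; exact ⟨by assumption, hQ⟩, fun h => ⟨_, .store _ _ _ _ h.1, h.2⟩⟩

theorem cwp_text {x : ℕ} {e : Expr} : Cmd.wp w T A L K (.text x e) Q v ↔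
    Q ((v.setReg x (if e.eval w v.reg < v.revealed then T.getD (e.eval w v.reg) 0 else 0)).tick
      (e.cost + 1)) :=
  ⟨fun ⟨_, h, hQ⟩ => by cases h; exact hQ, fun h => ⟨_, .text _ _ _, h⟩⟩

theorem cwp_next {x : ℕ} : Cmd.wp w T A L K (.next x) Q v ↔
    (v.revealed < T.length → Q ({ v.setReg x 1 with revealed := v.revealed + 1 }.tick 1)) ∧
    (¬ v.revealed < T.length → Q ((v.setReg x 0).tick 1)) := by
  constructor
  · rintro ⟨_, h, hQ⟩
    cases h with
    | next_true _ _ h => exact ⟨fun _ => hQ, fun h' => absurd h h'⟩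
    | next_false _ _ h => exact ⟨fun h' => absurd h' h, fun _ => hQ⟩
  · rintro ⟨h₁, h₂⟩
    by_cases h : v.revealed < T.length
    · exact ⟨_, .next_true _ _ h, h₁ h⟩
    · exact ⟨_, .next_false _ _ h, h₂ h⟩

theorem cwp_emit {es : List Expr} : Cmd.wp w T A L K (.emit es) Q v ↔
    Q ({ v with out := v.out ++ [(es.map (Expr.eval w v.reg), v.revealed)] }.tick
      ((es.map Expr.cost).sum + 1)) :=
  ⟨fun ⟨_, h, hQ⟩ => by cases h; exact hQ, fun h => ⟨_, .emit _ _, h⟩⟩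

theorem cwp_find : Cmd.wp w T A L K .find Q v ↔
    (v.reg 40 ≤ v.keys.length + 1 ∧ v.reg 41 ∈ A) ∧
      Q ((v.setReg 42 (keyIndex v.keys (v.reg 40, v.reg 41))).tick K) :=
  ⟨fun ⟨_, h, hQ⟩ => by cases h; exact ⟨⟨by assumption, by assumption⟩, hQ⟩,
    fun h => ⟨_, .find _ h.1.1 h.1.2, h.2⟩⟩

theorem cwp_insert : Cmd.wp w T A L K .insert Q v ↔
    (Legal A L (v.keys ++ [(v.reg 40, v.reg 41)]) ∧ v.reg 43 = v.keys.length + 1) ∧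
      Q ({ v with keys := v.keys ++ [(v.reg 40, v.reg 41)] }.tick K) :=
  ⟨fun ⟨_, h, hQ⟩ => by cases h; exact ⟨⟨by assumption, by assumption⟩, hQ⟩,
    fun h => ⟨_, .insert _ h.1.1 h.1.2, h.2⟩⟩

theorem cwp_seq {p q : Cmd} :
    Cmd.wp w T A L K (.seq p q) Q v ↔ Cmd.wp w T A L K p (Cmd.wp w T A L K q Q) v := by
  constructor
  · rintro ⟨_, h, hQ⟩
    cases h with
    | seq a b => exact ⟨_, a, _, b, hQ⟩
  · rintro ⟨_, a, _, b, hQ⟩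
    exact ⟨_, .seq a b, hQ⟩

theorem cwp_ite {e : Expr} {p q : Cmd} :
    Cmd.wp w T A L K (.ite e p q) Q v ↔
      (e.eval w v.reg ≠ 0 → Cmd.wp w T A L K p Q (v.tick (e.cost + 1))) ∧
      (e.eval w v.reg = 0 → Cmd.wp w T A L K q Q (v.tick (e.cost + 1))) := by
  constructor
  · rintro ⟨_, h, hQ⟩
    cases h with
    | ite_true h a => exact ⟨fun _ => ⟨_, a, hQ⟩, fun h' => absurd h' h⟩
    | ite_false h a => exact ⟨fun h' => absurd h h', fun _ => ⟨_, a, hQ⟩⟩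
  · rintro ⟨h₁, h₂⟩
    by_cases h : e.eval w v.reg = 0
    · obtain ⟨_, a, hQ⟩ := h₂ h
      exact ⟨_, .ite_false h a, hQ⟩
    · obtain ⟨_, a, hQ⟩ := h₁ h
      exact ⟨_, .ite_true h a, hQ⟩

theorem cwp_loop {e : Expr} {p : Cmd} :
    Cmd.wp w T A L K (.loop e p) Q v ↔
      (e.eval w v.reg ≠ 0 →
        Cmd.wp w T A L K p (Cmd.wp w T A L K (.loop e p) Q) (v.tick (e.cost + 1))) ∧
      (e.eval w v.reg = 0 → Q (v.tick (e.cost + 1))) := by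
  constructor
  · rintro ⟨_, h, hQ⟩
    cases h with
    | loop_true h a b => exact ⟨fun _ => ⟨_, a, _, b, hQ⟩, fun h' => absurd h' h⟩
    | loop_false h => exact ⟨fun h' => absurd h h', fun _ => hQ⟩
  · rintro ⟨h₁, h₂⟩
    by_cases h : e.eval w v.reg = 0
    · exact ⟨_, .loop_false h, h₂ h⟩
    · obtain ⟨_, a, _, b, hQ⟩ := h₁ h
      exact ⟨_, .loop_true h a b, hQ⟩

theorem Cmd.wp_mono {p : Cmd} {Q' : View → Prop} (h : Cmd.wp w T A L K p Q v)
    (hQ : ∀ s, Q s → Q' s) : Cmd.wp w T A L K p Q' v :=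
  h.imp fun _ ⟨a, b⟩ => ⟨a, hQ _ b⟩

end cwp

/-! ## Simulation -/

theorem Expr.eval_congr {w : ℕ} {ρ ρ' : ℕ → ℕ} (h : ∀ x < 50, ρ x = ρ' x) {e : Expr}
    (he : e.isMain = true) : e.eval w ρ = e.eval w ρ' := by
  induction e with
  | const k => rfl
  | reg x => exact h x (by simpa [Expr.isMain] using he)
  | bin o e₁ e₂ h₁ h₂ =>
    simp only [Expr.isMain, Bool.and_eq_true] at he
    simp [Expr.eval, h₁ he.1, h₂ he.2]

theorem eval_fieldAddr {w : ℕ} {ρ : ℕ → ℕ} {e : Expr} {j : ℕ}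
    (h : 16 * e.eval w ρ + 16 ≤ 2 ^ w) (hj : j < 16) :
    (fieldAddr j e).eval w ρ = 16 * e.eval w ρ + j := by
  simp only [fieldAddr, Expr.eval, BinOp.eval]
  by_cases h0 : 16 % 2 ^ w = 16
  · rw [h0, Nat.mod_eq_of_lt (a := 16 * _) (by omega), Nat.mod_eq_of_lt (a := j) (by omega),
      Nat.mod_eq_of_lt (by omega)]
  -- With words of exactly four bits the constant 16 becomes 0, but then the bound leaves only the
  -- record 0, and the address is still right.
  · have : ¬ 16 < 2 ^ w := fun h' => h0 (Nat.mod_eq_of_lt h')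
    have h1 : e.eval w ρ = 0 := by omega
    have h2 : (2 : ℕ) ^ w = 16 := by omega
    simp [h1, h2, Nat.mod_eq_of_lt hj]

section simulation

variable {w : ℕ} {T : List ℕ} {A : Finset ℕ} {L : ℕ} {ι : Type} [Fintype ι]
  {ω : ι → ℕ → ℕ} {K d₀ : ℕ} {init f g : Program}

/-- The state `s` implements the view `v`. -/
structure Implements (d₀ : ℕ) (v : View) (s : State) : Prop where
  reg : ∀ x < 50, s.reg x = v.reg x
  nd : ∀ j < 8, ∀ i, s.mem (16 * i + 2 * j) = v.nd j i
  revealed : s.revealed = v.revealed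
  out : s.out = v.out
  drawn : s.drawn = d₀
  space : s.space ≤ 128 * (v.keys.length + 2)

/-- A family of states implements the view `v` in the time of `v`. -/
structure Simulates (D : Dictionary w T A L ω K d₀ init f g) (v : View) (S : ι → State) :
    Prop where
  impl : ∀ a, Implements d₀ v (S a)
  inv : ∀ a, D.Inv a v.keys (S a)
  legal : Legal A L v.keys
  time : ∑ a, (S a).time + Fintype.card ι * D.credit v.keys.length ≤ Fintype.card ι * v.time

theorem Implements.tick {v : View} {s : State} (h : Implements d₀ v s) (t : ℕ) :
    Implements d₀ (v.tick t) (s.tick t) :=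
  ⟨h.reg, h.nd, h.revealed, h.out, h.drawn, h.space⟩

theorem Implements.setReg {v : View} {s : State} (h : Implements d₀ v s) (x y : ℕ) :
    Implements d₀ (v.setReg x y) (s.setReg x y) := by
  refine ⟨fun z hz => ?_, h.nd, h.revealed, h.out, h.drawn, h.space⟩
  simp only [View.setReg, State.setReg, Function.update_apply, h.reg z hz]

theorem Implements.touch {v : View} {s : State} (h : Implements d₀ v s) {i : ℕ}
    (hi : i < 128 * (v.keys.length + 2)) : Implements d₀ v (s.touch i) :=
  ⟨h.reg, h.nd, h.revealed, h.out, h.drawn, max_le h.space hi⟩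

theorem Implements.eval {v : View} {s : State} (h : Implements d₀ v s) {e : Expr}
    (he : e.isMain = true) : e.eval w s.reg = e.eval w v.reg :=
  Expr.eval_congr h.reg he

theorem dictAgree_tick (s : State) (t : ℕ) : DictAgree s (s.tick t) :=
  ⟨fun _ _ => rfl, fun _ => rfl⟩

/-- An instruction of the main program. -/
theorem Simulates.instr {D : Dictionary w T A L ω K d₀ init f g} {v v' : View} {S : ι → State}
    (h : Simulates D v S) (i : Instr) {t : ℕ} (hi' : i.cost = t) (hk : v'.keys = v.keys)
    (ht : v'.time = v.time)
    (hi : ∀ a, Implements d₀ v' (i.effect w T (ω a) (S a)))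
    (hd : ∀ a, DictAgree (S a) (i.effect w T (ω a) (S a))) :
    ∃ S' : ι → State, (∀ a, Exec w T (ω a) (.instr i) (S a) (S' a)) ∧
      Simulates D (v'.tick t) S' := by
  subst hi'
  refine ⟨fun a => (i.effect w T (ω a) (S a)).tick i.cost, fun a => .instr _ _,
    fun a => (hi a).tick _, fun a => ?_, ?_, ?_⟩
  · simp only [View.tick, hk]
    exact D.inv_congr (D.inv_congr (h.inv a) (hd a)) (dictAgree_tick _ _)
  · simpa [View.tick, hk] using h.legal
  · have : ∀ a, (i.effect w T (ω a) (S a)).time = (S a).time := by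
      intro a
      cases i <;> simp [Instr.effect, State.setReg, State.touch]
      split <;> rfl
    have := h.time
    simp only [View.tick, State.tick, Finset.sum_add_distrib, Finset.sum_const, mul_add,
      smul_eq_mul, Finset.card_univ, *]
    omega

theorem Simulates.tick {D : Dictionary w T A L ω K d₀ init f g} {v : View} {S : ι → State}
    (h : Simulates D v S) (t : ℕ) : Simulates D (v.tick t) fun a => (S a).tick t := by
  refine ⟨fun a => (h.impl a).tick _, fun a => D.inv_congr (h.inv a) (dictAgree_tick _ _),
    h.legal, ?_⟩
  have := h.time
  simp only [View.tick, State.tick, Finset.sum_add_distrib, Finset.sum_const, mul_add,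
    smul_eq_mul, Finset.card_univ]
  omega

theorem DictAgree.setReg (s : State) {x : ℕ} (hx : x < 50) (y : ℕ) :
    DictAgree s (s.setReg x y) := by
  refine ⟨fun z hz => ?_, fun _ => rfl⟩
  simp only [State.setReg, Function.update_apply]
  rw [if_neg (by omega)]

/-- The view before and after a dictionary operation. -/
theorem Implements.of_mainAgree {v v' : View} {s s' : State} (h : Implements d₀ v s)
    (h' : MainAgree s s') (hr : v'.reg = v.reg) (hn : v'.nd = v.nd)
    (hv : v'.revealed = v.revealed) (ho : v'.out = v.out)
    (hs : s'.space ≤ 128 * (v'.keys.length + 2)) : Implements d₀ v' s' := by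
  refine ⟨fun x hx => ?_, fun j hj i => ?_, ?_, ?_, ?_, hs⟩
  · rw [h'.reg x hx, h.reg x hx, hr]
  · rw [hn, ← h.nd j hj i, show 16 * i + 2 * j = 2 * (8 * i + j) by ring, h'.mem]
  · rw [h'.revealed, h.revealed, hv]
  · rw [h'.out, h.out, ho]
  · rw [h'.drawn, h.drawn]

/-- All machines of the family show the same view to the main program, whatever their random words
are, so they take the same branches and stay in lockstep. Only the times of dictionary operations
differ from machine to machine. Hence the time of the view bounds the average time, and the credit
of the dictionary absorbs amortized insertions. -/
theorem CExec.simulate {D : Dictionary w T A L ω K d₀ init f g} {c : Cmd} {v v' : View}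
    (h : CExec w T A L K c v v') (hc : c.isMain = true) {S : ι → State} (hS : Simulates D v S) :
    ∃ S' : ι → State, (∀ a, Exec w T (ω a) (c.compile f g) (S a) (S' a)) ∧ Simulates D v' S' := by
  induction h generalizing S with
  | skip v => exact ⟨S, fun a => .skip _, hS⟩
  | set x e v =>
    simp only [Cmd.isMain, Bool.and_eq_true, decide_eq_true_eq] at hc
    refine hS.instr (.assign x e) rfl rfl rfl (fun a => ?_) fun a => .setReg _ hc.1 _
    simp only [Instr.effect, (hS.impl a).eval hc.2]
    exact (hS.impl a).setReg _ _
  | load x j e v hv =>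
    simp only [Cmd.isMain, Bool.and_eq_true, decide_eq_true_eq] at hc
    refine hS.instr (.load x (fieldAddr (2 * j) e)) (v' := v.setReg x _)
      (by simp [Instr.cost, fieldAddr, Expr.cost]; omega) rfl rfl (fun a => ?_) fun a => ?_
    · have := (hS.impl a).eval (w := w) hc.2
      rw [← this] at hv ⊢
      have := hv.2
      have hj := hc.1.2
      simp only [Instr.effect]
      rw [eval_fieldAddr hv.1 (by omega), (hS.impl a).nd j hj]
      exact ((hS.impl a).touch (by omega)).setReg _ _
    · refine ⟨fun z hz => ?_, fun _ => rfl⟩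
      simp only [Instr.effect, State.setReg, State.touch, Function.update_apply]
      rw [if_neg (by omega)]
  | store j b e v hv =>
    simp only [Cmd.isMain, Bool.and_eq_true, decide_eq_true_eq] at hc
    have hj := hc.1.1
    refine hS.instr (.store (fieldAddr (2 * j) b) e) (v' := v.setNd j _ _)
      (by simp [Instr.cost, fieldAddr, Expr.cost]; omega) rfl rfl (fun a => ?_) fun a => ?_
    · have := (hS.impl a).eval (w := w) hc.1.2
      rw [← this] at hv ⊢
      rw [← (hS.impl a).eval (w := w) hc.2]
      have := hv.2
      simp only [Instr.effect]
      rw [eval_fieldAddr hv.1 (by omega)]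
      have h' := (hS.impl a).touch (i := 16 * Expr.eval w (S a).reg b + 2 * j) (by omega)
      refine ⟨h'.reg, fun j' hj' i => ?_, h'.revealed, h'.out, h'.drawn, h'.space⟩
      have h0 : (S a).mem (16 * i + 2 * j') = v.nd j' i := h'.nd j' hj' i
      simp only [View.setNd, Function.update_apply, h0]
      by_cases h1 : j' = j
      · subst h1
        by_cases h2 : i = Expr.eval w (S a).reg b
        · simp [h2]
        · rw [if_neg (by omega), if_pos rfl, Function.update_of_ne h2]
      · rw [if_neg h1, if_neg (by omega)]
    · refine ⟨fun _ _ => rfl, fun i => ?_⟩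
      rw [← (hS.impl a).eval (w := w) hc.1.2] at hv
      simp only [Instr.effect, Function.update_apply, State.touch]
      rw [eval_fieldAddr hv.1 (by omega), if_neg (by omega)]
  | text x e v =>
    simp only [Cmd.isMain, Bool.and_eq_true, decide_eq_true_eq] at hc
    refine hS.instr (.text x e) (v' := v.setReg x _) rfl rfl rfl (fun a => ?_)
      fun a => .setReg _ hc.1 _
    simp only [Instr.effect, (hS.impl a).eval hc.2, (hS.impl a).revealed]
    exact (hS.impl a).setReg _ _
  | next_true x v hv =>
    simp only [Cmd.isMain, decide_eq_true_eq] at hc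
    refine hS.instr (.next x) (v' := { v.setReg x 1 with revealed := _ }) rfl rfl rfl (fun a => ?_)
      fun a => ?_
    · have h' := (hS.impl a).setReg x 1
      simp only [Instr.effect, (hS.impl a).revealed, hv, if_true]
      exact ⟨h'.reg, h'.nd, rfl, h'.out, h'.drawn, h'.space⟩
    · simp only [Instr.effect, (hS.impl a).revealed, hv, if_true]
      exact ⟨(DictAgree.setReg (S a) hc 1).reg, (DictAgree.setReg (S a) hc 1).mem⟩
  | next_false x v hv =>
    simp only [Cmd.isMain, decide_eq_true_eq] at hc
    refine hS.instr (.next x) (v' := v.setReg x 0) rfl rfl rfl (fun a => ?_) fun a => ?_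
    · simp only [Instr.effect, (hS.impl a).revealed, hv, if_false]
      exact (hS.impl a).setReg x 0
    · simp only [Instr.effect, (hS.impl a).revealed, hv, if_false]
      exact .setReg _ hc _
  | emit es v =>
    simp only [Cmd.isMain, List.all_eq_true] at hc
    refine hS.instr (.emit es) (v' := { v with out := _ }) rfl rfl rfl (fun a => ?_)
      fun a => ⟨fun _ _ => rfl, fun _ => rfl⟩
    have h' := hS.impl a
    refine ⟨h'.reg, h'.nd, h'.revealed, ?_, h'.drawn, h'.space⟩
    simp only [Instr.effect, h'.out, h'.revealed]
    congr 3
    exact List.map_congr_left fun e he => h'.eval (hc e he)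
  | find v h40 h41 =>
    have := fun a => D.find_spec (k := (v.reg 40, v.reg 41)) (hS.inv a) hS.legal h40 h41
      ((hS.impl a).reg 40 (by norm_num)) ((hS.impl a).reg 41 (by norm_num))
    choose S' h1 h2 h3 h4 h5 using this
    refine ⟨S', h1, fun a => ?_, h2, hS.legal, ?_⟩
    · refine ((hS.impl a).setReg 42 _).of_mainAgree (h3 a) rfl rfl rfl rfl ?_
      exact (h5 a).trans (max_le (hS.impl a).space le_rfl)
    -- A single search may be slow on some machines. Only the sum over all machines is bounded,
    -- which is why the invariant is about sums.
    · have e1 := Finset.sum_le_sum fun a (_ : a ∈ Finset.univ) => h4 a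
      have e2 := D.cost_le (k := (v.reg 40, v.reg 41)) hS.legal h40 h41
      have e3 := hS.time
      rw [Finset.sum_add_distrib] at e1
      simp only [View.tick, View.setReg, mul_add]
      omega
  | insert v hv h43 =>
    have := fun a => D.insert_spec (k := (v.reg 40, v.reg 41)) (hS.inv a) hv
      ((hS.impl a).reg 40 (by norm_num)) ((hS.impl a).reg 41 (by norm_num))
      (((hS.impl a).reg 43 (by norm_num)).trans h43)
    choose S' h1 h2 h3 h4 h5 using this
    refine ⟨S', h1, fun a => ?_, h2, hv, ?_⟩
    · refine (hS.impl a).of_mainAgree (h3 a) rfl rfl rfl rfl ?_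
      refine (h5 a).trans (max_le ((hS.impl a).space.trans ?_) ?_) <;> simp [View.tick]
    · have e1 := Finset.sum_le_sum fun a (_ : a ∈ Finset.univ) => h4 a
      have e3 := hS.time
      simp only [Finset.sum_add_distrib, Finset.sum_const, smul_eq_mul, Finset.card_univ] at e1
      simp only [View.tick, mul_add, List.length_append, List.length_singleton]
      omega
  | seq _ _ ih₁ ih₂ =>
    simp only [Cmd.isMain, Bool.and_eq_true] at hc
    obtain ⟨S₁, h₁, s₁⟩ := ih₁ hc.1 hS
    obtain ⟨S₂, h₂, s₂⟩ := ih₂ hc.2 s₁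
    exact ⟨S₂, fun a => .seq (h₁ a) (h₂ a), s₂⟩
  | ite_true h _ ih =>
    simp only [Cmd.isMain, Bool.and_eq_true] at hc
    obtain ⟨S₁, h₁, s₁⟩ := ih hc.1.2 (hS.tick _)
    exact ⟨S₁, fun a => .ite_true (by rwa [(hS.impl a).eval hc.1.1]) (h₁ a), s₁⟩
  | ite_false h _ ih =>
    simp only [Cmd.isMain, Bool.and_eq_true] at hc
    obtain ⟨S₁, h₁, s₁⟩ := ih hc.2 (hS.tick _)
    exact ⟨S₁, fun a => .ite_false (by rwa [(hS.impl a).eval hc.1.1]) (h₁ a), s₁⟩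
  | loop_true h _ _ ih₁ ih₂ =>
    have hc' := hc
    simp only [Cmd.isMain, Bool.and_eq_true] at hc
    obtain ⟨S₁, h₁, s₁⟩ := ih₁ hc.2 (hS.tick _)
    obtain ⟨S₂, h₂, s₂⟩ := ih₂ hc' s₁
    exact ⟨S₂, fun a => .loop_true (by rwa [(hS.impl a).eval hc.1]) (h₁ a) (h₂ a), s₂⟩
  | loop_false h =>
    simp only [Cmd.isMain, Bool.and_eq_true] at hc
    exact ⟨_, fun a => .loop_false (by rwa [(hS.impl a).eval hc.1]), hS.tick _⟩

end simulation

end WordRAM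

namespace LZDPlus

open WordRAM

/-! ## Strings -/

theorem append_singleton_prefix {s x : List ℕ} {c : ℕ} :
    s ++ [c] <+: x ↔ s <+: x ∧ x[s.length]? = some c := by
  constructor
  · rintro ⟨t, rfl⟩
    exact ⟨⟨c :: t, by simp⟩, by simp⟩
  · rintro ⟨⟨t, rfl⟩, h⟩
    cases t with
    | nil => simp at h
    | cons b t =>
      simp at h
      exact ⟨t, by simp [h]⟩

theorem take_succ_of_getElem? {R : List ℕ} {d c : ℕ} (h : R[d]? = some c) :
    R.take (d + 1) = R.take d ++ [c] := by
  rw [List.take_add_one, h]; rfl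

theorem take_prefix_of_le {R x : List ℕ} {k d : ℕ} (h : R.take k <+: x) (hd : d ≤ k) :
    R.take d <+: x :=
  (List.take_prefix_take_left hd).trans h

/-! ## Compact tries -/

/-- A compact trie of the strings `F`. Its nodes are `0, ..., ks.length`, with `0` the root. The
edges are numbered from one: the edge with key `(u, c)` leads from the node `u` by the character `c`
to its child. The node `i` represents `N i`, is marked by the number `fac i` of a string in `F` that
equals `N i`, if there is one, and knows the number `ix i` of a string in `F` that extends `N i`. -/
structure Trie (F : List (List ℕ)) (ks : List (ℕ × ℕ)) (N : ℕ → List ℕ) (fac ix child : ℕ → ℕ) :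
    Prop where
  root : N 0 = []
  nodup : ks.Nodup
  edge : ∀ u c, keyIndex ks (u, c) ≠ 0 → u ≤ ks.length ∧ child (keyIndex ks (u, c)) ≤ ks.length ∧
    N u ++ [c] <+: N (child (keyIndex ks (u, c)))
  branch : ∀ u x c, u ≤ ks.length → x ≤ ks.length → N u ++ [c] <+: N x →
    keyIndex ks (u, c) ≠ 0 ∧ N (child (keyIndex ks (u, c))) <+: N x
  inj : ∀ i j, i ≤ ks.length → j ≤ ks.length → N i = N j → i = j
  fac_eq : ∀ i ≤ ks.length, fac i ≠ 0 → F[fac i - 1]? = some (N i)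
  complete : ∀ s ∈ F, ∃ i ≤ ks.length, N i = s ∧ fac i ≠ 0
  ix_eq : ∀ i ≤ ks.length, i ≠ 0 → ix i ≠ 0 ∧ ∃ s, F[ix i - 1]? = some s ∧ N i <+: s

/-- The search for `R` has matched `d` characters, and has reached a point on the edge `e` that
leads to the node `v`, possibly the node `v` itself. -/
structure Locus (ks : List (ℕ × ℕ)) (N : ℕ → List ℕ) (child : ℕ → ℕ) (R : List ℕ) (v d e : ℕ) :
    Prop where
  node : v ≤ ks.length
  le_len : d ≤ (N v).length
  le_rem : d ≤ R.length
  take_eq : (N v).take d = R.take d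
  below : ∀ x ≤ ks.length, R.take d <+: N x → N v <+: N x
  edge : d = 0 ∧ v = 0 ∨
    ∃ p c, e = keyIndex ks (p, c) ∧ e ≠ 0 ∧ child e = v ∧ (N p).length < d

/-- Among the marked nodes that the search for `R` has visited, the last one has the mark `bf` and
the length `bl`. -/
structure Best (ks : List (ℕ × ℕ)) (N : ℕ → List ℕ) (fac : ℕ → ℕ) (R : List ℕ) (d bf bl : ℕ) :
    Prop where
  le : bl ≤ d
  mark : bl = 0 ∨ bf ≠ 0 ∧ ∃ x ≤ ks.length, fac x = bf ∧ N x = R.take bl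
  max : ∀ x ≤ ks.length, fac x ≠ 0 → N x <+: R → (N x).length ≤ d → (N x).length ≤ bl

/-- The search for `R` cannot go on. -/
def Stuck (ks : List (ℕ × ℕ)) (N : ℕ → List ℕ) (R : List ℕ) (v d : ℕ) : Prop :=
  d = R.length ∨ ∃ c, R[d]? = some c ∧
    (d < (N v).length ∧ (N v)[d]? ≠ some c ∨ d = (N v).length ∧ keyIndex ks (v, c) = 0)

section trie

variable {F : List (List ℕ)} {ks : List (ℕ × ℕ)} {N : ℕ → List ℕ} {fac ix child : ℕ → ℕ}
  {R : List ℕ} {v d e c : ℕ}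

theorem Trie.empty {fac ix child : ℕ → ℕ} {N : ℕ → List ℕ} (h0 : fac 0 = 0) (hN : N 0 = []) :
    Trie [] [] N fac ix child where
  root := hN
  nodup := List.nodup_nil
  edge u c h := by simp [keyIndex] at h
  branch u x c hu hx h := by
    simp only [List.length_nil, nonpos_iff_eq_zero] at hu hx
    subst hu hx
    simp [hN] at h
  inj i j hi hj _ := by simp_all
  fac_eq i hi h := by simp_all
  complete s hs := by simp at hs
  ix_eq i hi h := by simp_all

theorem Trie.locus_root (_ : Trie F ks N fac ix child) (R : List ℕ) (e : ℕ)
    (h0 : N 0 = []) : Locus ks N child R 0 0 e where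
  node := Nat.zero_le _
  le_len := Nat.zero_le _
  le_rem := Nat.zero_le _
  take_eq := by simp
  below x _ _ := by simp [h0]
  edge := .inl ⟨rfl, rfl⟩

theorem Trie.best_root (R : List ℕ) : Best ks N fac R 0 0 0 where
  le := le_rfl
  mark := .inl rfl
  max _ _ _ _ h := h

theorem Locus.eq_take (h : Locus ks N child R v d e) (hd : d = (N v).length) :
    N v = R.take d := by
  rw [← h.take_eq, hd, List.take_length]

/-- Taking an edge matches only its first character, so the locus is then a point on the edge and in
general not yet its lower end. That nothing is missed below this point is what `branch` says about
the child. -/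
theorem Locus.down (hT : Trie F ks N fac ix child) (h : Locus ks N child R v d e)
    (hd : d = (N v).length) (hc : R[d]? = some c) (he : keyIndex ks (v, c) ≠ 0) :
    Locus ks N child R (child (keyIndex ks (v, c))) (d + 1) (keyIndex ks (v, c)) := by
  obtain ⟨h1, h2, h3⟩ := hT.edge v c he
  have hR : R.take (d + 1) = N v ++ [c] := by rw [take_succ_of_getElem? hc, h.eq_take hd]
  have hlen := h3.length_le
  simp only [List.length_append, List.length_singleton, ← hd] at hlen
  refine ⟨h2, hlen, (List.getElem?_eq_some_iff.1 hc).1, ?_, fun x hx hp => ?_,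
    .inr ⟨v, c, rfl, he, rfl, by omega⟩⟩
  · rw [hR, List.prefix_iff_eq_take.1 h3]; simp [hd]
  · exact (hT.branch v x c h1 hx (hR ▸ hp)).2

theorem Locus.forward (hT : Trie F ks N fac ix child) (h : Locus ks N child R v d e)
    (hd : d < (N v).length) (hc : R[d]? = some c) (hv : (N v)[d]? = some c) :
    Locus ks N child R v (d + 1) e := by
  refine ⟨h.node, hd, (List.getElem?_eq_some_iff.1 hc).1, ?_, fun x hx hp => ?_, ?_⟩
  · rw [take_succ_of_getElem? hc, take_succ_of_getElem? hv, h.take_eq]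
  · exact h.below x hx (take_prefix_of_le hp (Nat.le_succ d))
  · rcases h.edge with ⟨rfl, rfl⟩ | ⟨p, c, h1, h2, h3, h4⟩
    · simp [hT.root] at hd
    · exact .inr ⟨p, c, h1, h2, h3, by omega⟩

/-- If a node agreed with R for more than d characters, it would lie below the locus by `below`, and
its next character would be that of R. This contradicts either the mismatch inside the edge or, by
`branch`, the missing edge. Taking k to be the whole length of a node bounds the first reference;
smaller k bounds truncations and second references. -/
theorem Locus.le_of_stuck (hT : Trie F ks N fac ix child) (h : Locus ks N child R v d e)
    (hs : Stuck ks N R v d) {x k : ℕ} (hx : x ≤ ks.length) (hk : k ≤ (N x).length)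
    (hp : (N x).take k <+: R) : k ≤ d := by
  by_contra! hlt
  have hkR : k ≤ R.length := by have := hp.length_le; simp at this; omega
  have hp' : (N x).take k = R.take k := by
    have := List.prefix_iff_eq_take.1 hp
    rwa [List.length_take, min_eq_left hk] at this
  have h1 : R.take k <+: N x := hp' ▸ List.take_prefix k (N x)
  have h2 := h.below x hx (take_prefix_of_le h1 hlt.le)
  rcases hs with hs | ⟨c, hc, hs⟩
  · omega
  have h3 : (N x)[d]? = some c := by
    have h4 : (R.take k)[d]? = some c := by rw [List.getElem?_take_of_lt hlt, hc]
    obtain ⟨t, ht⟩ := h1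
    rw [← ht, List.getElem?_append_left (by simp; omega), h4]
  rcases hs with ⟨hd, hne⟩ | ⟨hd, hne⟩
  · apply hne
    obtain ⟨t, ht⟩ := h2
    rwa [← ht, List.getElem?_append_left hd] at h3
  · exact (hT.branch v x c h.node hx (append_singleton_prefix.2 ⟨h2, hd ▸ h3⟩)).1 hne

/-- The only candidate that becomes relevant at depth d + 1 is a marked node equal to the matched
prefix. It lies below `v`, which is at least as long, so it is `v` itself by `inj`, and `v` is not
marked if it has been reached exactly. -/
theorem Best.skip (hT : Trie F ks N fac ix child) (h : Locus ks N child R v (d + 1) e)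
    {bf bl : ℕ} (hb : Best ks N fac R d bf bl) (hv : d + 1 = (N v).length → fac v = 0) :
    Best ks N fac R (d + 1) bf bl := by
  refine ⟨by have := hb.le; omega, hb.mark, fun x hx hf hp hl => ?_⟩
  rcases Nat.lt_or_ge d (N x).length with hlt | hle
  · exfalso
    have h1 : N x = R.take (d + 1) := by
      rw [List.prefix_iff_eq_take.1 hp]; congr 1; omega
    have h2 := h.below x hx (by rw [h1])
    have h3 := h.le_len
    have h4 := h2.length_le
    have h5 := h2.eq_of_length_le (by omega)
    obtain rfl := hT.inj _ _ h.node hx h5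
    exact hf (hv (by omega))
  · exact hb.max x hx hf hp hle

theorem Best.update (h : Locus ks N child R v d e)
    (hd : d = (N v).length) (hf : fac v ≠ 0) : Best ks N fac R d (fac v) d :=
  ⟨le_rfl, .inr ⟨hf, v, h.node, rfl, h.eq_take hd⟩, fun _ _ _ _ hl => hl⟩

/-- Edges start at existing nodes, so the number of the next node does not occur in any key. This
makes the key that a split adds a new one. -/
theorem Trie.not_mem (hT : Trie F ks N fac ix child) (c : ℕ) : (ks.length + 1, c) ∉ ks := by
  intro h
  have := (hT.edge _ c (fun h' => keyIndex_eq_zero.1 h' h)).1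
  omega

/-- Making a point in the interior of an edge a node. -/
theorem Trie.split (hT : Trie F ks N fac ix child) (h : Locus ks N child R v d e)
    (hd : d < (N v).length) (hc : (N v)[d]? = some c) :
    Trie F (ks ++ [(ks.length + 1, c)]) (Function.update N (ks.length + 1) (R.take d))
      (Function.update fac (ks.length + 1) 0) (Function.update ix (ks.length + 1) (ix v))
      (Function.update (Function.update child e (ks.length + 1)) (ks.length + 1) v) ∧
    Locus (ks ++ [(ks.length + 1, c)]) (Function.update N (ks.length + 1) (R.take d))
      (Function.update (Function.update child e (ks.length + 1)) (ks.length + 1) v) R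
      (ks.length + 1) d e := by
  set m := ks.length + 1 with hm
  obtain ⟨p, c₀, he, he0, hev, hpd⟩ : ∃ p c, e = keyIndex ks (p, c) ∧ e ≠ 0 ∧ child e = v ∧
      (N p).length < d := by
    rcases h.edge with ⟨rfl, rfl⟩ | h
    · simp [hT.root] at hd
    · exact h
  have hN : ∀ i, i ≤ ks.length → Function.update N m (R.take d) i = N i := fun i hi =>
    Function.update_of_ne (by omega) _ _
  have hNm : Function.update N m (R.take d) m = R.take d := Function.update_self _ _ _
  have hlen : (R.take d).length = d := by simp [h.le_rem]
  have hRv : R.take d <+: N v := h.take_eq ▸ List.take_prefix _ _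
  have hnm := hT.not_mem c
  have hkm : keyIndex (ks ++ [(m, c)]) (m, c) = m := keyIndex_append_self hnm
  have hko : ∀ u c', (u, c') ≠ (m, c) → keyIndex (ks ++ [(m, c)]) (u, c') = keyIndex ks (u, c') :=
    fun u c' hne => keyIndex_append_of_ne hne
  have hem : e ≠ m := by have := @keyIndex_le ks (p, c₀); omega
  have hv0 : v ≠ 0 := by rintro rfl; simp [hT.root] at hd
  have hcm : Function.update (Function.update child e m) m v m = v := Function.update_self _ _ _
  have hce : Function.update (Function.update child e m) m v e = m := by
    rw [Function.update_of_ne hem, Function.update_self]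
  have hco : ∀ k, k ≤ ks.length → k ≠ e →
      Function.update (Function.update child e m) m v k = child k := fun k hk hke => by
    rw [Function.update_of_ne (by omega), Function.update_of_ne hke]
  have hvm : R.take d ++ [c] <+: N v := append_singleton_prefix.2 ⟨hRv, by rwa [hlen]⟩
  have hbelow : ∀ x ≤ ks.length, R.take d <+: N x → N v <+: N x := h.below
  have hpv := hT.edge p c₀ (he ▸ he0)
  rw [← he, hev] at hpv
  have hpR : N p ++ [c₀] <+: R.take d := by
    refine List.prefix_of_prefix_length_le hpv.2.2 hRv ?_
    simp [h.le_rem]; omega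
  have hT' : Trie F (ks ++ [(m, c)]) (Function.update N m (R.take d))
      (Function.update fac m 0) (Function.update ix m (ix v))
      (Function.update (Function.update child e m) m v) := by
    have cases_le : ∀ i, i ≤ (ks ++ [(m, c)]).length → i ≤ ks.length ∨ i = m := by
      intro i hi; simp at hi; omega
    refine ⟨?_, ?_, ?_, ?_, ?_, ?_, ?_, ?_⟩
    · rw [hN 0 (Nat.zero_le _), hT.root]
    · exact List.nodup_append.2 ⟨hT.nodup, by simp, by
        rintro a ha b hb rfl; simp at hb; exact hnm (hb ▸ ha)⟩
    · intro u c' hk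
      by_cases huc : (u, c') = (m, c)
      · obtain ⟨rfl, rfl⟩ := Prod.mk.inj huc
        rw [hkm, hcm, hNm, hN v h.node]
        have := h.node
        simp; exact ⟨by omega, by omega, hvm⟩
      · rw [hko u c' huc] at hk ⊢
        obtain ⟨h1, h2, h3⟩ := hT.edge u c' hk
        rw [hN u h1]
        have h4 : keyIndex ks (u, c') ≤ ks.length := keyIndex_le
        by_cases hke : keyIndex ks (u, c') = e
        · rw [hke, hce, hNm]
          have := keyIndex_inj (hke.trans he) hk
          obtain ⟨rfl, rfl⟩ := Prod.mk.inj this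
          simp only [List.length_append, List.length_singleton]
          exact ⟨by omega, by omega, hpR⟩
        · rw [hco _ h4 hke, hN _ h2]
          simp only [List.length_append, List.length_singleton]
          exact ⟨by omega, by omega, h3⟩
    · intro u x c' hu hx hp
      rcases cases_le u hu with hu | rfl
      · rw [hN u hu] at hp
        rw [hko u c' (by intro h; have := (Prod.mk.inj h).1; omega)]
        -- The new node lies on the edge to `v`. As a target of `branch` it can be replaced by `v`,
        -- to which the old trie applies.
        have key : N u ++ [c'] <+: N (if x = m then v else x) ∧
            (if x = m then v else x) ≤ ks.length := by
          rcases cases_le x hx with hx | rfl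
          · rw [hN x hx] at hp
            rw [if_neg (by omega)]; exact ⟨hp, hx⟩
          · rw [hNm] at hp
            rw [if_pos rfl]; exact ⟨hp.trans hRv, h.node⟩
        obtain ⟨h1, h2⟩ := hT.branch u _ c' hu key.2 key.1
        refine ⟨h1, ?_⟩
        obtain ⟨-, h3, h4⟩ := hT.edge u c' h1
        have h5 : keyIndex ks (u, c') ≤ ks.length := keyIndex_le
        by_cases hke : keyIndex ks (u, c') = e
        · rw [hke, hce, hNm]
          rcases cases_le x hx with hx | rfl
          · rw [if_neg (by omega), hke, hev] at h2
            rw [hN x hx]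
            exact hRv.trans h2
          · rw [hNm]
        · rw [hco _ h5 hke, hN _ h3]
          rcases cases_le x hx with hx | rfl
          · rw [if_neg (by omega)] at h2
            rwa [hN x hx]
          · rw [if_pos rfl] at h2
            rw [hNm] at hp ⊢
            refine List.prefix_of_prefix_length_le h2 hRv ?_
            -- If the child of `u` were longer than the split point, `below` would identify its
            -- string with that of `v`, so two edges would end at the same place. If `u` is shorter
            -- than `p`, its edge would have to end at or before `p`; if it is longer, the edge of
            -- `p` would have to end at or before `u`; if the lengths agree, the two edges are the
            -- same, which was excluded.
            by_contra! hlt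
            have h6 := hbelow _ h3 (List.prefix_of_prefix_length_le hRv h2 hlt.le)
            have h7 : N v = N (child (keyIndex ks (u, c'))) :=
              h6.eq_of_length_le h2.length_le
            have hlu := hp.length_le
            simp [hlen] at hlu
            rcases lt_trichotomy (N u).length (N p).length with hl | hl | hl
            · have := (hT.branch u p c' hu hpv.1 (List.prefix_of_prefix_length_le key.1
                (by rw [if_pos rfl]; exact (List.prefix_append _ _).trans hpv.2.2)
                (by simp; omega))).2
              have := this.length_le
              rw [← h7] at this
              omega
            · have hup : N u ++ [c'] = N p ++ [c₀] := by
                rw [if_pos rfl] at key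
                exact (List.prefix_of_prefix_length_le key.1 hpv.2.2 (by simp [hl])).eq_of_length_le
                  (by simp [hl])
              obtain ⟨h8, h9⟩ := List.append_inj hup (by simpa using hl)
              have := hT.inj _ _ hu hpv.1 h8
              simp at h9
              exact hke (by rw [he, this, h9])
            · have := (hT.branch p u c₀ hpv.1 hu (List.prefix_of_prefix_length_le hpv.2.2
                ((List.prefix_append _ _).trans (hp.trans hRv)) (by simp; omega))).2
              rw [← he, hev] at this
              have := this.length_le
              omega
      · rw [hNm] at hp
        rcases cases_le x hx with hx | rfl
        · rw [hN x hx] at hp ⊢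
          have h1 := hbelow x hx ((List.prefix_append _ _).trans hp)
          have h2 : c' = c := by
            have h3 := (append_singleton_prefix.1 hp).2
            have h4 := (append_singleton_prefix.1 (hvm.trans h1)).2
            simpa using h3.symm.trans h4
          subst h2
          rw [hkm, hcm, hN v h.node]
          exact ⟨by omega, h1⟩
        · rw [hNm] at hp
          have := hp.length_le
          simp at this
          omega
    · intro i j hi hj hij
      -- An old node at the split point would lie below it, and so have at least the length of `v`,
      -- which is greater than d.
      have aux : ∀ i ≤ ks.length, N i ≠ R.take d := fun i hi h' => by
        have := (hbelow i hi (by rw [h'])).length_le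
        rw [h', hlen] at this
        omega
      rcases cases_le i hi with hi | rfl <;> rcases cases_le j hj with hj | rfl
      · rw [hN i hi, hN j hj] at hij; exact hT.inj i j hi hj hij
      · rw [hN i hi, hNm] at hij; exact absurd hij (aux i hi)
      · rw [hN j hj, hNm] at hij; exact absurd hij.symm (aux j hj)
      · rfl
    · intro i hi hf
      rcases cases_le i hi with hi | rfl
      · rw [Function.update_of_ne (by omega)] at hf ⊢
        rw [hN i hi]
        exact hT.fac_eq i hi hf
      · simp at hf
    · intro s hs
      obtain ⟨i, hi, h1, h2⟩ := hT.complete s hs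
      refine ⟨i, by simp; omega, by rw [hN i hi, h1], ?_⟩
      rwa [Function.update_of_ne (by omega)]
    · intro i hi hi0
      rcases cases_le i hi with hi | rfl
      · rw [Function.update_of_ne (by omega), hN i hi]
        exact hT.ix_eq i hi hi0
      · obtain ⟨h1, s, h2, h3⟩ := hT.ix_eq v h.node hv0
        rw [Function.update_self, hNm]
        exact ⟨h1, s, h2, hRv.trans h3⟩
  refine ⟨hT', ?_⟩
  refine ⟨by simp [hm], by rw [hNm, hlen], h.le_rem, ?_, ?_, ?_⟩
  · rw [hNm]; simp
  · intro x _ hp; rwa [hNm]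
  · refine .inr ⟨p, c₀, ?_, he0, hce, ?_⟩
    · rw [hko p c₀ (by intro h; have := (Prod.mk.inj h).1; have := hpv.1; omega), he]
    · rwa [hN p hpv.1]

/-- Marking a node as a new string. -/
theorem Trie.mark (hT : Trie F ks N fac ix child) (hv : v ≤ ks.length) :
    Trie (F ++ [N v]) ks N (Function.update fac v (F.length + 1)) ix child := by
  refine ⟨hT.root, hT.nodup, hT.edge, hT.branch, hT.inj, ?_, ?_, ?_⟩
  · intro i hi hf
    by_cases h : i = v
    · subst h; simp
    · rw [Function.update_of_ne h] at hf ⊢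
      have := hT.fac_eq i hi hf
      rw [List.getElem?_append_left (List.getElem?_eq_some_iff.1 this).1, this]
  · intro s hs
    rcases List.mem_append.1 hs with hs | hs
    · obtain ⟨i, hi, h1, h2⟩ := hT.complete s hs
      refine ⟨i, hi, h1, ?_⟩
      rw [Function.update_apply]; split <;> omega
    · simp only [List.mem_singleton] at hs
      exact ⟨v, hv, hs.symm, by simp⟩
  · intro i hi hi0
    obtain ⟨h1, s, h2, h3⟩ := hT.ix_eq i hi hi0
    exact ⟨h1, s, by rw [List.getElem?_append_left (List.getElem?_eq_some_iff.1 h2).1, h2], h3⟩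

/-- Adding a leaf below a node for a new string. -/
theorem Trie.leaf (hT : Trie F ks N fac ix child) (h : Locus ks N child R v d e)
    (hd : d = (N v).length) (hc : R[d]? = some c) (hk : keyIndex ks (v, c) = 0) {l : ℕ}
    (hl : d < l) (hlR : l ≤ R.length) :
    Trie (F ++ [R.take l]) (ks ++ [(v, c)]) (Function.update N (ks.length + 1) (R.take l))
      (Function.update fac (ks.length + 1) (F.length + 1))
      (Function.update ix (ks.length + 1) (F.length + 1))
      (Function.update child (ks.length + 1) (ks.length + 1)) := by
  set m := ks.length + 1 with hm
  have hN : ∀ i, i ≤ ks.length → Function.update N m (R.take l) i = N i := fun i hi =>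
    Function.update_of_ne (by omega) _ _
  have hNm : Function.update N m (R.take l) m = R.take l := Function.update_self _ _ _
  have hkm : keyIndex (ks ++ [(v, c)]) (v, c) = m := keyIndex_append_self (keyIndex_eq_zero.1 hk)
  have hko : ∀ u c', (u, c') ≠ (v, c) → keyIndex (ks ++ [(v, c)]) (u, c') = keyIndex ks (u, c') :=
    fun u c' hne => keyIndex_append_of_ne hne
  have hvl : N v ++ [c] <+: R.take l := by
    rw [h.eq_take hd, ← take_succ_of_getElem? hc]
    exact List.take_prefix_take_left hl
  have cases_le : ∀ i, i ≤ (ks ++ [(v, c)]).length → i ≤ ks.length ∨ i = m := by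
    intro i hi; simp at hi; omega
  -- No old node continues `v` by `c`, since the edge for it is missing. So the new leaf shares with
  -- the old nodes nothing beyond `v`.
  have hno : ∀ x ≤ ks.length, ¬ N v ++ [c] <+: N x := fun x hx hp =>
    (hT.branch v x c h.node hx hp).1 hk
  have hvn := h.node
  refine ⟨?_, ?_, ?_, ?_, ?_, ?_, ?_, ?_⟩
  · rw [hN 0 (Nat.zero_le _), hT.root]
  · exact List.nodup_append.2 ⟨hT.nodup, by simp, by
      rintro a ha b hb rfl; simp at hb; exact keyIndex_eq_zero.1 hk (hb ▸ ha)⟩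
  · intro u c' hk'
    by_cases huc : (u, c') = (v, c)
    · obtain ⟨rfl, rfl⟩ := Prod.mk.inj huc
      rw [hkm, Function.update_self, hNm, hN _ h.node]
      simp only [List.length_append, List.length_singleton]
      exact ⟨by omega, by omega, hvl⟩
    · rw [hko u c' huc] at hk' ⊢
      obtain ⟨h1, h2, h3⟩ := hT.edge u c' hk'
      have h4 : keyIndex ks (u, c') ≤ ks.length := keyIndex_le
      have h5 : Function.update child m m (keyIndex ks (u, c')) = child (keyIndex ks (u, c')) :=
        Function.update_of_ne (by omega) _ _
      rw [h5, hN _ h1, hN _ h2]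
      simp only [List.length_append, List.length_singleton]
      exact ⟨by omega, by omega, h3⟩
  · intro u x c' hu hx hp
    rcases cases_le u hu with hu | rfl
    · rw [hN u hu] at hp
      by_cases huc : (u, c') = (v, c)
      · obtain ⟨rfl, rfl⟩ := Prod.mk.inj huc
        rw [hkm, Function.update_self, hNm]
        rcases cases_le x hx with hx | rfl
        · rw [hN x hx] at hp
          exact absurd hp (hno x hx)
        · rw [hNm]; exact ⟨by omega, List.prefix_rfl⟩
      · rw [hko u c' huc]
        have h4 : keyIndex ks (u, c') ≤ ks.length := keyIndex_le
        have h5 : Function.update child m m (keyIndex ks (u, c')) = child (keyIndex ks (u, c')) :=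
          Function.update_of_ne (by omega) _ _
        rw [h5]
        rcases cases_le x hx with hx | rfl
        · rw [hN x hx] at hp ⊢
          obtain ⟨h1, h2⟩ := hT.branch u x c' hu hx hp
          rw [hN _ (hT.edge u c' h1).2.1]
          exact ⟨h1, h2⟩
        · rw [hNm] at hp ⊢
          have hvR : N v <+: R.take l := (List.prefix_append _ _).trans hvl
          -- A node other than `v` from which the new leaf is seen along an edge other than the new
          -- one is a proper ancestor of `v`. Its branch towards the leaf is therefore the old
          -- branch towards `v`.
          have hlt : (N u).length < (N v).length := by
            by_contra! hge
            rcases hge.eq_or_lt with heq | hlt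
            · have : N u ++ [c'] = N v ++ [c] :=
                (List.prefix_of_prefix_length_le hp hvl (by simp [heq])).eq_of_length_le
                  (by simp [heq])
              obtain ⟨h8, h9⟩ := List.append_inj this (by simpa using heq.symm)
              simp at h9
              exact huc (by rw [hT.inj _ _ hu h.node h8, h9])
            · exact hno u hu (List.prefix_of_prefix_length_le hvl
                ((List.prefix_append _ _).trans hp) (by simp; omega))
          obtain ⟨h1, h2⟩ := hT.branch u v c' hu h.node
            (List.prefix_of_prefix_length_le hp hvR (by simp; omega))
          rw [hN _ (hT.edge u c' h1).2.1]
          exact ⟨h1, h2.trans hvR⟩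
    · exfalso
      rw [hNm] at hp
      rcases cases_le x hx with hx | rfl
      · rw [hN x hx] at hp
        exact hno x hx (hvl.trans ((List.prefix_append _ _).trans hp))
      · rw [hNm] at hp
        have := hp.length_le
        simp at this
        omega
  · intro i j hi hj hij
    have aux : ∀ i ≤ ks.length, N i ≠ R.take l := fun i hi h' => hno i hi (h' ▸ hvl)
    rcases cases_le i hi with hi | rfl <;> rcases cases_le j hj with hj | rfl
    · rw [hN i hi, hN j hj] at hij; exact hT.inj i j hi hj hij
    · rw [hN i hi, hNm] at hij; exact absurd hij (aux i hi)
    · rw [hN j hj, hNm] at hij; exact absurd hij.symm (aux j hj)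
    · rfl
  · intro i hi hf
    rcases cases_le i hi with hi | rfl
    · rw [Function.update_of_ne (by omega)] at hf ⊢
      have := hT.fac_eq i hi hf
      rw [hN i hi, List.getElem?_append_left (List.getElem?_eq_some_iff.1 this).1, this]
    · rw [hNm]; simp
  · intro s hs
    rcases List.mem_append.1 hs with hs | hs
    · obtain ⟨i, hi, h1, h2⟩ := hT.complete s hs
      refine ⟨i, by simp; omega, by rw [hN i hi, h1], ?_⟩
      rwa [Function.update_of_ne (by omega)]
    · simp only [List.mem_singleton] at hs
      exact ⟨m, by simp [hm], by rw [hNm, hs], by simp⟩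
  · intro i hi hi0
    rcases cases_le i hi with hi | rfl
    · rw [Function.update_of_ne (by omega), hN i hi]
      obtain ⟨h1, s, h2, h3⟩ := hT.ix_eq i hi hi0
      exact ⟨h1, s, by rw [List.getElem?_append_left (List.getElem?_eq_some_iff.1 h2).1, h2], h3⟩
    · rw [Function.update_self, hNm]
      exact ⟨by omega, _, by simp, List.prefix_rfl⟩

end trie

/-! ## Greedy choices -/

section choice

variable {A : Finset ℕ} {F : List (List ℕ)} {R : List ℕ}

/-- `r` is the first reference of the combination that is chosen, and has length `l`. -/
structure FirstRef (A : Finset ℕ) (F : List (List ℕ)) (R : List ℕ) (r : Ref) (l : ℕ) : Prop where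
  valid : r.ValidNonempty A F
  str_eq : r.str F = R.take l
  pos : 1 ≤ l
  le : l ≤ R.length
  char : l = 1 → r.IsChar
  max : ∀ s ∈ F, s <+: R → s.length ≤ l

/-- `r` is a second reference of the combination that is chosen, of which `l` characters are used,
if `R` remains after the first reference. -/
structure SecondRef (A : Finset ℕ) (F : List (List ℕ)) (R : List ℕ) (r : Ref) (l : ℕ) : Prop where
  valid : r.Valid A F
  take_eq : (r.str F).take l = R.take l
  le_str : l ≤ (r.str F).length
  le : l ≤ R.length
  char : (r.str F).length = 1 ∨ l = 1 → r.IsChar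
  zero : l = 0 → r = .factor 0 ∧ R = []
  max : ∀ s ∈ F, ∀ k ≤ s.length, s.take k <+: R → k ≤ l

theorem Ref.str_factor_mem {y : ℕ} (h0 : y ≠ 0) (hy : y ≤ F.length) :
    (Ref.factor y).str F ∈ F := by
  obtain ⟨y, rfl⟩ := Nat.exists_eq_succ_of_ne_zero h0
  have : y < F.length := hy
  simp [Ref.str, this]

theorem Ref.str_factor {y : ℕ} {s : List ℕ} (h0 : y ≠ 0) (hy : F[y - 1]? = some s) :
    (Ref.factor y).str F = s ∧ y ≤ F.length := by
  obtain ⟨y, rfl⟩ := Nat.exists_eq_succ_of_ne_zero h0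
  obtain ⟨h1, h2⟩ := List.getElem?_eq_some_iff.1 hy
  simp only [Nat.succ_eq_add_one, Nat.add_sub_cancel] at h1 h2
  exact ⟨by simp [Ref.str, h1, h2], h1⟩

theorem FirstRef.isLongestRef {r : Ref} {l : ℕ} (h : FirstRef A F R r l) :
    IsLongestRef A F R r := by
  refine ⟨h.valid, h.str_eq ▸ List.take_prefix _ _, fun r' hv hp => ?_⟩
  rw [h.str_eq, List.length_take, min_eq_left h.le]
  cases r' with
  | char a => exact h.pos
  | factor y =>
    exact h.max _ (Ref.str_factor_mem (fun h0 => hv.2 (by rw [h0])) hv.1) hp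

/-- References may differ, but every longest first reference has the same length l₁. What a
competing combination uses of its second reference is thus a prefix of the same rest of the text,
and is bounded by `SecondRef.max` if it is part of a factor. -/
theorem comb_len_le {r₁ r₂ : Ref} {l₁ l₂ : ℕ} (h₁ : FirstRef A F R r₁ l₁)
    (h₂ : SecondRef A F (R.drop l₁) r₂ l₂) {q₁ q₂ : Ref} {m : ℕ}
    (hq : IsCandidate A F R (.comb q₁ q₂ m)) : m ≤ l₁ + l₂ := by
  obtain ⟨⟨hv, hp, hm⟩, hv₂, -, hm₂, hp₂⟩ := hq
  have hl : (q₁.str F).length = l₁ := by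
    have e1 := h₁.isLongestRef.2.2 _ hv hp
    have e2 := hm _ h₁.valid h₁.isLongestRef.2.1
    rw [h₁.str_eq, List.length_take, min_eq_left h₁.le] at e1 e2
    omega
  by_contra! hlt
  obtain ⟨k, rfl⟩ : ∃ k, m = l₁ + k := ⟨m - l₁, by omega⟩
  rw [hl] at hm₂
  have hpre : (q₂.str F).take k <+: R.drop l₁ := by
    simp only [Production.str] at hp₂
    rw [← hl, List.take_length_add_append] at hp₂
    obtain ⟨t, ht⟩ := hp₂
    exact ⟨t, by rw [← ht, ← hl]; simp⟩
  have hk : k ≤ (q₂.str F).length := by omega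
  have hk0 : 0 < k := by omega
  cases q₂ with
  | char a =>
    simp only [Ref.str, List.length_singleton] at hk
    have := hpre.length_le
    simp only [Ref.str, List.length_take, List.length_singleton] at this
    -- A character contributes only k = 1, so l₂ would be 0. But then `SecondRef.zero` leaves no
    -- text that it could match.
    have h0 : l₂ = 0 := by omega
    rw [(h₂.zero h0).2] at this
    simp at this
    omega
  | factor y =>
    by_cases h0 : y = 0
    · subst h0
      simp [Ref.str] at hk
      omega
    · have := h₂.max _ (Ref.str_factor_mem h0 hv₂) k hk hpre
      omega

/-- Here t bounds all truncations and l₁ + l₂ all combinations, so comparing two numbers settles the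
greedy choice. A tie goes to the combination, as the convention demands. -/
theorem isChoice_comb {r₁ r₂ : Ref} {l₁ l₂ t : ℕ} (h₁ : FirstRef A F R r₁ l₁)
    (h₂ : SecondRef A F (R.drop l₁) r₂ l₂)
    (ht : ∀ s ∈ F, ∀ k ≤ s.length, s.take k <+: R → k ≤ t) (hl : t ≤ l₁ + l₂) :
    IsChoice A F R (.comb r₁ r₂ (l₁ + l₂)) ∧
      (Production.comb r₁ r₂ (l₁ + l₂)).str F = R.take (l₁ + l₂) := by
  have hlen : (r₁.str F).length = l₁ := by rw [h₁.str_eq]; simp [h₁.le]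
  have hstr : (Production.comb r₁ r₂ (l₁ + l₂)).str F = R.take (l₁ + l₂) := by
    simp only [Production.str]
    conv_lhs => rw [← hlen]
    rw [List.take_length_add_append, h₂.take_eq, h₁.str_eq, ← List.take_add]
  have hpos := h₁.pos
  refine ⟨⟨⟨h₁.isLongestRef, h₂.valid, by omega, ?_, ?_⟩, ?_, ?_, ?_, ?_⟩, hstr⟩
  · rw [hlen]; have := h₂.le_str; omega
  · rw [hstr]; exact List.take_prefix _ _
  · intro q hq
    cases q with
    | comb q₁ q₂ m => exact comb_len_le h₁ h₂ hq
    | trunc y m =>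
      obtain ⟨hy, hy', hm, hm', hp⟩ := hq
      exact (ht _ (Ref.str_factor_mem (by omega) hy') m hm' hp).trans hl
  · rw [hlen]; exact h₁.char
  · rw [hlen]
    rintro (h | h)
    · exact h₂.char (.inl h)
    · exact h₂.char (.inr (by omega))
  · rw [hlen]
    intro h
    exact (h₂.zero (by omega)).1

/-- The strict inequality is what the convention asks of a truncation: every combination is shorter.
Any factor that extends the matched prefix can be named, not only a particular one. -/
theorem isChoice_trunc {r₁ r₂ : Ref} {l₁ l₂ t y : ℕ} {s : List ℕ} (h₁ : FirstRef A F R r₁ l₁)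
    (h₂ : SecondRef A F (R.drop l₁) r₂ l₂)
    (ht : ∀ s ∈ F, ∀ k ≤ s.length, s.take k <+: R → k ≤ t) (hl : l₁ + l₂ < t)
    (htR : t ≤ R.length) (h0 : y ≠ 0) (hy : F[y - 1]? = some s) (hs : R.take t <+: s) :
    IsChoice A F R (.trunc y t) ∧ (Production.trunc y t).str F = R.take t := by
  obtain ⟨hs', hy'⟩ := Ref.str_factor h0 hy
  have hlen := hs.length_le
  simp only [List.length_take, min_eq_left htR] at hlen
  have hstr : (Production.trunc y t).str F = R.take t := by
    simp only [Production.str]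
    rw [hs', List.prefix_iff_eq_take.1 hs]
    simp [htR]
  refine ⟨⟨⟨by omega, hy', by omega, by rwa [hs'], by rw [hstr]; exact List.take_prefix _ _⟩,
    ?_, fun q₁ q₂ m hq => (comb_len_le h₁ h₂ hq).trans_lt hl⟩, hstr⟩
  intro q hq
  cases q with
  | comb q₁ q₂ m => exact (comb_len_le h₁ h₂ hq).trans hl.le
  | trunc y m =>
    obtain ⟨hy, hy', hm, hm', hp⟩ := hq
    exact ht _ (Ref.str_factor_mem (by omega) hy') m hm' hp

end choice

end LZDPlus

namespace LZDPlus

open WordRAM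

/-! ## The main program

Registers: 0 the position in the text, 1 the number of revealed characters, 2 the number of factors,
3 the number of nodes. A search uses 4 the position of the pattern, 5 the number of matched
characters, 6 the node, 7 the edge, 8 and 9 the mark and the length of the last marked node, 10 a
flag, 11 the next character, 12 whether there is one. The fields of a node: 0 the position of its
string, 1 its length, 2 its mark, 3 the number of a factor that extends it; field 4 of an edge is
its child. -/

/-- Reveal the character after the matched ones. -/
def nextChar : Cmd :=
  .seq (.ite (.bin .lt (.bin .add (.reg 4) (.reg 5)) (.reg 1)) (.set 12 (.const 1))
    (.seq (.next 12) (.ite (.reg 12) (.set 1 (.bin .add (.reg 1) (.const 1))) .skip)))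
  (.text 11 (.bin .add (.reg 4) (.reg 5)))

/-- Follow an edge from a node. -/
def followEdge : Cmd :=
  .seq (.set 40 (.reg 6)) <| .seq (.set 41 (.reg 11)) <| .seq .find <|
  .ite (.reg 42)
    (.seq (.set 7 (.reg 42)) <| .seq (.load 6 4 (.reg 7)) <|
      .set 5 (.bin .add (.reg 5) (.const 1)))
    (.set 10 (.const 0))

/-- Compare the next character with the one on the edge. -/
def followText : Cmd :=
  .seq (.load 14 0 (.reg 6)) <| .seq (.text 14 (.bin .add (.reg 14) (.reg 5))) <|
  .ite (.bin .eq (.reg 14) (.reg 11)) (.set 5 (.bin .add (.reg 5) (.const 1)))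
    (.set 10 (.const 0))

/-- Remember the node if it has been reached and is marked. -/
def noteMark : Cmd :=
  .seq (.load 13 1 (.reg 6)) <|
  .ite (.bin .eq (.reg 13) (.reg 5))
    (.seq (.load 14 2 (.reg 6)) <|
      .ite (.reg 14) (.seq (.set 8 (.reg 14)) (.set 9 (.reg 5))) .skip)
    .skip

/-- Match one more character. -/
def searchStep : Cmd :=
  .seq nextChar <|
  .ite (.reg 12)
    (.seq (.load 13 1 (.reg 6)) <|
      .seq (.ite (.bin .eq (.reg 13) (.reg 5)) followEdge followText) <|
      .ite (.reg 10) noteMark .skip)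
    (.set 10 (.const 0))

/-- Match as many characters as possible from a position of the text. -/
def search : Cmd :=
  .seq (.set 5 (.const 0)) <| .seq (.set 6 (.const 0)) <| .seq (.set 7 (.const 0)) <|
  .seq (.set 8 (.const 0)) <| .seq (.set 9 (.const 0)) <| .seq (.set 10 (.const 1)) <|
  .loop (.reg 10) searchStep

section spec

variable {w : ℕ} {T : List ℕ} {A : Finset ℕ} {L K : ℕ}

/-- The string of a node. -/
def nodeStr (T : List ℕ) (nd : ℕ → ℕ → ℕ) (i : ℕ) : List ℕ := (T.drop (nd 0 i)).take (nd 1 i)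

/-- The revealed part of the text is known. -/
structure Revealed (T : List ℕ) (v : View) : Prop where
  reg : v.reg 1 = v.revealed
  le : v.revealed ≤ T.length

/-- `v'` differs from `v` only in the registers `xs` and in what has been revealed. -/
structure OnlyRegs (xs : List ℕ) (v v' : View) : Prop where
  reg : ∀ x ∉ xs, v'.reg x = v.reg x
  nd : v'.nd = v.nd
  out : v'.out = v.out
  keys : v'.keys = v.keys
  revealed : v.revealed ≤ v'.revealed

theorem OnlyRegs.trans {xs : List ℕ} {v v' v'' : View} (h : OnlyRegs xs v v')
    (h' : OnlyRegs xs v' v'') : OnlyRegs xs v v'' :=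
  ⟨fun x hx => (h'.reg x hx).trans (h.reg x hx), h'.nd.trans h.nd, h'.out.trans h.out,
    h'.keys.trans h.keys, h.revealed.trans h'.revealed⟩

theorem OnlyRegs.mono {xs ys : List ℕ} {v v' : View} (h : OnlyRegs xs v v') (hxy : xs ⊆ ys) :
    OnlyRegs ys v v' :=
  ⟨fun x hx => h.reg x fun h => hx (hxy h), h.nd, h.out, h.keys, h.revealed⟩

/-- The effect of `nextChar` at the position `p`. -/
structure CharRead (T : List ℕ) (p : ℕ) (v v' : View) : Prop where
  only : OnlyRegs [1, 11, 12] v v'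
  rev : Revealed T v'
  le : v'.revealed ≤ max v.revealed (p + 1)
  time : v'.time ≤ v.time + 30
  avail : v'.reg 12 ≠ 0 → p < v'.revealed ∧ T[p]? = some (v'.reg 11)
  no_avail : v'.reg 12 = 0 → p = T.length ∧ v'.revealed = T.length

/-- The assumption `hW`, which recurs in all specifications, keeps positions and the addresses of at
most 2 * n + 4 records below 2 ^ w, so that no arithmetic wraps around. -/
theorem nextChar_spec {v : View} (hW : 1024 * (T.length + 2) ≤ 2 ^ w) (hv : Revealed T v)
    (hp : v.reg 4 + v.reg 5 ≤ v.revealed) :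
    nextChar.wp w T A L K (CharRead T (v.reg 4 + v.reg 5) v) v := by
  have h1 := hv.reg
  have h2 := hv.le
  have e1 : (v.reg 4 + v.reg 5) % 2 ^ w = v.reg 4 + v.reg 5 := Nat.mod_eq_of_lt (by omega)
  have e2 : 1 % 2 ^ w = 1 := Nat.mod_eq_of_lt (by omega)
  simp only [nextChar, cwp_seq, cwp_ite, cwp_set, cwp_next, cwp_text, cwp_skip, View.setReg,
    View.tick, Expr.eval, BinOp.eval, Expr.cost, Function.update_apply]
  simp [e1, e2, h1]
  refine ⟨fun h => ?_, fun h => ⟨fun h' => ?_, fun h' => ?_⟩⟩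
  · have h3 : v.reg 4 + v.reg 5 < T.length := by omega
    refine ⟨⟨fun x hx => ?_, rfl, rfl, rfl, le_rfl⟩, ⟨?_, h2⟩, ?_, ?_, ?_, ?_⟩
    · simp at hx; simp [hx]
    · simp [h1]
    · simp
    · simp
    · simp [h, h3]
    · simp
  · have h3 : v.reg 4 + v.reg 5 < T.length := by omega
    have e3 : (v.revealed + 1) % 2 ^ w = v.revealed + 1 := Nat.mod_eq_of_lt (by omega)
    have h4 : v.reg 4 + v.reg 5 < v.revealed + 1 := by omega
    simp only [e3]
    refine ⟨⟨fun x hx => ?_, rfl, rfl, rfl, Nat.le_succ _⟩, ⟨?_, h'⟩, ?_, ?_, ?_, ?_⟩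
    · simp at hx; simp [hx]
    · simp
    · simp; omega
    · simp
    · simp [h4, h3]
      intro h5; omega
    · simp
  · refine ⟨⟨fun x hx => ?_, rfl, rfl, rfl, le_rfl⟩, ⟨?_, h2⟩, ?_, ?_, ?_, ?_⟩
    · simp at hx; simp [hx]
    · simp [h1]
    · simp
    · simp
    · simp
    · simp; omega

/-- The effect of `followEdge`. -/
structure EdgeFollowed (K : ℕ) (v v' : View) : Prop where
  only : OnlyRegs [5, 6, 7, 10, 40, 41, 42] v v'
  revealed : v'.revealed = v.revealed
  time : v'.time ≤ v.time + K + 40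
  next : (keyIndex v.keys (v.reg 6, v.reg 11) ≠ 0 ∧
      v'.reg 6 = v.nd 4 (keyIndex v.keys (v.reg 6, v.reg 11)) ∧ v'.reg 5 = v.reg 5 + 1 ∧
      v'.reg 7 = keyIndex v.keys (v.reg 6, v.reg 11) ∧ v'.reg 10 = v.reg 10) ∨
    (keyIndex v.keys (v.reg 6, v.reg 11) = 0 ∧ v'.reg 6 = v.reg 6 ∧ v'.reg 5 = v.reg 5 ∧
      v'.reg 7 = v.reg 7 ∧ v'.reg 10 = 0)

theorem followEdge_spec {v : View} (hW : 1024 * (T.length + 2) ≤ 2 ^ w)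
    (hk : v.keys.length ≤ 2 * T.length + 2) (h6 : v.reg 6 ≤ v.keys.length)
    (h11 : v.reg 11 ∈ A) (h5 : v.reg 5 ≤ T.length) :
    followEdge.wp w T A L K (EdgeFollowed K v) v := by
  have e1 : (v.reg 5 + 1) % 2 ^ w = v.reg 5 + 1 := Nat.mod_eq_of_lt (by omega)
  have e2 : 1 % 2 ^ w = 1 := Nat.mod_eq_of_lt (by omega)
  have hle := @keyIndex_le v.keys (v.reg 6, v.reg 11)
  simp only [followEdge, cwp_seq, cwp_ite, cwp_set, cwp_find, cwp_load, View.setReg,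
    View.tick, Expr.eval, BinOp.eval, Expr.cost, View.Addressable]
  simp [e1, e2, h11]
  refine ⟨by omega, fun h => ⟨⟨by omega, by omega⟩, ?_⟩, fun h => ?_⟩
  · refine ⟨⟨fun x hx => ?_, rfl, rfl, rfl, le_rfl⟩, rfl, ?_, .inl ?_⟩
    · simp at hx; simp [hx]
    · simp; omega
    · simp [h]
  · refine ⟨⟨fun x hx => ?_, rfl, rfl, rfl, le_rfl⟩, rfl, ?_, .inr ?_⟩
    · simp at hx; simp [hx]
    · simp; omega
    · simp [h]

/-- The effect of `followText`. -/
structure TextFollowed (T : List ℕ) (v v' : View) : Prop where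
  only : OnlyRegs [5, 10, 14] v v'
  revealed : v'.revealed = v.revealed
  time : v'.time ≤ v.time + 40
  next : (T[v.nd 0 (v.reg 6) + v.reg 5]? = some (v.reg 11) ∧ v'.reg 5 = v.reg 5 + 1 ∧
      v'.reg 10 = v.reg 10) ∨
    (T[v.nd 0 (v.reg 6) + v.reg 5]? ≠ some (v.reg 11) ∧ v'.reg 5 = v.reg 5 ∧ v'.reg 10 = 0)

theorem followText_spec {v : View} (hW : 1024 * (T.length + 2) ≤ 2 ^ w) (hv : Revealed T v)
    (hk : v.keys.length ≤ 2 * T.length + 2) (h6 : v.reg 6 ≤ v.keys.length)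
    (h5 : v.nd 0 (v.reg 6) + v.reg 5 < v.revealed) :
    followText.wp w T A L K (TextFollowed T v) v := by
  have hle := hv.le
  have e1 : (v.reg 5 + 1) % 2 ^ w = v.reg 5 + 1 := Nat.mod_eq_of_lt (by omega)
  have e2 : 1 % 2 ^ w = 1 := Nat.mod_eq_of_lt (by omega)
  have e3 : (v.nd 0 (v.reg 6) + v.reg 5) % 2 ^ w = v.nd 0 (v.reg 6) + v.reg 5 :=
    Nat.mod_eq_of_lt (by omega)
  have h3 : v.nd 0 (v.reg 6) + v.reg 5 < T.length := by omega
  simp only [followText, cwp_seq, cwp_ite, cwp_set, cwp_text, cwp_load, View.setReg,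
    View.tick, Expr.eval, BinOp.eval, Expr.cost, View.Addressable]
  simp [e1, e2, e3, h5, h3]
  refine ⟨⟨by omega, by omega⟩, fun h => ?_, fun h => ?_⟩
  · refine ⟨⟨fun x hx => ?_, rfl, rfl, rfl, le_rfl⟩, rfl, ?_, .inl ?_⟩
    · simp at hx; simp [hx]
    · simp
    · simp [h, h3]
  · refine ⟨⟨fun x hx => ?_, rfl, rfl, rfl, le_rfl⟩, rfl, ?_, .inr ?_⟩
    · simp at hx; simp [hx]
    · simp
    · simp [h, h3]

/-- The effect of `noteMark`. -/
structure MarkNoted (v v' : View) : Prop where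
  only : OnlyRegs [8, 9, 13, 14] v v'
  revealed : v'.revealed = v.revealed
  time : v'.time ≤ v.time + 40
  next : (v.nd 1 (v.reg 6) = v.reg 5 ∧ v.nd 2 (v.reg 6) ≠ 0 ∧ v'.reg 8 = v.nd 2 (v.reg 6) ∧
      v'.reg 9 = v.reg 5) ∨
    ((v.nd 1 (v.reg 6) = v.reg 5 → v.nd 2 (v.reg 6) = 0) ∧ v'.reg 8 = v.reg 8 ∧
      v'.reg 9 = v.reg 9)

theorem noteMark_spec {v : View} (hW : 1024 * (T.length + 2) ≤ 2 ^ w)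
    (hk : v.keys.length ≤ 2 * T.length + 2) (h6 : v.reg 6 ≤ v.keys.length) :
    noteMark.wp w T A L K (MarkNoted v) v := by
  simp only [noteMark, cwp_seq, cwp_ite, cwp_set, cwp_skip, cwp_load, View.setReg,
    View.tick, Expr.eval, BinOp.eval, Expr.cost, View.Addressable]
  simp
  refine ⟨⟨by omega, by omega⟩, fun h => ⟨⟨by omega, by omega⟩, fun h' => ?_, fun h' => ?_⟩,
    fun h => ?_⟩
  · refine ⟨⟨fun x hx => ?_, rfl, rfl, rfl, le_rfl⟩, rfl, ?_, .inl ?_⟩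
    · simp at hx; simp [hx]
    · simp
    · simp [h, h']
  · refine ⟨⟨fun x hx => ?_, rfl, rfl, rfl, le_rfl⟩, rfl, ?_, .inr ?_⟩
    · simp at hx; simp [hx]
    · simp
    · simp [h, h']
  · refine ⟨⟨fun x hx => ?_, rfl, rfl, rfl, le_rfl⟩, rfl, ?_, .inr ?_⟩
    · simp at hx; simp [hx]
    · simp
    · simp [h]

/-- The memory represents a trie of the strings `F`. -/
structure Rep (T : List ℕ) (F : List (List ℕ)) (v : View) : Prop where
  trie : Trie F v.keys (nodeStr T v.nd) (v.nd 2) (v.nd 3) (v.nd 4)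
  bound : ∀ i ≤ v.keys.length, v.nd 0 i + v.nd 1 i ≤ v.revealed
  keys_le : v.keys.length ≤ 2 * T.length + 2

theorem Rep.length_nodeStr {F : List (List ℕ)} {v : View} (h : Rep T F v) (hv : Revealed T v)
    {i : ℕ} (hi : i ≤ v.keys.length) : (nodeStr T v.nd i).length = v.nd 1 i := by
  have := h.bound i hi
  have := hv.le
  simp [nodeStr]; omega

theorem getElem?_nodeStr {nd : ℕ → ℕ → ℕ} {i d : ℕ} (hd : d < nd 1 i) :
    (nodeStr T nd i)[d]? = T[nd 0 i + d]? := by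
  rw [nodeStr, List.getElem?_take_of_lt hd, List.getElem?_drop]

/-- The registers that a search changes. -/
def searchRegs : List ℕ := [1, 5, 6, 7, 8, 9, 10, 11, 12, 13, 14, 40, 41, 42]

/-- The invariant of a search from the position `p` that started in `v₀`, and the number of
characters that it may have revealed. -/
structure Searching (T : List ℕ) (p : ℕ) (v₀ v : View) : Prop where
  only : OnlyRegs searchRegs v₀ v
  rev : Revealed T v
  locus : Locus v₀.keys (nodeStr T v₀.nd) (v₀.nd 4) (T.drop p) (v.reg 6) (v.reg 5) (v.reg 7)
  best : Best v₀.keys (nodeStr T v₀.nd) (v₀.nd 2) (T.drop p) (v.reg 5) (v.reg 8) (v.reg 9)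
  reach : p + v.reg 5 ≤ v.revealed

/-- A search that goes on. -/
structure SearchOn (T : List ℕ) (p : ℕ) (v₀ v : View) : Prop extends Searching T p v₀ v where
  go : v.reg 10 ≠ 0
  le : v.revealed ≤ max v₀.revealed (p + v.reg 5)

/-- A search that has ended. -/
structure SearchDone (T : List ℕ) (p : ℕ) (v₀ v : View) : Prop extends Searching T p v₀ v where
  halted : v.reg 10 = 0
  le : v.revealed ≤ max v₀.revealed (p + v.reg 5 + 1)
  stuck : Stuck v₀.keys (nodeStr T v₀.nd) (T.drop p) (v.reg 6) (v.reg 5)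
  read : p + v.reg 5 = T.length ∨ p + v.reg 5 < v.revealed

theorem Rep.only {F : List (List ℕ)} {xs : List ℕ} {v v' : View} (h : Rep T F v)
    (h' : OnlyRegs xs v v') : Rep T F v' := by
  refine ⟨?_, ?_, ?_⟩
  · rw [h'.nd, h'.keys]; exact h.trie
  · rw [h'.nd, h'.keys]; exact fun i hi => (h.bound i hi).trans h'.revealed
  · rw [h'.keys]; exact h.keys_le

/-- A step either matches one character, which moves the locus by `Locus.down` or `Locus.forward`,
or fails. A failure has one of three causes, which are the cases of `Stuck`: the end of the text, a
missing edge, or a mismatch inside an edge. -/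
theorem searchStep_spec {F : List (List ℕ)} {p : ℕ} {v₀ v : View}
    (hW : 1024 * (T.length + 2) ≤ 2 ^ w) (hA : ∀ a ∈ T, a ∈ A) (hR : Rep T F v₀)
    (hp : v₀.reg 4 = p) (h : SearchOn T p v₀ v) :
    searchStep.wp w T A L K (fun v' => v'.time ≤ v.time + K + 150 ∧
      (SearchOn T p v₀ v' ∧ v'.reg 5 = v.reg 5 + 1 ∨
        SearchDone T p v₀ v' ∧ v'.reg 5 = v.reg 5)) v := by
  have h4 : v.reg 4 = p := by rw [h.only.reg 4 (by simp [searchRegs]), hp]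
  have hl := h.locus
  have hrl := h.rev.le
  have hreach := h.reach
  have hk := hR.keys_le
  have hRv := hR.only h.only
  rw [searchStep, cwp_seq]
  refine Cmd.wp_mono (nextChar_spec hW h.rev (by rw [h4]; exact h.reach)) fun v₁ h₁ => ?_
  rw [h4] at h₁
  have e5 : v₁.reg 5 = v.reg 5 := h₁.only.reg 5 (by simp)
  have e6 : v₁.reg 6 = v.reg 6 := h₁.only.reg 6 (by simp)
  have e7 : v₁.reg 7 = v.reg 7 := h₁.only.reg 7 (by simp)
  have e8 : v₁.reg 8 = v.reg 8 := h₁.only.reg 8 (by simp)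
  have e9 : v₁.reg 9 = v.reg 9 := h₁.only.reg 9 (by simp)
  have e10 : v₁.reg 10 = v.reg 10 := h₁.only.reg 10 (by simp)
  have end1 : v₁.nd = v₀.nd := h₁.only.nd.trans h.only.nd
  have ekeys1 : v₁.keys = v₀.keys := h₁.only.keys.trans h.only.keys
  have hrev1 := h₁.only.revealed
  have ht1 := h₁.time
  have hle1 := h₁.le
  have hle := h.le
  have only₁ : OnlyRegs searchRegs v₀ v₁ := h.only.trans (h₁.only.mono (by simp [searchRegs]))
  have hnode := hl.node
  have hlen : (nodeStr T v₀.nd (v.reg 6)).length = v₀.nd 1 (v.reg 6) := by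
    have := hRv.length_nodeStr h.rev (i := v.reg 6) (by rw [h.only.keys]; exact hnode)
    rwa [h.only.nd] at this
  have hlelen := hl.le_len
  rw [hlen] at hlelen
  rw [cwp_ite]
  refine ⟨fun h12 => ?_, fun h12 => ?_⟩
  · obtain ⟨hread, hchar⟩ := h₁.avail h12
    have hcR : (T.drop p)[v.reg 5]? = some (v₁.reg 11) := by rw [List.getElem?_drop, hchar]
    have hcA : v₁.reg 11 ∈ A := hA _ (List.mem_of_getElem? hchar)
    rw [cwp_seq, cwp_load, cwp_seq, cwp_ite]
    refine ⟨⟨?_, ?_⟩, ?_⟩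
    · simp [Expr.eval, View.tick, e6]; omega
    · simp [Expr.eval, View.tick, e6, ekeys1]; omega
    set v₂ : View := ((v₁.tick ((Expr.reg 12).cost + 1)).setReg 13
      ((v₁.tick ((Expr.reg 12).cost + 1)).nd 1
        (Expr.eval w (v₁.tick ((Expr.reg 12).cost + 1)).reg (.reg 6)))).tick
        ((Expr.reg 6).cost + 5) with hv₂
    have only₂ : OnlyRegs [13] v₁ v₂ := by
      refine ⟨fun x hx => ?_, rfl, rfl, rfl, le_rfl⟩
      simp at hx; simp [hv₂, View.tick, View.setReg, hx]
    have r2 : v₂.revealed = v₁.revealed := rfl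
    have t2 : v₂.time = v₁.time + 8 := by simp [hv₂, View.tick, View.setReg, Expr.cost]
    have e13 : v₂.reg 13 = v₀.nd 1 (v.reg 6) := by
      simp [hv₂, View.tick, View.setReg, Expr.eval, e6, end1]
    have e25 : v₂.reg 5 = v.reg 5 := (only₂.reg 5 (by simp)).trans e5
    have e26 : v₂.reg 6 = v.reg 6 := (only₂.reg 6 (by simp)).trans e6
    have e27 : v₂.reg 7 = v.reg 7 := (only₂.reg 7 (by simp)).trans e7
    have e28 : v₂.reg 8 = v.reg 8 := (only₂.reg 8 (by simp)).trans e8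
    have e29 : v₂.reg 9 = v.reg 9 := (only₂.reg 9 (by simp)).trans e9
    have e210 : v₂.reg 10 = v.reg 10 := (only₂.reg 10 (by simp)).trans e10
    have e211 : v₂.reg 11 = v₁.reg 11 := only₂.reg 11 (by simp)
    have only₂' : OnlyRegs searchRegs v₀ v₂ := only₁.trans (only₂.mono (by simp [searchRegs]))
    have end2 : v₂.nd = v₀.nd := only₂'.nd
    have ekeys2 : v₂.keys = v₀.keys := only₂'.keys
    have rv₂ : Revealed T v₂ := ⟨(only₂.reg 1 (by simp)).trans h₁.rev.reg, h₁.rev.le⟩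
    -- The step has failed on a character that was read: the locus and the best mark stay as they
    -- were, and the failure itself is the proof of `Stuck`.
    have hstuck : ∀ v₃ : View, OnlyRegs searchRegs v₀ v₃ → v₃.revealed = v₁.revealed →
        v₃.reg 5 = v.reg 5 → v₃.reg 6 = v.reg 6 → v₃.reg 7 = v.reg 7 → v₃.reg 8 = v.reg 8 →
        v₃.reg 9 = v.reg 9 → v₃.reg 10 = 0 → v₃.reg 1 = v₃.revealed →
        (v.reg 5 < v₀.nd 1 (v.reg 6) ∧
          (nodeStr T v₀.nd (v.reg 6))[v.reg 5]? ≠ some (v₁.reg 11) ∨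
          v.reg 5 = v₀.nd 1 (v.reg 6) ∧ keyIndex v₀.keys (v.reg 6, v₁.reg 11) = 0) →
        SearchDone T p v₀ v₃ := by
      intro v₃ o hr r5 r6 r7 r8 r9 r10 r1 hs
      refine { only := o, rev := ⟨r1, hr ▸ h₁.rev.le⟩, locus := ?_, best := ?_, reach := ?_,
               halted := r10, le := ?_, stuck := ?_, read := ?_ }
      · rw [r5, r6, r7]; exact hl
      · rw [r5, r8, r9]; exact h.best
      · omega
      · omega
      · rw [r5, r6]
        exact .inr ⟨_, hcR, by rwa [hlen]⟩
      · right; omega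
    -- The step has matched a character: `noteMark` then restores the invariant about the best mark
    -- at the new depth.
    have hgo : ∀ v₃ : View, OnlyRegs searchRegs v₀ v₃ → v₃.revealed = v₁.revealed →
        v₃.reg 5 = v.reg 5 + 1 → v₃.reg 8 = v.reg 8 →
        v₃.reg 9 = v.reg 9 → v₃.reg 10 ≠ 0 → v₃.reg 1 = v₃.revealed →
        Locus v₀.keys (nodeStr T v₀.nd) (v₀.nd 4) (T.drop p) (v₃.reg 6) (v.reg 5 + 1)
          (v₃.reg 7) → v₃.time ≤ v.time + K + 90 →
        noteMark.wp w T A L K (fun v' => v'.time ≤ v.time + K + 150 ∧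
          (SearchOn T p v₀ v' ∧ v'.reg 5 = v.reg 5 + 1 ∨
            SearchDone T p v₀ v' ∧ v'.reg 5 = v.reg 5)) (v₃.tick ((Expr.reg 10).cost + 1)) := by
      intro v₃ o hr r5 r8 r9 r10 r1 hloc ht
      have e1 : (v₃.tick ((Expr.reg 10).cost + 1)).reg = v₃.reg := rfl
      have e2 : (v₃.tick ((Expr.reg 10).cost + 1)).keys = v₃.keys := rfl
      have e3 : (v₃.tick ((Expr.reg 10).cost + 1)).nd = v₃.nd := rfl
      have e4 : (v₃.tick ((Expr.reg 10).cost + 1)).time = v₃.time + 2 := rfl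
      refine Cmd.wp_mono (noteMark_spec hW (by rw [e2, o.keys]; exact hk)
        (by rw [e1, e2, o.keys]; exact hloc.node)) fun v₄ h₄ => ?_
      have ht4 := h₄.time
      have o4 : OnlyRegs [8, 9, 13, 14] v₃ v₄ :=
        ⟨h₄.only.reg, h₄.only.nd, h₄.only.out, h₄.only.keys, h₄.only.revealed⟩
      have rr : v₄.revealed = v₃.revealed := h₄.revealed
      have r45 : v₄.reg 5 = v.reg 5 + 1 := (o4.reg 5 (by simp)).trans r5
      refine ⟨by omega, .inl ⟨?_, r45⟩⟩
      have hnx := h₄.next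
      simp only [e1, e3, o.nd, r5, r8, r9] at hnx
      have hlen' : (nodeStr T v₀.nd (v₃.reg 6)).length = v₀.nd 1 (v₃.reg 6) := by
        have := hRv.length_nodeStr h.rev (i := v₃.reg 6) (by rw [h.only.keys]; exact hloc.node)
        rwa [h.only.nd] at this
      refine { only := o.trans (o4.mono (by simp [searchRegs])), rev := ⟨?_, ?_⟩, locus := ?_,
               best := ?_, reach := ?_, go := ?_, le := ?_ }
      · rw [rr, o4.reg 1 (by simp), r1]
      · rw [rr, hr]; exact h₁.rev.le
      · rw [r45, o4.reg 6 (by simp), o4.reg 7 (by simp)]; exact hloc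
      · rw [r45]
        rcases hnx with ⟨n1, n2, n3, n4⟩ | ⟨n1, n2, n3⟩
        · rw [n3, n4]
          exact Best.update hloc (by rw [hlen', n1]) n2
        · rw [n2, n3]
          exact Best.skip hR.trie hloc h.best fun hh => n1 (by rw [← hlen', hh])
      · omega
      · rw [o4.reg 10 (by simp)]; exact r10
      · omega
    have hfin : ∀ v₃ : View, OnlyRegs searchRegs v₀ v₃ → v₃.revealed = v₁.revealed →
        v₃.reg 1 = v₃.revealed → v₃.time ≤ v.time + K + 90 → v₃.reg 8 = v.reg 8 →
        v₃.reg 9 = v.reg 9 →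
        (v₃.reg 5 = v.reg 5 + 1 ∧ v₃.reg 10 ≠ 0 ∧
            Locus v₀.keys (nodeStr T v₀.nd) (v₀.nd 4) (T.drop p) (v₃.reg 6) (v.reg 5 + 1)
              (v₃.reg 7) ∨
          v₃.reg 5 = v.reg 5 ∧ v₃.reg 6 = v.reg 6 ∧ v₃.reg 7 = v.reg 7 ∧ v₃.reg 10 = 0 ∧
            (v.reg 5 < v₀.nd 1 (v.reg 6) ∧
              (nodeStr T v₀.nd (v.reg 6))[v.reg 5]? ≠ some (v₁.reg 11) ∨
              v.reg 5 = v₀.nd 1 (v.reg 6) ∧ keyIndex v₀.keys (v.reg 6, v₁.reg 11) = 0)) →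
        Cmd.wp w T A L K (.ite (.reg 10) noteMark .skip) (fun v' => v'.time ≤ v.time + K + 150 ∧
          (SearchOn T p v₀ v' ∧ v'.reg 5 = v.reg 5 + 1 ∨
            SearchDone T p v₀ v' ∧ v'.reg 5 = v.reg 5)) v₃ := by
      intro v₃ o hr r1 ht r8 r9 hcase
      rw [cwp_ite, cwp_skip]
      simp only [Expr.eval]
      rcases hcase with ⟨r5, r10, hloc⟩ | ⟨r5, r6, r7, r10, hs⟩
      · exact ⟨fun _ => hgo v₃ o hr r5 r8 r9 r10 r1 hloc ht, fun h0 => absurd h0 r10⟩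
      · refine ⟨fun h0 => absurd r10 h0, fun _ => ?_⟩
        refine ⟨by simp [View.tick, Expr.cost]; omega, .inr ⟨hstuck _
          ⟨o.reg, o.nd, o.out, o.keys, o.revealed⟩ hr r5 r6 r7 r8 r9 r10 r1 hs, r5⟩⟩
    simp only [Expr.eval, BinOp.eval, e13, e25]
    refine ⟨fun hd => ?_, fun hd => ?_⟩
    · have hd : v₀.nd 1 (v.reg 6) = v.reg 5 := by by_contra hne; simp [hne] at hd
      refine Cmd.wp_mono (followEdge_spec hW ?_ ?_ ?_ ?_) fun v₃ h₃ => ?_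
      · simpa [View.tick, ekeys2] using hk
      · simpa [View.tick, ekeys2, e26] using hnode
      · simpa [View.tick, e211] using hcA
      · simp only [View.tick, e25]; omega
      have o3 : OnlyRegs [5, 6, 7, 10, 40, 41, 42] v₂ v₃ :=
        ⟨h₃.only.reg, h₃.only.nd, h₃.only.out, h₃.only.keys, h₃.only.revealed⟩
      have hr3 : v₃.revealed = v₂.revealed := h₃.revealed
      have ht3 := h₃.time
      have hn3 := h₃.next
      simp only [View.tick, e25, e26, e27, e210, e211, ekeys2, end2] at hn3
      simp only [View.tick, Expr.cost, t2] at ht3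
      refine hfin v₃ (only₂'.trans (o3.mono (by simp [searchRegs]))) (hr3.trans r2) ?_ (by omega)
        ((o3.reg 8 (by simp)).trans e28) ((o3.reg 9 (by simp)).trans e29) ?_
      · rw [o3.reg 1 (by simp), hr3, rv₂.reg]
      · rcases hn3 with ⟨n1, n2, n3, n4, n5⟩ | ⟨n1, n2, n3, n4, n5⟩
        · refine .inl ⟨n3, n5 ▸ h.go, ?_⟩
          rw [n2, n4]
          exact hl.down hR.trie (by rw [hlen, hd]) hcR n1
        · exact .inr ⟨n3, n2, n4, n5, .inr ⟨hd.symm, n1⟩⟩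
    · have hd : ¬ v₀.nd 1 (v.reg 6) = v.reg 5 := by intro hne; simp [hne] at hd
      have hlt : v.reg 5 < v₀.nd 1 (v.reg 6) := by omega
      have hb := hR.bound _ hnode
      have := only₂'.revealed
      refine Cmd.wp_mono (followText_spec hW ⟨rv₂.reg, rv₂.le⟩ ?_ ?_ ?_) fun v₃ h₃ => ?_
      · simpa [View.tick, ekeys2] using hk
      · simpa [View.tick, ekeys2, e26] using hnode
      · simp only [View.tick, e25, e26, end2]; omega
      have o3 : OnlyRegs [5, 10, 14] v₂ v₃ :=
        ⟨h₃.only.reg, h₃.only.nd, h₃.only.out, h₃.only.keys, h₃.only.revealed⟩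
      have hr3 : v₃.revealed = v₂.revealed := h₃.revealed
      have ht3 := h₃.time
      have hn3 := h₃.next
      simp only [View.tick, e25, e26, e210, e211, end2] at hn3
      rw [← getElem?_nodeStr hlt] at hn3
      simp only [View.tick, Expr.cost, t2] at ht3
      refine hfin v₃ (only₂'.trans (o3.mono (by simp [searchRegs]))) (hr3.trans r2) ?_ (by omega)
        ((o3.reg 8 (by simp)).trans e28) ((o3.reg 9 (by simp)).trans e29) ?_
      · rw [o3.reg 1 (by simp), hr3, rv₂.reg]
      · have r6 : v₃.reg 6 = v.reg 6 := (o3.reg 6 (by simp)).trans e26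
        have r7 : v₃.reg 7 = v.reg 7 := (o3.reg 7 (by simp)).trans e27
        rcases hn3 with ⟨n1, n2, n3⟩ | ⟨n1, n2, n3⟩
        · refine .inl ⟨n2, n3 ▸ h.go, ?_⟩
          rw [r6, r7]
          exact hl.forward hR.trie (by rw [hlen]; exact hlt) hcR n1
        · exact .inr ⟨n2, r6, r7, n3, .inl ⟨hlt, n1⟩⟩
  · obtain ⟨hend, hrevT⟩ := h₁.no_avail h12
    rw [cwp_set]
    refine ⟨by simp [View.tick, View.setReg, Expr.cost]; omega, .inr ⟨?_, ?_⟩⟩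
    · have o2 : OnlyRegs searchRegs v₁ (((v₁.tick ((Expr.reg 12).cost + 1)).setReg 10
          (Expr.eval w (v₁.tick ((Expr.reg 12).cost + 1)).reg (Expr.const 0))).tick
          ((Expr.const 0).cost + 1)) := by
        refine ⟨fun x hx => ?_, rfl, rfl, rfl, le_rfl⟩
        simp [searchRegs] at hx; simp [View.tick, View.setReg, hx]
      refine { only := only₁.trans o2, rev := ⟨?_, h₁.rev.le⟩, locus := ?_, best := ?_,
               reach := ?_, halted := ?_, le := ?_, stuck := .inl ?_, read := .inl ?_ }
      · simp [View.tick, View.setReg, h₁.rev.reg]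
      · simpa [View.tick, View.setReg, e5, e6, e7] using hl
      · simpa [View.tick, View.setReg, e5, e8, e9] using h.best
      · simp [View.tick, View.setReg, e5]; omega
      · simp [View.tick, View.setReg, Expr.eval]
      · simp [View.tick, View.setReg, e5]; omega
      · simp [View.tick, View.setReg, e5]; omega
      · simp [View.tick, View.setReg, e5]; omega
    · simp [View.tick, View.setReg, e5]

theorem OnlyRegs.tick {xs : List ℕ} {v v' : View} (h : OnlyRegs xs v v') (t : ℕ) :
    OnlyRegs xs v (v'.tick t) :=
  ⟨h.reg, h.nd, h.out, h.keys, h.revealed⟩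

theorem Revealed.tick {v : View} (h : Revealed T v) (t : ℕ) : Revealed T (v.tick t) :=
  ⟨h.reg, h.le⟩

theorem SearchOn.tick {p : ℕ} {v₀ v : View} (h : SearchOn T p v₀ v) (t : ℕ) :
    SearchOn T p v₀ (v.tick t) :=
  ⟨⟨h.only.tick t, h.rev.tick t, h.locus, h.best, h.reach⟩, h.go, h.le⟩

theorem SearchDone.tick {p : ℕ} {v₀ v : View} (h : SearchDone T p v₀ v) (t : ℕ) :
    SearchDone T p v₀ (v.tick t) :=
  ⟨⟨h.only.tick t, h.rev.tick t, h.locus, h.best, h.reach⟩, h.halted, h.le, h.stuck, h.read⟩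

/-- Every iteration but the last matches a character, so the number of iterations is the number of
matched characters plus one. Each costs at most K + 150, and 2 more for the test of the loop. -/
theorem searchLoop_spec {F : List (List ℕ)} {p : ℕ} {v₀ : View}
    (hW : 1024 * (T.length + 2) ≤ 2 ^ w) (hA : ∀ a ∈ T, a ∈ A) (hR : Rep T F v₀)
    (hp : v₀.reg 4 = p) (n : ℕ) : ∀ v : View, SearchOn T p v₀ v → T.length - p - v.reg 5 = n →
    Cmd.wp w T A L K (.loop (.reg 10) searchStep) (fun v' => SearchDone T p v₀ v' ∧
      v.reg 5 ≤ v'.reg 5 ∧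
      v'.time ≤ v.time + (K + 152) * (v'.reg 5 - v.reg 5 + 1) + 2) v := by
  induction n with
  | zero =>
    intro v h hn
    rw [cwp_loop]
    refine ⟨fun _ => ?_, fun h0 => absurd h0 h.go⟩
    refine Cmd.wp_mono (searchStep_spec hW hA hR hp (h.tick _)) fun v₁ h₁ => ?_
    obtain ⟨ht, h₁ | h₁⟩ := h₁
    -- With no text left, a further match would exceed `le_rem`.
    · exfalso
      have := h₁.1.locus.le_rem
      have h2 := h₁.2
      simp [View.tick] at this h2
      omega
    · have r5 : v₁.reg 5 = v.reg 5 := h₁.2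
      rw [cwp_loop]
      refine ⟨fun h0 => absurd h₁.1.halted h0, fun _ => ⟨h₁.1.tick _, ?_, ?_⟩⟩
      · simp [View.tick, r5]
      · simp [View.tick, r5, Expr.cost] at ht ⊢; omega
  | succ n ih =>
    intro v h hn
    rw [cwp_loop]
    refine ⟨fun _ => ?_, fun h0 => absurd h0 h.go⟩
    refine Cmd.wp_mono (searchStep_spec hW hA hR hp (h.tick _)) fun v₁ h₁ => ?_
    obtain ⟨ht, h₁ | h₁⟩ := h₁
    · have r5 : v₁.reg 5 = v.reg 5 + 1 := h₁.2
      refine Cmd.wp_mono (ih v₁ h₁.1 (by omega)) fun v₂ ⟨h₂, h3, h4⟩ => ⟨h₂, by omega, ?_⟩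
      rw [show v₂.reg 5 - v.reg 5 + 1 = (v₂.reg 5 - v₁.reg 5 + 1) + 1 by omega, mul_add]
      simp [View.tick, Expr.cost] at ht
      omega
    · have r5 : v₁.reg 5 = v.reg 5 := h₁.2
      rw [cwp_loop]
      refine ⟨fun h0 => absurd h₁.1.halted h0, fun _ => ⟨h₁.1.tick _, ?_, ?_⟩⟩
      · simp [View.tick, r5]
      · simp [View.tick, r5, Expr.cost] at ht ⊢; omega

theorem search_spec {F : List (List ℕ)} {p : ℕ} {v : View}
    (hW : 1024 * (T.length + 2) ≤ 2 ^ w) (hA : ∀ a ∈ T, a ∈ A) (hR : Rep T F v)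
    (hv : Revealed T v) (hp : v.reg 4 = p) (hp' : p ≤ v.revealed) :
    search.wp w T A L K (fun v' => SearchDone T p v v' ∧
      v'.time ≤ v.time + (K + 152) * (v'.reg 5 + 1) + 20) v := by
  have e2 : 1 % 2 ^ w = 1 := Nat.mod_eq_of_lt (by omega)
  simp only [search, cwp_seq, cwp_set]
  refine Cmd.wp_mono (searchLoop_spec (F := F) (p := p) (v₀ := v) hW hA hR hp _ _ ?_ rfl)
    fun v' ⟨h1, h2, h3⟩ => ⟨h1, ?_⟩
  · refine { only := ⟨fun x hx => ?_, rfl, rfl, rfl, le_rfl⟩, rev := ⟨?_, hv.le⟩, locus := ?_,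
             best := ?_, reach := ?_, go := ?_, le := ?_ }
    · simp [searchRegs] at hx; simp [View.tick, View.setReg, hx]
    · simp [View.tick, View.setReg, hv.reg]
    · simpa [View.tick, View.setReg, Expr.eval] using hR.trie.locus_root _ _ hR.trie.root
    · simpa [View.tick, View.setReg, Expr.eval] using Trie.best_root _
    · simpa [View.tick, View.setReg, Expr.eval] using hp'
    · simp [View.tick, View.setReg, Expr.eval, e2]
    · simp [View.tick, View.setReg]
  · simp [View.tick, View.setReg, Expr.eval, Expr.cost] at h3
    omega

end spec

end LZDPlus

/-! ### The choice of one factor and its insertion into the trie. -/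

namespace LZDPlus

open WordRAM

/-- Choose the first reference: registers 23 and 24 are its encoding, 25 is its length. -/
def chooseFirst : Cmd :=
  .ite (.bin .lt (.const 1) (.reg 9))
    (.seq (.set 23 (.const 1)) <| .seq (.set 24 (.reg 8)) <| .set 25 (.reg 9))
    (.seq (.set 23 (.const 0)) <| .seq (.text 24 (.reg 0)) <| .set 25 (.const 1))

/-- Choose the second reference: registers 26 and 27 are its encoding, 28 is the length of the
combination. -/
def chooseSecond : Cmd :=
  .ite (.bin .lt (.const 1) (.reg 5))
    (.seq (.set 26 (.const 1)) <| .seq (.load 27 3 (.reg 6)) <|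
      .set 28 (.bin .add (.reg 25) (.reg 5)))
    (.ite (.bin .lt (.reg 4) (.reg 1))
      (.seq (.set 26 (.const 0)) <| .seq (.text 27 (.reg 4)) <|
        .set 28 (.bin .add (.reg 25) (.const 1)))
      (.seq (.set 26 (.const 1)) <| .seq (.set 27 (.const 0)) <| .set 28 (.reg 25)))

/-- Output the production. -/
def output : Cmd :=
  .ite (.bin .lt (.reg 28) (.reg 20))
    (.seq (.load 29 3 (.reg 21)) <| .seq (.emit [.const 1, .reg 29, .reg 20]) <|
      .set 28 (.reg 20))
    (.emit [.const 0, .reg 23, .reg 24, .reg 26, .reg 27, .reg 28])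

/-- Make the point that the first search has reached a node. -/
def splitEdge : Cmd :=
  .seq (.load 13 1 (.reg 21)) <|
  .ite (.bin .lt (.reg 20) (.reg 13))
    (.seq (.store 0 (.reg 3) (.reg 0)) <| .seq (.store 1 (.reg 3) (.reg 20)) <|
      .seq (.store 2 (.reg 3) (.const 0)) <| .seq (.load 13 3 (.reg 21)) <|
      .seq (.store 3 (.reg 3) (.reg 13)) <| .seq (.store 4 (.reg 22) (.reg 3)) <|
      .seq (.store 4 (.reg 3) (.reg 21)) <| .seq (.load 13 0 (.reg 21)) <|
      .seq (.text 41 (.bin .add (.reg 13) (.reg 20))) <| .seq (.set 40 (.reg 3)) <|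
      .seq (.set 43 (.reg 3)) <| .seq .insert <| .seq (.set 21 (.reg 3)) <|
      .set 3 (.bin .add (.reg 3) (.const 1)))
    .skip

/-- Add the factor to the trie, at or below the node that the first search has reached. -/
def addFactor : Cmd :=
  .ite (.bin .eq (.reg 20) (.reg 28)) (.store 2 (.reg 21) (.reg 2))
    (.seq (.store 0 (.reg 3) (.reg 0)) <| .seq (.store 1 (.reg 3) (.reg 28)) <|
      .seq (.store 2 (.reg 3) (.reg 2)) <| .seq (.store 3 (.reg 3) (.reg 2)) <|
      .seq (.store 4 (.reg 3) (.reg 3)) <| .seq (.set 40 (.reg 21)) <|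
      .seq (.text 41 (.bin .add (.reg 0) (.reg 20))) <| .seq (.set 43 (.reg 3)) <|
      .seq .insert <| .set 3 (.bin .add (.reg 3) (.const 1)))

/-- Find and output the next factor: register 28 is its length. -/
def findFactor : Cmd :=
  .seq (.set 4 (.reg 0)) <| .seq search <|
  .seq (.set 20 (.reg 5)) <| .seq (.set 21 (.reg 6)) <| .seq (.set 22 (.reg 7)) <|
  .seq chooseFirst <| .seq (.set 4 (.bin .add (.reg 0) (.reg 25))) <| .seq search <|
  .seq chooseSecond output

/-- Insert the factor into the trie, and move on. -/
def insertFactor : Cmd :=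
  .seq (.set 2 (.bin .add (.reg 2) (.const 1))) <|
  .seq splitEdge <| .seq addFactor <|
  .seq (.set 0 (.bin .add (.reg 0) (.reg 28))) <|
  .seq (.set 4 (.reg 0)) <| .seq (.set 5 (.const 0)) nextChar

/-- The computation of the factorization. -/
def lzdPlus : Cmd :=
  .seq (.set 3 (.const 1)) <| .seq nextChar <| .loop (.reg 12) (.seq findFactor insertFactor)

section spec

variable {w : ℕ} {T : List ℕ} {A : Finset ℕ} {L K : ℕ}

/-- The length of the remaining text is positive after a search that has not reached the end. -/
theorem getElem?_drop_of_lt {p d : ℕ} (h : p + d < T.length) :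
    ∃ c, (T.drop p)[d]? = some c ∧ T[p + d]? = some c :=
  ⟨T[p + d], by simp [h], by simp [h]⟩

/-- A factor that is a prefix of R is a marked node, and by `Locus.le_of_stuck` it is no deeper than
the search went. So the last mark seen is the longest. Marks of length at most one are ignored in
favour of the character itself, as the convention demands. -/
theorem chooseFirst_spec {F : List (List ℕ)} {p : ℕ} {v₀ v₁ v : View}
    (hW : 1024 * (T.length + 2) ≤ 2 ^ w) (hA : ∀ a ∈ T, a ∈ A) (hR : Rep T F v₀)
    (h : SearchDone T p v₀ v₁) (h8 : v.reg 8 = v₁.reg 8) (h9 : v.reg 9 = v₁.reg 9) (h0 : v.reg 0 = p) (hp : p < T.length) (hpr : p < v.revealed) :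
    chooseFirst.wp w T A L K (fun v' => OnlyRegs [23, 24, 25] v v' ∧
      v'.revealed = v.revealed ∧ v'.time ≤ v.time + 30 ∧
      ∃ r, FirstRef A F (T.drop p) r (v'.reg 25) ∧ r.encode = [v'.reg 23, v'.reg 24]) v := by
  have e2 : 1 % 2 ^ w = 1 := Nat.mod_eq_of_lt (by omega)
  have hb := h.best
  have hmax : ∀ s ∈ F, s <+: T.drop p → s.length ≤ v₁.reg 9 := by
    intro s hs hp
    obtain ⟨x, hx, rfl, hf⟩ := hR.trie.complete s hs
    exact hb.max x hx hf hp
      (h.locus.le_of_stuck hR.trie h.stuck hx le_rfl (by rwa [List.take_length]))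
  have hle := hb.le
  have hle' := h.locus.le_rem
  simp only [chooseFirst, cwp_seq, cwp_ite, cwp_set, cwp_text, View.setReg,
    View.tick, Expr.eval, BinOp.eval, Expr.cost]
  simp [e2, h0, hpr, h8, h9]
  refine ⟨fun h9' => ⟨⟨fun x hx => ?_, rfl, rfl, rfl, le_rfl⟩, .factor (v₁.reg 8), ?_, rfl⟩,
    fun h9' => ⟨⟨fun x hx => ?_, rfl, rfl, rfl, le_rfl⟩, .char T[p], ?_, by simp [Ref.encode, hp]⟩⟩
  · simp at hx; simp [hx]
  · rcases hb.mark with hm | ⟨hm, x, hx, hf, hN⟩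
    · omega
    · have h1 := hR.trie.fac_eq x hx (hf ▸ hm)
      rw [hf] at h1
      obtain ⟨h2, h3⟩ := Ref.str_factor hm h1
      refine ⟨⟨h3, by simpa using hm⟩, h2.trans hN, by omega, by omega, by omega, hmax⟩
  · simp at hx; simp [hx]
  · refine ⟨⟨hA _ (List.getElem_mem hp), by simp⟩, ?_, le_rfl, by simp; omega, fun _ => trivial,
      fun s hs hp => (hmax s hs hp).trans h9'⟩
    rw [List.drop_eq_getElem_cons hp]; rfl

/-- Two or more matched characters call for a factor, and any factor below the locus serves.
Otherwise the next character is always available as a reference, even if the trie matched nothing.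
Only at the end of the text is the second reference empty. -/
theorem chooseSecond_spec {F : List (List ℕ)} {p : ℕ} {v₀ v : View}
    (hW : 1024 * (T.length + 2) ≤ 2 ^ w) (hA : ∀ a ∈ T, a ∈ A) (hR : Rep T F v₀)
    (h : SearchDone T p v₀ v) (h4 : v.reg 4 = p) (hp : p ≤ T.length) (h25 : v.reg 25 ≤ p) :
    chooseSecond.wp w T A L K (fun v' => OnlyRegs [26, 27, 28] v v' ∧
      v'.revealed = v.revealed ∧ v'.time ≤ v.time + 40 ∧
      ∃ r l, SecondRef A F (T.drop p) r l ∧ r.encode = [v'.reg 26, v'.reg 27] ∧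
        v'.reg 28 = v.reg 25 + l ∧ v.reg 5 ≤ l ∧ p + l ≤ v.revealed) v := by
  have hrd := h.locus.le_rem
  simp only [List.length_drop] at hrd
  have e2 : 1 % 2 ^ w = 1 := Nat.mod_eq_of_lt (by omega)
  have e3 : (v.reg 25 + 1) % 2 ^ w = v.reg 25 + 1 := Nat.mod_eq_of_lt (by omega)
  have e4 : (v.reg 25 + v.reg 5) % 2 ^ w = v.reg 25 + v.reg 5 := Nat.mod_eq_of_lt (by omega)
  have hmax : ∀ s ∈ F, ∀ k ≤ s.length, s.take k <+: T.drop p → k ≤ v.reg 5 := by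
    intro s hs k hk hp
    obtain ⟨x, hx, rfl, hf⟩ := hR.trie.complete s hs
    exact h.locus.le_of_stuck hR.trie h.stuck hx hk hp
  have hk := hR.keys_le
  have hnode := h.locus.node
  have hr := h.rev.reg
  have hrl := h.rev.le
  have hread := h.read
  have hreach := h.reach
  simp only [chooseSecond, cwp_seq, cwp_ite, cwp_set, cwp_text, cwp_load, View.setReg,
    View.tick, Expr.eval, BinOp.eval, Expr.cost, View.Addressable]
  simp [e2, e3, e4, h4, hr, h.only.keys]
  refine ⟨fun h5 => ⟨⟨by omega, by omega⟩, ⟨fun x hx => ?_, rfl, rfl, h.only.keys.symm, le_rfl⟩,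
    .factor (v.nd 3 (v.reg 6)), ?_, rfl, hreach⟩,
    fun h5 => ⟨fun h6 => ⟨⟨fun x hx => ?_, rfl, rfl, h.only.keys.symm, le_rfl⟩, ?_⟩,
      fun h6 => ⟨⟨fun x hx => ?_, rfl, rfl, h.only.keys.symm, le_rfl⟩, .factor 0, ?_, rfl, ?_, by omega⟩⟩⟩
  · simp at hx; simp [hx]
  · have h0 : v.reg 6 ≠ 0 := by
      intro h0
      have := h.locus.le_len
      rw [h0, hR.trie.root] at this
      simp at this
      omega
    obtain ⟨h1, s, h2, h3⟩ := hR.trie.ix_eq _ hnode h0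
    rw [h.only.nd]
    obtain ⟨h7, h8⟩ := Ref.str_factor h1 h2
    have hls := h.locus.le_len.trans h3.length_le
    refine ⟨h8, ?_, ?_, by simp; omega, ?_, by omega, hmax⟩
    · rw [h7, ← h.locus.take_eq, List.prefix_iff_eq_take.1 h3, List.take_take,
        min_eq_left h.locus.le_len]
    · rwa [h7]
    · rw [h7]; omega
  · simp at hx; simp [hx]
  · have hpT : p < T.length := by omega
    refine ⟨.char T[p], ⟨hA _ (List.getElem_mem hpT), ?_, by simp [Ref.str], by simp; omega,
      fun _ => trivial, by simp, fun s hs k hk hp => (hmax s hs k hk hp).trans h5⟩, ?_, h5, h6⟩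
    · rw [List.drop_eq_getElem_cons hpT]; rfl
    · simp [Ref.encode, hpT, h6]
  · simp at hx; simp [hx]
  · have hpT : p = T.length := by omega
    refine ⟨Nat.zero_le _, by simp, by simp, by simp, by simp [Ref.str], ?_, ?_⟩
    · simp [hpT]
    · intro s hs k hk hp
      have := hmax s hs k hk hp
      omega
  · omega

theorem output_spec {F : List (List ℕ)} {p : ℕ} {v₀ v₁ v : View} {r₁ r₂ : Ref} {l₁ l₂ : ℕ}
    (hW : 1024 * (T.length + 2) ≤ 2 ^ w) (hR : Rep T F v₀)
    (h : SearchDone T p v₀ v₁)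
    (h20 : v.reg 20 = v₁.reg 5) (h21 : v.reg 21 = v₁.reg 6) (hnd : v.nd = v₀.nd)
    (hkeys : v.keys = v₀.keys) (h₁ : FirstRef A F (T.drop p) r₁ l₁)
    (h₂ : SecondRef A F ((T.drop p).drop l₁) r₂ l₂)
    (hr₁ : r₁.encode = [v.reg 23, v.reg 24]) (hr₂ : r₂.encode = [v.reg 26, v.reg 27])
    (h28 : v.reg 28 = l₁ + l₂) :
    output.wp w T A L K (fun v' => (∀ x ∉ [28, 29], v'.reg x = v.reg x) ∧ v'.nd = v.nd ∧
      v'.keys = v.keys ∧ v'.revealed = v.revealed ∧ v'.time ≤ v.time + 30 ∧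
      v'.reg 28 = max (l₁ + l₂) (v₁.reg 5) ∧
      ∃ q, IsChoice A F (T.drop p) q ∧ q.str F = (T.drop p).take (v'.reg 28) ∧
        v'.out = v.out ++ [(q.encode, v.revealed)]) v := by
  have e2 : 1 % 2 ^ w = 1 := Nat.mod_eq_of_lt (by omega)
  have hmax : ∀ s ∈ F, ∀ k ≤ s.length, s.take k <+: T.drop p → k ≤ v₁.reg 5 := by
    intro s hs k hk hp
    obtain ⟨x, hx, rfl, hf⟩ := hR.trie.complete s hs
    exact h.locus.le_of_stuck hR.trie h.stuck hx hk hp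
  have hk := hR.keys_le
  have hnode := h.locus.node
  simp only [output, cwp_seq, cwp_ite, cwp_set, cwp_emit, cwp_load, View.setReg,
    View.tick, Expr.eval, BinOp.eval, Expr.cost, View.Addressable]
  simp [e2, h20, h21, h28, hkeys, Expr.eval, Expr.cost]
  refine ⟨fun hlt => ⟨⟨by omega, by omega⟩, ?_, by omega, ?_⟩, fun hle => ⟨hle, ?_⟩⟩
  · rintro x h1 h2; simp [h1, h2]
  -- The root extends to no particular factor. But a truncation longer than every combination has
  -- matched something, so the locus is not at the root.
  · have h0 : v₁.reg 6 ≠ 0 := by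
      intro h0
      have := h.locus.le_len
      rw [h0, hR.trie.root] at this
      simp at this
      omega
    obtain ⟨h1, s, h2, h3⟩ := hR.trie.ix_eq _ hnode h0
    rw [hnd]
    obtain ⟨c1, c2⟩ := isChoice_trunc h₁ h₂ hmax hlt h.locus.le_rem h1 h2
      ((h.locus.take_eq ▸ List.take_prefix _ _ : (T.drop p).take (v₁.reg 5) <+: _).trans h3)
    exact ⟨_, c1, c2, rfl⟩
  · obtain ⟨c1, c2⟩ := isChoice_comb h₁ h₂ hmax hle
    refine ⟨_, c1, c2, ?_⟩
    simp [Production.encode, hr₁, hr₂]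

theorem _root_.WordRAM.Legal.append {ks : List (ℕ × ℕ)} {k : ℕ × ℕ} (h : Legal A L ks)
    (hL : ks.length + 1 ≤ L) (hk : k ∉ ks) (h1 : k.1 ≤ ks.length + 1) (h2 : k.2 ∈ A) :
    Legal A L (ks ++ [k]) := by
  refine ⟨List.nodup_append.2 ⟨h.nodup, by simp, by
    rintro a ha b hb rfl; simp at hb; exact hk (hb ▸ ha)⟩, by simpa using hL, fun k' hk' => ?_⟩
  rcases List.mem_append.1 hk' with hk' | hk'
  · have := h.bound k' hk'
    exact ⟨by simp; omega, this.2⟩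
  · simp only [List.mem_singleton] at hk'
    subst hk'
    exact ⟨by simpa using h1, h2⟩

/-- A point of the trie that has been made a node, below which a factor may be added. -/
structure AtNode (T : List ℕ) (A : Finset ℕ) (F : List (List ℕ)) (p : ℕ) (v : View) : Prop where
  rep : Rep T F v
  locus : Locus v.keys (nodeStr T v.nd) (v.nd 4) (T.drop p) (v.reg 21) (v.reg 20) (v.reg 22)
  at_node : v.reg 20 = (nodeStr T v.nd (v.reg 21)).length
  fresh : ∀ c, (T.drop p)[v.reg 20]? = some c → keyIndex v.keys (v.reg 21, c) = 0
  legal : Legal A (2 * T.length + 2) v.keys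
  count : v.reg 3 = v.keys.length + 1

/-- In either case the locus becomes a node without an edge for the next character of R, which is
the precondition of adding a leaf. -/
theorem splitEdge_spec {F : List (List ℕ)} {p : ℕ} {v : View}
    (hW : 1024 * (T.length + 2) ≤ 2 ^ w) (hA : ∀ a ∈ T, a ∈ A) (hR : Rep T F v)
    (hv : Revealed T v) (hk : v.keys.length + 1 ≤ 2 * T.length + 2)
    (hlegal : Legal A (2 * T.length + 2) v.keys)
    (h : Locus v.keys (nodeStr T v.nd) (v.nd 4) (T.drop p) (v.reg 21) (v.reg 20) (v.reg 22))
    (hs : Stuck v.keys (nodeStr T v.nd) (T.drop p) (v.reg 21) (v.reg 20))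
    (h0 : v.reg 0 = p) (h3 : v.reg 3 = v.keys.length + 1) (hpr : p + v.reg 20 ≤ v.revealed) :
    splitEdge.wp w T A (2 * T.length + 2) K (fun v' => AtNode T A F p v' ∧
      (∀ x ∉ [3, 13, 21, 40, 41, 43], v'.reg x = v.reg x) ∧ v'.out = v.out ∧
      v'.revealed = v.revealed ∧ v'.keys.length ≤ v.keys.length + 1 ∧
      v'.time ≤ v.time + K + 130) v := by
  have hle := hv.le
  have hnode := h.node
  have hlen := hR.length_nodeStr hv hnode
  have hb := hR.bound _ hnode
  have hll := h.le_len
  rw [hlen] at hll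
  have e2 : 1 % 2 ^ w = 1 := Nat.mod_eq_of_lt (by omega)
  have e3 : (v.nd 0 (v.reg 21) + v.reg 20) % 2 ^ w = v.nd 0 (v.reg 21) + v.reg 20 :=
    Nat.mod_eq_of_lt (by omega)
  have e4 : (v.keys.length + 1 + 1) % 2 ^ w = v.keys.length + 1 + 1 :=
    Nat.mod_eq_of_lt (by omega)
  have a1 : 16 * v.reg 21 + 16 ≤ 2 ^ w := by omega
  have a2 : v.reg 21 ≤ v.keys.length + 2 := by omega
  have a3 : 16 * (v.keys.length + 1) + 16 ≤ 2 ^ w := by omega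
  have n1 : v.reg 21 ≠ v.keys.length + 1 := by omega
  simp only [splitEdge, cwp_seq, cwp_ite, cwp_set, cwp_load, cwp_store, cwp_text, cwp_insert,
    cwp_skip, View.setReg, View.setNd, View.tick, Expr.eval, BinOp.eval, Expr.cost,
    View.Addressable]
  simp [e2, e3, e4, h0, h3, a1, a2, a3, n1]
  refine ⟨fun hlt => ?_, fun hge => ⟨?_, ?_, by omega⟩⟩
  · have hlt' : v.nd 0 (v.reg 21) + v.reg 20 < v.revealed := by omega
    have hltT : v.nd 0 (v.reg 21) + v.reg 20 < T.length := by omega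
    have hc := getElem?_nodeStr (T := T) hlt
    obtain ⟨c, hc'⟩ : ∃ c, T[v.nd 0 (v.reg 21) + v.reg 20]? = some c := ⟨_, List.getElem?_eq_getElem hltT⟩
    rw [hc'] at hc
    have hcA : c ∈ A := hA _ (List.mem_of_getElem? hc')
    have h22 : v.reg 22 ≤ v.keys.length := by
      rcases h.edge with ⟨d1, d2⟩ | ⟨p', c', d1, -⟩
      · rw [d2] at hlen hlt
        rw [hR.trie.root] at hlen
        simp at hlen
        omega
      · rw [d1]; exact keyIndex_le
    simp only [hlt', if_true, hc', Option.getD_some]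
    -- Strings are read off the fields 0 and 1 only. The stored pair of position and length denotes
    -- the matched prefix, and all old strings are unchanged.
    have hN : ∀ f : ℕ → ℕ, nodeStr T (Function.update (Function.update
        (Function.update (Function.update (Function.update v.nd 0
          (Function.update (v.nd 0) (v.keys.length + 1) p)) 1
          (Function.update (v.nd 1) (v.keys.length + 1) (v.reg 20)))
        2 (Function.update (v.nd 2) (v.keys.length + 1) 0))
        3 (Function.update (v.nd 3) (v.keys.length + 1) (v.nd 3 (v.reg 21)))) 4 f) =
        Function.update (nodeStr T v.nd) (v.keys.length + 1) ((T.drop p).take (v.reg 20)) := by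
      intro f
      funext i
      by_cases hi : i = v.keys.length + 1
      · subst hi; simp [nodeStr]
      · simp [nodeStr, hi]
    obtain ⟨hT', hL'⟩ := hR.trie.split h (by rw [hlen]; exact hlt) hc
    have hleg := hlegal.append (k := (v.keys.length + 1, c)) hk (hR.trie.not_mem c) le_rfl hcA
    refine ⟨⟨by omega, by omega⟩, hleg, ⟨⟨?_, ?_, ?_⟩, ?_, ?_, ?_, ?_, ?_⟩, ?_, by omega⟩
    · simp only [hN]; simpa using hT'
    · intro i hi
      simp only [List.length_append, List.length_singleton] at hi
      by_cases hi' : i = v.keys.length + 1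
      · subst hi'; simpa using hpr
      · simpa [hi'] using hR.bound i (by omega)
    · simpa using hk
    · simp only [hN]; simpa using hL'
    · simp only [hN]
      have := hL'.le_rem
      simp only [List.length_drop] at this
      simp; omega
    · intro c' hc''
      simp at hc'' ⊢
      -- The search was stuck strictly inside the edge. So R either has ended or differs from the
      -- edge in the next character, and the one edge of the new node does not continue R.
      have hcc : c' ≠ c := by
        rintro rfl
        rcases hs with hs | ⟨c₁, hc₁, hs | hs⟩
        · have := (List.getElem?_eq_some_iff.1 hc'').1
          simp at hs
          omega
        · rw [List.getElem?_drop, hc''] at hc₁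
          exact hs.2 (hc.trans hc₁)
        · omega
      rw [keyIndex_append_of_ne (by simp [hcc]), keyIndex_eq_zero]
      exact hR.trie.not_mem c'
    · exact hleg
    · simp
    · intro x x1 x2 x3 x4 x5 x6
      simp [x1, x2, x3, x4, x5, x6]
  · refine ⟨⟨hR.trie, hR.bound, hR.keys_le⟩, ?_, ?_, ?_, hlegal, ?_⟩
    · simpa using h
    · simp; omega
    · intro c hc
      simp at hc ⊢
      rcases hs with hs | ⟨c₁, hc₁, hs | hs⟩
      · have := (List.getElem?_eq_some_iff.1 hc).1
        simp at hs
        omega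
      · omega
      · rw [List.getElem?_drop, hc] at hc₁
        rw [Option.some_inj.1 hc₁]
        exact hs.2
    · simp [h3]
  · intro x x1 x2 x3 x4 x5 x6
    simp [x2]

/-- The factor is at least as long as the matched prefix. If it equals that prefix, its node exists
and is marked; otherwise it continues with a character for which there is no edge. A new edge and
the leaf below it get the same number. -/
theorem addFactor_spec {F : List (List ℕ)} {p : ℕ} {v : View}
    (hW : 1024 * (T.length + 2) ≤ 2 ^ w) (hA : ∀ a ∈ T, a ∈ A) (hv : Revealed T v)
    (h : AtNode T A F p v) (hk : v.keys.length + 1 ≤ 2 * T.length + 2)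
    (h0 : v.reg 0 = p) (h2 : v.reg 2 = F.length + 1)
    (hpr : p + v.reg 28 ≤ v.revealed) (hl : v.reg 20 ≤ v.reg 28) :
    addFactor.wp w T A (2 * T.length + 2) K (fun v' =>
      Rep T (F ++ [(T.drop p).take (v.reg 28)]) v' ∧ Legal A (2 * T.length + 2) v'.keys ∧
      v'.reg 3 = v'.keys.length + 1 ∧
      (∀ x ∉ [3, 40, 41, 43], v'.reg x = v.reg x) ∧ v'.out = v.out ∧
      v'.revealed = v.revealed ∧ v'.keys.length ≤ v.keys.length + 1 ∧
      v'.time ≤ v.time + K + 130) v := by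
  have hle := hv.le
  have hR := h.rep
  have hnode := h.locus.node
  have h3 := h.count
  have e3 : (p + v.reg 20) % 2 ^ w = p + v.reg 20 := Nat.mod_eq_of_lt (by omega)
  have e4 : (v.keys.length + 1 + 1) % 2 ^ w = v.keys.length + 1 + 1 :=
    Nat.mod_eq_of_lt (by omega)
  have a1 : 16 * v.reg 21 + 16 ≤ 2 ^ w := by omega
  have a2 : v.reg 21 ≤ v.keys.length + 2 := by omega
  have a3 : 16 * (v.keys.length + 1) + 16 ≤ 2 ^ w := by omega
  have e2 : 1 % 2 ^ w = 1 := Nat.mod_eq_of_lt (by omega)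
  simp only [addFactor, cwp_seq, cwp_ite, cwp_set, cwp_store, cwp_text, cwp_insert,
    View.setReg, View.setNd, View.tick, Expr.eval, BinOp.eval, Expr.cost, View.Addressable]
  simp [e2, e3, e4, h0, h3, h2, a1, a2, a3]
  refine ⟨fun heq' => ⟨⟨?_, ?_, hR.keys_le⟩, h.legal, by omega⟩, fun hne' => ?_⟩
  · have heq : v.reg 20 = v.reg 28 := by by_contra h; simp [h] at heq'
    have hN : nodeStr T (Function.update v.nd 2 (Function.update (v.nd 2) (v.reg 21)
        (F.length + 1))) = nodeStr T v.nd := by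
      funext i; simp [nodeStr]
    have := hR.trie.mark hnode
    rw [h.locus.eq_take h.at_node, heq] at this
    simp only [hN]; simpa using this
  · intro i hi; simpa using hR.bound i hi
  · have hne : v.reg 20 ≠ v.reg 28 := by intro h; simp [h] at hne'
    have hlt : v.reg 20 < v.reg 28 := by omega
    have hlt' : p + v.reg 20 < v.revealed := by omega
    have hltT : p + v.reg 20 < T.length := by omega
    obtain ⟨c, hc, hc'⟩ := getElem?_drop_of_lt hltT
    have hcA : c ∈ A := hA _ (List.mem_of_getElem? hc')
    simp only [hlt', if_true, hc', Option.getD_some]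
    have hN : ∀ f g h : ℕ → ℕ, nodeStr T (Function.update (Function.update
        (Function.update (Function.update (Function.update v.nd 0
          (Function.update (v.nd 0) (v.keys.length + 1) p)) 1
          (Function.update (v.nd 1) (v.keys.length + 1) (v.reg 28)))
        2 f) 3 g) 4 h) =
        Function.update (nodeStr T v.nd) (v.keys.length + 1) ((T.drop p).take (v.reg 28)) := by
      intro f g h
      funext i
      by_cases hi : i = v.keys.length + 1
      · subst hi; simp [nodeStr]
      · simp [nodeStr, hi]
    have hfr := h.fresh c hc
    have hT' := hR.trie.leaf h.locus h.at_node hc hfr hlt (by simp; omega)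
    have hleg := h.legal.append (k := (v.reg 21, c)) hk (keyIndex_eq_zero.1 hfr)
      (Nat.le_succ_of_le hnode) hcA
    refine ⟨hleg, ⟨?_, ?_, ?_⟩, hleg, ?_, by omega⟩
    · simp only [hN]; simpa using hT'
    · intro i hi
      simp only [List.length_append, List.length_singleton] at hi
      by_cases hi' : i = v.keys.length + 1
      · subst hi'; simpa using hpr
      · simpa [hi'] using hR.bound i (by omega)
    · simpa using hk
    · intro x x1 x2 x3 x4
      simp [x1, x2, x3, x4]

/-- The factors `F` with productions `P` have been computed. -/
structure Progress (T : List ℕ) (A : Finset ℕ) (F : List (List ℕ)) (P : List Production)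
    (v : View) : Prop where
  rep : Rep T F v
  rev : Revealed T v
  legal : Legal A (2 * T.length + 2) v.keys
  keys_le : v.keys.length ≤ 2 * F.length
  pos : v.reg 0 = F.flatten.length
  flat : F.flatten = T.take (v.reg 0)
  pos_le : v.reg 0 ≤ T.length
  count : v.reg 2 = F.length
  nodes : v.reg 3 = v.keys.length + 1
  nonempty : ∀ s ∈ F, s ≠ []
  length_eq : P.length = F.length
  out_eq : v.out.map Prod.fst = P.map Production.encode
  online : ∀ (x : ℕ) (hx : x < v.out.length), v.out[x].2 ≤ (F.take (x + 1)).flatten.length + 1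
  choice : ∀ (x : ℕ) (hF : x < F.length) (hP : x < P.length),
    IsChoice A (F.take x) (T.drop (F.take x).flatten.length) P[x] ∧ F[x] = P[x].str (F.take x)
  revealed_le : v.revealed ≤ v.reg 0 + 1
  avail : v.reg 12 ≠ 0 → v.reg 0 < v.revealed
  finished : v.reg 12 = 0 → v.reg 0 = T.length

theorem length_le_flatten {F : List (List ℕ)} (h : ∀ s ∈ F, s ≠ []) :
    F.length ≤ F.flatten.length := by
  induction F with
  | nil => simp
  | cons s F ih =>
    have h1 := List.length_pos_of_ne_nil (h s (by simp))
    have h2 := ih fun t ht => h t (by simp [ht])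
    simp; simp at h2; omega

theorem onlyRegs_set (v : View) (x y t : ℕ) : OnlyRegs [x] v ((v.setReg x y).tick t) := by
  refine ⟨fun z hz => ?_, rfl, rfl, rfl, le_rfl⟩
  simp at hz
  simp [View.setReg, View.tick, hz]

theorem reg_set (v : View) (x y t : ℕ) : ((v.setReg x y).tick t).reg x = y := by
  simp [View.setReg, View.tick]

theorem Progress.length_le {F : List (List ℕ)} {P : List Production} {v : View}
    (h : Progress T A F P v) : F.length ≤ v.reg 0 := h.pos ▸ length_le_flatten h.nonempty

/-- The effect of `findFactor`. -/
structure Found (T : List ℕ) (A : Finset ℕ) (F : List (List ℕ)) (K p l : ℕ) (q : Production)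
    (v v' : View) : Prop where
  len : v'.reg 28 = l
  pos : 1 ≤ l
  le : p + l ≤ v'.revealed
  nd : v'.nd = v.nd
  keys : v'.keys = v.keys
  reg : ∀ x ∉ [1, 4, 5, 6, 7, 8, 9, 10, 11, 12, 13, 14, 20, 21, 22, 23, 24, 25, 26, 27, 28, 29,
    40, 41, 42], v'.reg x = v.reg x
  rev : Revealed T v'
  revealed_le : v'.revealed ≤ p + l + 1
  mono : v.revealed ≤ v'.revealed
  match_le : v'.reg 20 ≤ l
  locus : Locus v.keys (nodeStr T v.nd) (v.nd 4) (T.drop p) (v'.reg 21) (v'.reg 20) (v'.reg 22)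
  stuck : Stuck v.keys (nodeStr T v.nd) (T.drop p) (v'.reg 21) (v'.reg 20)
  choice : IsChoice A F (T.drop p) q
  str : q.str F = (T.drop p).take l
  out : v'.out = v.out ++ [(q.encode, v'.revealed)]
  time : v'.time ≤ v.time + (K + 152) * (4 * l) + 300

-- The first search matches t characters and the second at most l₂, and the factor has length l =
-- max (l₁ + l₂) t. So neither search reads past position p + l, that is, more than one character
-- after the factor. The trie is untouched, so the result of the first search remains valid for the
-- insertion.
set_option maxHeartbeats 800000 in
theorem findFactor_spec {F : List (List ℕ)} {P : List Production} {v : View}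
    (hW : 1024 * (T.length + 2) ≤ 2 ^ w) (hA : ∀ a ∈ T, a ∈ A) (h : Progress T A F P v)
    (h12 : v.reg 12 ≠ 0) :
    findFactor.wp w T A (2 * T.length + 2) K
      (fun v' => ∃ l q, Found T A F K (v.reg 0) l q v v') v := by
  have hrv := h.revealed_le
  have hFl := h.length_le
  have hav := h.avail h12
  have hrl := h.rev.le
  have hkl := h.keys_le
  have hpT : v.reg 0 < T.length := by omega
  obtain ⟨p, hp⟩ : ∃ p, p = v.reg 0 := ⟨_, rfl⟩
  rw [← hp] at hFl hav hpT hrv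
  rw [← hp]
  rw [findFactor, cwp_seq, cwp_set, cwp_seq]
  obtain ⟨va, hva⟩ : ∃ va, va = (v.setReg 4 (Expr.eval w v.reg (.reg 0))).tick
    ((Expr.reg 0).cost + 1) := ⟨_, rfl⟩
  have oa : OnlyRegs [4] v va := hva ▸ onlyRegs_set _ _ _ _
  have a4 : va.reg 4 = p := by rw [hva, reg_set, Expr.eval, hp]
  have ar : va.revealed = v.revealed := by rw [hva]; rfl
  have at' : va.time = v.time + 2 := by rw [hva]; rfl
  have raRev : Revealed T va := ⟨by rw [oa.reg 1 (by simp), ar, h.rev.reg], by rw [ar]; exact hrl⟩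
  have repa := h.rep.only oa
  rw [← hva]
  refine Cmd.wp_mono (search_spec hW hA repa raRev a4 (by omega)) fun v₁ ⟨d₁, t₁⟩ => ?_
  rw [cwp_seq, cwp_set, cwp_seq, cwp_set, cwp_seq, cwp_set, cwp_seq]
  simp only [Expr.eval, Expr.cost]
  obtain ⟨v₂, hv₂⟩ : ∃ v₂, v₂ = (((((v₁.setReg 20 (v₁.reg 5)).tick (1 + 1)).setReg 21
    (((v₁.setReg 20 (v₁.reg 5)).tick (1 + 1)).reg 6)).tick (1 + 1)).setReg 22
    ((((v₁.setReg 20 (v₁.reg 5)).tick (1 + 1)).setReg 21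
    (((v₁.setReg 20 (v₁.reg 5)).tick (1 + 1)).reg 6)).tick (1 + 1) |>.reg 7)).tick (1 + 1) :=
    ⟨_, rfl⟩
  have o₂ : OnlyRegs [20, 21, 22] v₁ v₂ := by
    rw [hv₂]
    refine (((onlyRegs_set _ _ _ _).mono ?_).trans ((onlyRegs_set _ _ _ _).mono ?_)).trans
      ((onlyRegs_set _ _ _ _).mono ?_) <;> simp
  have r20 : v₂.reg 20 = v₁.reg 5 := by simp [hv₂, View.setReg, View.tick]
  have r21 : v₂.reg 21 = v₁.reg 6 := by simp [hv₂, View.setReg, View.tick]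
  have r22 : v₂.reg 22 = v₁.reg 7 := by simp [hv₂, View.setReg, View.tick]
  have r2r : v₂.revealed = v₁.revealed := by rw [hv₂]; rfl
  have r2t : v₂.time = v₁.time + 6 := by rw [hv₂]; rfl
  rw [← hv₂]
  clear hv₂ hva
  have o1 := d₁.only
  have rev1 := o1.revealed
  have r0 : v₂.reg 0 = p := by
    rw [o₂.reg 0 (by simp), o1.reg 0 (by simp [searchRegs]), oa.reg 0 (by simp), hp]
  refine Cmd.wp_mono (chooseFirst_spec hW hA repa d₁ (o₂.reg 8 (by simp)) (o₂.reg 9 (by simp))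
    r0 hpT (by omega)) fun v₃ ⟨o₃, r3r, t₃, q₁, f₁, enc₁⟩ => ?_
  rw [cwp_seq, cwp_set, cwp_seq]
  obtain ⟨l₁, hl₁⟩ : ∃ l₁, l₁ = v₃.reg 25 := ⟨_, rfl⟩
  rw [← hl₁] at f₁
  have hl₁T := f₁.le
  simp only [List.length_drop] at hl₁T
  have e5 : Expr.eval w v₃.reg (.bin .add (.reg 0) (.reg 25)) = p + l₁ := by
    simp only [Expr.eval, BinOp.eval]
    rw [o₃.reg 0 (by simp), r0, ← hl₁, Nat.mod_eq_of_lt (by omega)]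
  rw [e5]
  obtain ⟨v₄, hv₄⟩ : ∃ v₄, v₄ = (v₃.setReg 4 (p + l₁)).tick
    ((Expr.bin .add (.reg 0) (.reg 25)).cost + 1) := ⟨_, rfl⟩
  have o₄ : OnlyRegs [4] v₃ v₄ := hv₄ ▸ onlyRegs_set _ _ _ _
  have r44 : v₄.reg 4 = p + l₁ := by rw [hv₄, reg_set]
  have r4r : v₄.revealed = v₃.revealed := by rw [hv₄]; rfl
  have r4t : v₄.time = v₃.time + 4 := by rw [hv₄]; rfl
  rw [← hv₄]
  clear hv₄
  have rev₁ := d₁.rev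
  have rev₁l := rev₁.le
  have o24 : OnlyRegs [4, 20, 21, 22, 23, 24, 25] v₁ v₄ :=
    ((o₂.mono (by simp)).trans (o₃.mono (by simp))).trans (o₄.mono (by simp))
  have rev₄ : Revealed T v₄ := ⟨by
    rw [o24.reg 1 (by simp), rev₁.reg, r4r, r3r, r2r], by rw [r4r, r3r, r2r]; exact rev₁.le⟩
  have rep₁ := repa.only o1
  have rep₄ := rep₁.only o24
  have hreach₁ := d₁.reach
  -- The second search has to start inside the revealed part. A first reference of length at least
  -- two is a factor, which the first search has matched; one of length one is a character that has
  -- been read.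
  have hl₁r : p + l₁ ≤ v₁.revealed := by
    have hb := d₁.best.le
    have : l₁ ≤ max (v₁.reg 5) 1 := by
      rcases Nat.lt_or_ge 1 l₁ with hlt | hle
      · have hm := f₁.str_eq
        have hq := f₁.valid
        have : (q₁.str F).length = l₁ := by rw [hm]; simp; omega
        cases q₁ with
        | char a => simp [Ref.str] at this; omega
        | factor y =>
          have hmem := Ref.str_factor_mem (fun h0 => hq.2 (by rw [h0])) hq.1
          obtain ⟨x, hx, hN, hf⟩ := repa.trie.complete _ hmem
          have h6 := d₁.locus.le_of_stuck repa.trie d₁.stuck hx le_rfl (by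
            rw [List.take_length, hN, hm]; exact List.take_prefix _ _)
          rw [hN, this] at h6
          omega
      · omega
    have h7 := d₁.read
    omega
  refine Cmd.wp_mono (search_spec hW hA rep₄ rev₄ r44 (by omega)) fun v₅ ⟨d₅, t₅⟩ => ?_
  have o5 := d₅.only
  have rev5 := o5.revealed
  rw [cwp_seq]
  have r525 : v₅.reg 25 = l₁ := by
    rw [o5.reg 25 (by simp [searchRegs]), o₄.reg 25 (by simp), hl₁]
  have r54 : v₅.reg 4 = p + l₁ := by rw [o5.reg 4 (by simp [searchRegs]), r44]
  refine Cmd.wp_mono (chooseSecond_spec hW hA rep₄ d₅ r54 (by omega) (by omega))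
    fun v₆ ⟨o₆, r6r, t₆, q₂, l₂, f₂, enc₂, r628, hd₂, hl₂⟩ => ?_
  rw [← List.drop_drop] at f₂
  have o46 : OnlyRegs (searchRegs ++ [26, 27, 28]) v₄ v₆ :=
    (o5.mono (by simp [searchRegs])).trans (o₆.mono (by simp [searchRegs]))
  have o16 : OnlyRegs (searchRegs ++ [4, 20, 21, 22, 23, 24, 25, 26, 27, 28]) v₁ v₆ :=
    (o24.mono (by simp [searchRegs])).trans (o46.mono (by simp [searchRegs]))
  have o06 : OnlyRegs (searchRegs ++ [4, 20, 21, 22, 23, 24, 25, 26, 27, 28]) v v₆ :=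
    ((oa.mono (by simp [searchRegs])).trans (o1.mono (by simp [searchRegs]))).trans o16
  have r620 : v₆.reg 20 = v₁.reg 5 := by
    rw [o46.reg 20 (by simp [searchRegs]), o₄.reg 20 (by simp), o₃.reg 20 (by simp), r20]
  have r621 : v₆.reg 21 = v₁.reg 6 := by
    rw [o46.reg 21 (by simp [searchRegs]), o₄.reg 21 (by simp), o₃.reg 21 (by simp), r21]
  have r622 : v₆.reg 22 = v₁.reg 7 := by
    rw [o46.reg 22 (by simp [searchRegs]), o₄.reg 22 (by simp), o₃.reg 22 (by simp), r22]
  have r623 : v₆.reg 23 = v₃.reg 23 := by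
    rw [o46.reg 23 (by simp [searchRegs]), o₄.reg 23 (by simp)]
  have r624 : v₆.reg 24 = v₃.reg 24 := by
    rw [o46.reg 24 (by simp [searchRegs]), o₄.reg 24 (by simp)]
  refine Cmd.wp_mono (output_spec hW repa d₁ r620 r621
    (o16.nd.trans o1.nd) (o16.keys.trans o1.keys) f₁ f₂ (by rw [r623, r624, enc₁]) enc₂ (by rw [r628, r525]))
    fun v₇ ⟨reg₇, nd₇, keys₇, r7r, t₇, r728, q, hq, hqs, out₇⟩ => ?_
  have hle₁ := d₁.le
  have hle₅ := d₅.le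
  obtain ⟨l, hl⟩ : ∃ l, l = v₇.reg 28 := ⟨_, rfl⟩
  rw [← hl] at hqs r728
  have hl₂T := f₂.le
  simp only [List.length_drop] at hl₂T
  have ht₁T := d₁.locus.le_rem
  simp only [List.length_drop] at ht₁T
  have hl1 := f₁.pos
  refine ⟨l, q, { len := hl.symm, pos := by omega, le := by omega, nd := nd₇.trans o06.nd,
                  keys := keys₇.trans o06.keys, reg := ?_, rev := ?_, revealed_le := by omega,
                  mono := by omega, match_le := ?_, locus := ?_, stuck := ?_, choice := hq,
                  str := hqs, out := ?_, time := ?_ }⟩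
  · intro x hx
    have s1 : [28, 29] ⊆ [1, 4, 5, 6, 7, 8, 9, 10, 11, 12, 13, 14, 20, 21, 22, 23, 24, 25, 26, 27,
        28, 29, 40, 41, 42] := by simp
    have s2 : searchRegs ++ [4, 20, 21, 22, 23, 24, 25, 26, 27, 28] ⊆ [1, 4, 5, 6, 7, 8, 9, 10, 11,
        12, 13, 14, 20, 21, 22, 23, 24, 25, 26, 27, 28, 29, 40, 41, 42] := by simp [searchRegs]
    rw [reg₇ x fun hm => hx (s1 hm), o06.reg x fun hm => hx (s2 hm)]
  · refine ⟨?_, by rw [r7r, r6r]; exact d₅.rev.le⟩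
    rw [reg₇ 1 (by simp), o₆.reg 1 (by simp), r7r, r6r, d₅.rev.reg]
  · rw [reg₇ 20 (by simp), r620]; omega
  · rw [reg₇ 20 (by simp), reg₇ 21 (by simp), reg₇ 22 (by simp), r620, r621, r622, ← oa.nd,
      ← oa.keys]
    exact d₁.locus
  · rw [reg₇ 20 (by simp), reg₇ 21 (by simp), r620, r621, ← oa.nd, ← oa.keys]
    exact d₁.stuck
  · rw [out₇, o06.out, r7r]
  -- As l is at least one, each search costs at most K + 152 per character for l + 1 ≤ 2 * l
  -- characters.
  · have m1 : (K + 152) * (v₁.reg 5 + 1) ≤ (K + 152) * (2 * l) := Nat.mul_le_mul_left _ (by omega)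
    have m2 : (K + 152) * (v₅.reg 5 + 1) ≤ (K + 152) * (2 * l) := Nat.mul_le_mul_left _ (by omega)
    have m3 : (K + 152) * (4 * l) = (K + 152) * (2 * l) + (K + 152) * (2 * l) := by ring
    omega

/-- The trie gains at most two keys, which keeps their number within twice the number of factors.
The character after the factor is requested only after the output, and tells whether another factor
follows. -/
theorem insertFactor_spec {F : List (List ℕ)} {P : List Production} {v v₇ : View} {p l : ℕ}
    {q : Production}
    (hW : 1024 * (T.length + 2) ≤ 2 ^ w) (hA : ∀ a ∈ T, a ∈ A) (h : Progress T A F P v)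
    (hp : v.reg 0 = p) (hpT : p < T.length) (hf : Found T A F K p l q v v₇) :
    insertFactor.wp w T A (2 * T.length + 2) K (fun v' => ∃ s q, s ≠ [] ∧
      Progress T A (F ++ [s]) (P ++ [q]) v' ∧
      v'.time ≤ v.time + (10 * K + 2000) * s.length) v₇ := by
  have hFl := h.length_le
  have hrl := h.rev.le
  have hkl := h.keys_le
  rw [hp] at hFl
  have hl1 := hf.pos
  have hle := hf.le
  have hfr := hf.rev.le
  have hmono := hf.mono
  have hml := hf.match_le
  have hrle := hf.revealed_le
  have hqs := hf.str
  have ht₇ := hf.time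
  have ht₁T := hf.locus.le_rem
  simp only [List.length_drop] at ht₁T
  rw [insertFactor, cwp_seq, cwp_set, cwp_seq]
  have e8 : Expr.eval w v₇.reg (.bin .add (.reg 2) (.const 1)) = F.length + 1 := by
    simp only [Expr.eval, BinOp.eval]
    rw [hf.reg 2 (by simp), h.count,
      Nat.mod_eq_of_lt (a := 1) (by omega), Nat.mod_eq_of_lt (by omega)]
  rw [e8]
  obtain ⟨v₈, hv₈⟩ : ∃ v₈, v₈ = (v₇.setReg 2 (F.length + 1)).tick
    ((Expr.bin .add (.reg 2) (.const 1)).cost + 1) := ⟨_, rfl⟩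
  have o₈ : OnlyRegs [2] v₇ v₈ := hv₈ ▸ onlyRegs_set _ _ _ _
  have r82 : v₈.reg 2 = F.length + 1 := by rw [hv₈, reg_set]
  have r8r : v₈.revealed = v₇.revealed := by rw [hv₈]; rfl
  have r8t : v₈.time = v₇.time + 4 := by rw [hv₈]; rfl
  rw [← hv₈]
  clear hv₈
  have nd₈ : v₈.nd = v.nd := o₈.nd.trans hf.nd
  have keys₈ : v₈.keys = v.keys := o₈.keys.trans hf.keys
  have rev₈ : Revealed T v₈ := ⟨by rw [o₈.reg 1 (by simp), r8r, hf.rev.reg], by rw [r8r]; exact hfr⟩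
  have rep₈ : Rep T F v₈ := by
    refine ⟨?_, ?_, ?_⟩
    · rw [nd₈, keys₈]; exact h.rep.trie
    · rw [nd₈, keys₈]
      intro i hi
      have := h.rep.bound i hi
      omega
    · rw [keys₈]; exact h.rep.keys_le
  have r80 : v₈.reg 0 = p := by rw [o₈.reg 0 (by simp), hf.reg 0 (by simp), hp]
  have r83 : v₈.reg 3 = v₈.keys.length + 1 := by
    rw [o₈.reg 3 (by simp), hf.reg 3 (by simp), keys₈, h.nodes]
  have r820 : v₈.reg 20 = v₇.reg 20 := o₈.reg 20 (by simp)
  have r821 : v₈.reg 21 = v₇.reg 21 := o₈.reg 21 (by simp)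
  have r822 : v₈.reg 22 = v₇.reg 22 := o₈.reg 22 (by simp)
  have hloc₈ : Locus v₈.keys (nodeStr T v₈.nd) (v₈.nd 4) (T.drop p) (v₈.reg 21) (v₈.reg 20)
      (v₈.reg 22) := by
    rw [r820, r821, r822, nd₈, keys₈]; exact hf.locus
  have hst₈ : Stuck v₈.keys (nodeStr T v₈.nd) (T.drop p) (v₈.reg 21) (v₈.reg 20) := by
    rw [r820, r821, nd₈, keys₈]; exact hf.stuck
  refine Cmd.wp_mono (splitEdge_spec hW hA rep₈ rev₈ (by rw [keys₈]; omega)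
    (by rw [keys₈]; exact h.legal) hloc₈ hst₈ r80 r83 (by omega))
    fun v₉ ⟨at₉, reg₉, out₉, r9r, k₉, t₉⟩ => ?_
  rw [cwp_seq]
  have r920 : v₉.reg 20 = v₇.reg 20 := by rw [reg₉ 20 (by simp), r820]
  have r928 : v₉.reg 28 = l := by rw [reg₉ 28 (by simp), o₈.reg 28 (by simp), hf.len]
  have rev₉ : Revealed T v₉ := ⟨by rw [reg₉ 1 (by simp), rev₈.reg, r9r], r9r ▸ rev₈.le⟩
  rw [keys₈] at k₉
  refine Cmd.wp_mono (addFactor_spec hW hA rev₉ at₉ (by omega) (by rw [reg₉ 0 (by simp), r80])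
    (by rw [reg₉ 2 (by simp), r82]) (by omega) (by omega))
    fun v₁₀ ⟨rep₁₀, leg₁₀, r103, reg₁₀, out₁₀, r10r, k₁₀, t₁₀⟩ => ?_
  rw [r928] at rep₁₀
  have r100 : v₁₀.reg 0 = p := by rw [reg₁₀ 0 (by simp), reg₉ 0 (by simp), r80]
  have r1028 : v₁₀.reg 28 = l := by rw [reg₁₀ 28 (by simp), r928]
  have e11 : (p + l) % 2 ^ w = p + l := Nat.mod_eq_of_lt (by omega)
  rw [cwp_seq, cwp_set, cwp_seq, cwp_set, cwp_seq, cwp_set]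
  simp only [Expr.eval, BinOp.eval, Expr.cost, r100, r1028, e11, Nat.zero_mod]
  obtain ⟨v₁₁, hv₁₁⟩ : ∃ v₁₁, v₁₁ = (((((v₁₀.setReg 0 (p + l)).tick (1 + 1 + 1 + 1)).setReg 4
    (((v₁₀.setReg 0 (p + l)).tick (1 + 1 + 1 + 1)).reg 0)).tick (1 + 1)).setReg 5 0).tick (1 + 1) :=
    ⟨_, rfl⟩
  have o₁₁ : OnlyRegs [0, 4, 5] v₁₀ v₁₁ := by
    rw [hv₁₁]
    refine (((onlyRegs_set _ _ _ _).mono ?_).trans ((onlyRegs_set _ _ _ _).mono ?_)).trans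
      ((onlyRegs_set _ _ _ _).mono ?_) <;> simp
  have r110 : v₁₁.reg 0 = p + l := by simp [hv₁₁, View.setReg, View.tick]
  have r114 : v₁₁.reg 4 = p + l := by simp [hv₁₁, View.setReg, View.tick]
  have r115 : v₁₁.reg 5 = 0 := by simp [hv₁₁, View.setReg, View.tick]
  have r11r : v₁₁.revealed = v₁₀.revealed := by rw [hv₁₁]; rfl
  have r11t : v₁₁.time = v₁₀.time + 8 := by rw [hv₁₁]; rfl
  rw [← hv₁₁]
  clear hv₁₁
  have rev₁₁ : Revealed T v₁₁ := ⟨by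
    rw [o₁₁.reg 1 (by simp), reg₁₀ 1 (by simp), rev₉.reg, r11r, r10r], by
    rw [r11r, r10r]; exact rev₉.le⟩
  refine Cmd.wp_mono (nextChar_spec hW rev₁₁ (by rw [r114, r115]; omega)) fun v₁₂ c₁₂ => ?_
  rw [r114, r115, Nat.add_zero] at c₁₂
  have o₁₂ := c₁₂.only
  have o1012 : OnlyRegs [0, 1, 4, 5, 11, 12] v₁₀ v₁₂ :=
    (o₁₁.mono (by simp)).trans (o₁₂.mono (by simp))
  have hlT : l ≤ T.length - p := by omega
  have slen : ((T.drop p).take l).length = l := by simp; omega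
  have out₁₂ : v₁₂.out = v.out ++ [(q.encode, v₇.revealed)] := by
    rw [o1012.out, out₁₀, out₉, o₈.out, hf.out]
  have r120 : v₁₂.reg 0 = p + l := by rw [o₁₂.reg 0 (by simp), r110]
  have hlenout : v.out.length = F.length := by
    have := congrArg List.length h.out_eq
    simpa [h.length_eq] using this
  refine ⟨(T.drop p).take l, q, ?_, ?_, ?_⟩
  · intro h0
    rw [h0] at slen
    simp at slen
    omega
  · have hpF : F.flatten.length = p := by rw [← hp, h.pos]
    refine { rep := rep₁₀.only o1012, rev := c₁₂.rev, legal := ?_, keys_le := ?_, pos := ?_,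
             flat := ?_, pos_le := ?_, count := ?_, nodes := ?_, nonempty := ?_,
             length_eq := ?_, out_eq := ?_, online := ?_, choice := ?_, revealed_le := ?_,
             avail := ?_, finished := ?_ }
    · rw [o1012.keys]; exact leg₁₀
    · rw [o1012.keys]; simp; omega
    · rw [r120]; simp only [List.flatten_append, List.length_append, hpF]; simp; omega
    · rw [r120, List.flatten_append, h.flat, hp, List.take_add]; simp
    · omega
    · rw [o1012.reg 2 (by simp), reg₁₀ 2 (by simp), reg₉ 2 (by simp), r82]; simp
    · rw [o1012.reg 3 (by simp), r103, o1012.keys]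
    · intro s hs
      rcases List.mem_append.1 hs with hs | hs
      · exact h.nonempty s hs
      · simp only [List.mem_singleton] at hs
        rintro rfl
        rw [← hs] at slen
        simp at slen
        omega
    · simp [h.length_eq]
    · rw [out₁₂]; simp [h.out_eq]
    · intro x hx
      simp only [out₁₂] at hx ⊢
      simp only [List.length_append, List.length_singleton] at hx
      rcases Nat.lt_or_ge x v.out.length with hlt | hge
      · rw [List.getElem_append_left hlt, List.take_append_of_le_length (by omega)]
        exact h.online x hlt
      · obtain rfl : x = v.out.length := by omega
        simp only [hlenout]
        rw [List.take_of_length_le (by simp)]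
        rw [List.getElem_append_right (by omega)]
        simp only [hlenout, Nat.sub_self, List.getElem_cons_zero, List.flatten_append,
          List.length_append, hpF]
        simp
        omega
    · intro x hF hP
      simp only [List.length_append, List.length_singleton] at hF hP
      rcases Nat.lt_or_ge x F.length with hlt | hge
      · rw [List.getElem_append_left hlt, List.getElem_append_left (by rw [h.length_eq]; exact hlt),
          List.take_append_of_le_length (by omega)]
        exact h.choice x hlt (by rw [h.length_eq]; exact hlt)
      · obtain rfl : x = F.length := by omega
        rw [List.getElem_append_right le_rfl, List.getElem_append_right (by rw [h.length_eq])]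
        simp only [h.length_eq, Nat.sub_self, List.getElem_cons_zero, List.take_left, hpF]
        exact ⟨hf.choice, hqs.symm⟩
    · have := c₁₂.le
      omega
    · intro h0
      have := (c₁₂.avail h0).1
      omega
    · intro h0
      have := (c₁₂.no_avail h0).1
      omega
  · rw [slen]
    have tn := c₁₂.time
    -- The two insertions and all constant costs are charged to the first character of the factor;
    -- 10 * K + 2000 exceeds what is needed by a generous margin.
    have m3 : 2 * K + 700 ≤ (2 * K + 700) * l := Nat.le_mul_of_pos_right _ (by omega)
    have m4 : (10 * K + 2000) * l =
        (K + 152) * (4 * l) + (2 * K + 700) * l + (4 * K + 692) * l := by ring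
    omega

/-- Factors are nonempty, so the remaining length decreases, and the cost 2 of testing the loop is
charged to one character of the factor; hence 2002 in place of 2000. -/
theorem mainLoop_spec (hW : 1024 * (T.length + 2) ≤ 2 ^ w) (hA : ∀ a ∈ T, a ∈ A) (n : ℕ) :
    ∀ (F : List (List ℕ)) (P : List Production) (v : View), Progress T A F P v →
      T.length - v.reg 0 = n →
      Cmd.wp w T A (2 * T.length + 2) K (.loop (.reg 12) (.seq findFactor insertFactor))
        (fun v' => ∃ F' P', Progress T A F' P' v' ∧ v'.reg 12 = 0 ∧
          v'.time ≤ v.time + (10 * K + 2002) * (T.length - v.reg 0) + 2) v := by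
  induction n using Nat.strong_induction_on with
  | _ n ih =>
    intro F P v h hn
    rw [cwp_loop]
    refine ⟨fun h12 => ?_, fun h12 => ⟨F, P, ?_, h12, ?_⟩⟩
    · have h' : Progress T A F P (v.tick ((Expr.reg 12).cost + 1)) := { h with
        rep := ⟨h.rep.trie, h.rep.bound, h.rep.keys_le⟩, rev := h.rev.tick _ }
      have hav := h.avail h12
      have hle := h.rev.le
      rw [cwp_seq]
      refine Cmd.wp_mono (findFactor_spec hW hA h' h12) fun v₁ ⟨l, q, hf⟩ => ?_
      refine Cmd.wp_mono (insertFactor_spec hW hA h' rfl (by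
        change v.reg 0 < _; omega) hf) fun v₂ ⟨s, q', hs, h₂, ht⟩ => ?_
      have e0 : v₂.reg 0 = v.reg 0 + s.length := by
        rw [h₂.pos, h.pos]; simp
      have hs' := List.length_pos_of_ne_nil hs
      have hle₂ := h₂.pos_le
      refine Cmd.wp_mono (ih _ (by omega) _ _ v₂ h₂ rfl) fun v₃ ⟨F', P', h₃, h12', ht₃⟩ =>
        ⟨F', P', h₃, h12', ?_⟩
      have e1 : (10 * K + 2002) * (T.length - v.reg 0) =
          (10 * K + 2000) * s.length + 2 * s.length + (10 * K + 2002) * (T.length - v₂.reg 0) := by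
        rw [show T.length - v.reg 0 = s.length + (T.length - v₂.reg 0) by omega]; ring
      have e2 : (v.tick ((Expr.reg 12).cost + 1)).time = v.time + 2 := rfl
      omega
    · exact { h with rep := ⟨h.rep.trie, h.rep.bound, h.rep.keys_le⟩, rev := h.rev.tick _ }
    · simp only [View.tick, Expr.cost]; omega

theorem lzdPlus_spec {v : View} (hW : 1024 * (T.length + 2) ≤ 2 ^ w) (hA : ∀ a ∈ T, a ∈ A)
    (hreg : ∀ x < 50, v.reg x = 0) (hnd : ∀ j < 8, ∀ i, v.nd j i = 0) (hk : v.keys = [])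
    (ho : v.out = []) (hr : v.revealed = 0) :
    lzdPlus.wp w T A (2 * T.length + 2) K (fun v' => ∃ F P, Progress T A F P v' ∧
      v'.reg 12 = 0 ∧ v'.time ≤ v.time + (10 * K + 2002) * T.length + 50) v := by
  have e2 : 1 % 2 ^ w = 1 := Nat.mod_eq_of_lt (by omega)
  rw [lzdPlus, cwp_seq, cwp_set, cwp_seq]
  obtain ⟨v₁, hv₁⟩ : ∃ v₁, v₁ = (v.setReg 3 (Expr.eval w v.reg (.const 1))).tick
    ((Expr.const 1).cost + 1) := ⟨_, rfl⟩
  have o₁ : OnlyRegs [3] v v₁ := hv₁ ▸ onlyRegs_set _ _ _ _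
  have r3 : v₁.reg 3 = 1 := by rw [hv₁, reg_set, Expr.eval, e2]
  have rr : v₁.revealed = 0 := by rw [hv₁]; exact hr
  have rt : v₁.time = v.time + 2 := by rw [hv₁]; rfl
  have z : ∀ x < 50, x ≠ 3 → v₁.reg x = 0 := fun x hx h3 => by
    rw [o₁.reg x (by simpa using h3), hreg x hx]
  rw [← hv₁]
  have rev₁ : Revealed T v₁ := ⟨by rw [z 1 (by omega) (by omega), rr], by rw [rr]; omega⟩
  refine Cmd.wp_mono (nextChar_spec hW rev₁ (by
    rw [z 4 (by omega) (by omega), z 5 (by omega) (by omega)]; omega)) fun v₂ c₂ => ?_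
  rw [z 4 (by omega) (by omega), z 5 (by omega) (by omega)] at c₂
  have o₂ := c₂.only
  have ond : v₂.nd = v.nd := o₂.nd.trans o₁.nd
  have okeys : v₂.keys = [] := (o₂.keys.trans o₁.keys).trans hk
  have oout : v₂.out = [] := (o₂.out.trans o₁.out).trans ho
  have r20 : v₂.reg 0 = 0 := by rw [o₂.reg 0 (by simp), z 0 (by omega) (by omega)]
  have ht := c₂.time
  have hle := c₂.le
  refine Cmd.wp_mono (mainLoop_spec hW hA _ [] [] v₂ ?_ rfl) fun v₃ ⟨F', P', h₃, h12', ht₃⟩ =>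
    ⟨F', P', h₃, h12', ?_⟩
  · refine { rep := ⟨?_, ?_, ?_⟩, rev := c₂.rev, legal := ?_, keys_le := ?_, pos := ?_, flat := ?_,
             pos_le := ?_, count := ?_, nodes := ?_, nonempty := ?_, length_eq := rfl,
             out_eq := ?_, online := ?_, choice := ?_, revealed_le := ?_, avail := ?_,
             finished := ?_ }
    · rw [okeys, ond]
      exact .empty (hnd 2 (by omega) 0) (by simp [nodeStr, hnd 1 (by omega) 0])
    · intro i _
      rw [ond, hnd 0 (by omega), hnd 1 (by omega)]; omega
    · simp [okeys]
    · rw [okeys]; exact ⟨List.nodup_nil, by simp, by simp⟩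
    · simp [okeys]
    · simp [r20]
    · simp [r20]
    · omega
    · rw [o₂.reg 2 (by simp), z 2 (by omega) (by omega)]; rfl
    · rw [o₂.reg 3 (by simp), r3, okeys]; rfl
    · simp
    · simp [oout]
    · simp [oout]
    · intro x hF; simp at hF
    · omega
    · intro h; have := (c₂.avail h).1; omega
    · intro h; have := (c₂.no_avail h).1; omega
  · rw [r20, Nat.sub_zero] at ht₃
    omega

/-- During the computation the remaining text is described by a position in T, as the later factors
are not known yet. At the end it is the concatenation of the later factors. -/
theorem Progress.isFactorization {F : List (List ℕ)} {P : List Production} {v : View}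
    (h : Progress T A F P v) (h12 : v.reg 12 = 0) : IsFactorization A T F P := by
  have hT : F.flatten = T := by rw [h.flat, h.finished h12, List.take_length]
  refine ⟨hT, h.length_eq, fun x hF hP => ?_⟩
  have h1 := h.choice x hF hP
  have h2 : T.drop (F.take x).flatten.length = (F.drop x).flatten := by
    rw [← hT]
    conv_lhs => rw [← List.take_append_drop x F, List.flatten_append]
    simp
  rwa [h2] at h1

end spec

end LZDPlus

/-! ### The main program combined with an arbitrary dictionary. -/

namespace LZDPlus

open WordRAM

theorem isMain_lzdPlus : lzdPlus.isMain = true := by decide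

/-- With a dictionary, the factorization is computed in linear time on average. -/
theorem exists_exec_lzdPlus {w : ℕ} {T : List ℕ} {A : Finset ℕ} {ι : Type} [Fintype ι]
    {ω : ι → ℕ → ℕ} {K d₀ : ℕ} {init f g : Program}
    (D : Dictionary w T A (2 * T.length + 2) ω K d₀ init f g)
    (hW : 1024 * (T.length + 2) ≤ 2 ^ w) (hA : ∀ a ∈ T, a ∈ A) {C : ℕ} (hC : 257 ≤ C) :
    ∃ S : ι → State,
      (∀ a, Exec w T (ω a) (.seq init (lzdPlus.compile f g)) State.init (S a)) ∧
      (∀ a, ComputedOnline C A T (S a)) ∧ (∀ a, (S a).drawn = d₀) ∧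
      ∑ a, (S a).time ≤ Fintype.card ι * (K + (10 * K + 2002) * T.length + 50) := by
  choose S₀ hex hinv hma htime hspace using D.init_spec
  obtain ⟨v, hcv, F, P, hP, h12, ht⟩ := lzdPlus_spec (w := w) (T := T) (A := A) (K := K)
    (v := ⟨fun _ => 0, fun _ _ => 0, 0, [], [], K⟩) hW hA (fun _ _ => rfl) (fun _ _ _ => rfl) rfl
    rfl rfl
  have hsim : Simulates D ⟨fun _ => 0, fun _ _ => 0, 0, [], [], K⟩ S₀ := by
    refine ⟨fun a => ⟨(hma a).reg, fun j _ i => ?_, (hma a).revealed, (hma a).out, (hma a).drawn,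
      hspace a⟩, hinv, ⟨List.nodup_nil, by simp, by simp⟩, ?_⟩
    · rw [show 16 * i + 2 * j = 2 * (8 * i + j) by ring, (hma a).mem]; rfl
    · have := Finset.sum_le_sum fun a (_ : a ∈ Finset.univ) => htime a
      simpa [Finset.sum_add_distrib] using this
  obtain ⟨S, hS, hsim'⟩ := hcv.simulate isMain_lzdPlus hsim
  refine ⟨S, fun a => .seq (hex a) (hS a), fun a => ?_, fun a => (hsim'.impl a).drawn, ?_⟩
  · have hi := hsim'.impl a
    have h1 := hi.space
    have h2 := hP.keys_le
    have h3 := hP.length_le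
    have h4 := hP.pos_le
    refine ⟨F, P, hP.isFactorization h12, by rw [hi.out, hP.out_eq], fun x hx => ?_, ?_, ?_⟩
    · simp only [hi.out] at hx ⊢
      exact hP.online x hx
    -- Two keys per factor and 128 words per key give 128 * (2 * z + 2) words. The 257th is for the
    -- text itself in the second bound.
    · calc _ ≤ 257 * (F.length + 1) := by omega
        _ ≤ _ := Nat.mul_le_mul_right _ hC
    · calc _ ≤ 257 * (T.length + 1) := by omega
        _ ≤ _ := Nat.mul_le_mul_right _ hC
  · have := hsim'.time
    refine (Nat.le_add_right _ _).trans (this.trans (Nat.mul_le_mul_left _ ?_))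
    simp only at ht
    omega

end LZDPlus

namespace WordRAM

/-! ## Skip lists

A dictionary without randomness: for every number `u`, the keys `(u, c)` are kept in a balanced
skip list, that is, a tree in which all leaves have the same height and inner nodes have two, three
or four children, which form a linked list. The field at `16 * u + 1` is the root of the tree of
`u`. The other fields of a cell are its largest key (3), its right neighbour (5), its first child
(7) and, for a leaf, the value of the key (9). -/

theorem addr_mod {w x j : ℕ} (h : 16 * x + 16 ≤ 2 ^ w) (hj : j < 16) :
    (16 * x + j) % 2 ^ w = 16 * x + j :=
  Nat.mod_eq_of_lt (by omega)

theorem update_field {m : ℕ → ℕ} {i i' j j' v : ℕ} (hj : j < 16) (hj' : j' < 16) :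
    Function.update m (16 * i + j) v (16 * i' + j') =
      if i' = i ∧ j' = j then v else m (16 * i' + j') := by
  rw [Function.update_apply]
  by_cases h : i' = i ∧ j' = j
  · rw [if_pos h, if_pos (by omega)]
  · rw [if_neg h, if_neg (by omega)]

/-- `Tree m h n y r ks fp`: in the memory `m`, the cell `y` is the first one of `n` adjacent trees
of height `h`, the last of which has the right neighbour `r`. Their leaves have the keys and values
`ks`, and their cells are `fp`. -/
inductive Tree (m : ℕ → ℕ) : ℕ → ℕ → ℕ → ℕ → List (ℕ × ℕ) → List ℕ → Prop
  | leaf {x : ℕ} : x ≠ 0 → m (16 * x + 7) = 0 →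
      Tree m 0 1 x (m (16 * x + 5)) [(m (16 * x + 3), m (16 * x + 9))] [x]
  | node {h n x r : ℕ} {ks : List (ℕ × ℕ)} {fp : List ℕ} : x ≠ 0 →
      Tree m h n (m (16 * x + 7)) r ks fp → 2 ≤ n → n ≤ 4 →
      (∃ ks' v, ks = ks' ++ [(m (16 * x + 3), v)]) →
      Tree m (h + 1) 1 x (m (16 * x + 5)) ks (x :: fp)
  | cons {h n y z r : ℕ} {ks₁ ks₂ : List (ℕ × ℕ)} {fp₁ fp₂ : List ℕ} : Tree m h 1 y z ks₁ fp₁ →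
      Tree m h n z r ks₂ fp₂ → Tree m h (n + 1) y r (ks₁ ++ ks₂) (fp₁ ++ fp₂)

namespace Tree

variable {m m' : ℕ → ℕ} {h n y r : ℕ} {ks : List (ℕ × ℕ)} {fp : List ℕ}

theorem pos (t : Tree m h n y r ks fp) : 0 < n := by cases t <;> omega

theorem ne_zero (t : Tree m h n y r ks fp) : y ≠ 0 := by
  induction t with
  | leaf h => exact h
  | node h => exact h
  | cons _ _ ih _ => exact ih

theorem mem_fp (t : Tree m h n y r ks fp) : y ∈ fp := by
  induction t with
  | leaf h => simp
  | node h => simp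
  | cons _ _ ih _ => simp [ih]

theorem congr (t : Tree m h n y r ks fp)
    (hm : ∀ i ∈ fp, ∀ j, j = 3 ∨ j = 5 ∨ j = 7 ∨ j = 9 → m' (16 * i + j) = m (16 * i + j)) :
    Tree m' h n y r ks fp := by
  induction t with
  | @leaf x h0 h7 =>
    have := hm x (by simp)
    rw [← this 5 (by simp), ← this 3 (by simp), ← this 9 (by simp)]
    rw [← this 7 (by simp)] at h7
    exact .leaf h0 h7
  | @node h n x r ks fp h0 _ h2 h4 hk ih =>
    have hx := hm x (by simp)
    have ih := ih fun i hi => hm i (by simp [hi])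
    rw [← hx 7 (by simp)] at ih
    rw [← hx 5 (by simp)]
    rw [← hx 3 (by simp)] at hk
    exact .node h0 ih h2 h4 hk
  | cons _ _ ih₁ ih₂ =>
    exact .cons (ih₁ fun i hi => hm i (by simp [hi])) (ih₂ fun i hi => hm i (by simp [hi]))

theorem cons_inv (t : Tree m h n y r ks fp) (hn : 2 ≤ n) :
    ∃ z ks₁ ks₂ fp₁ fp₂, Tree m h 1 y z ks₁ fp₁ ∧ Tree m h (n - 1) z r ks₂ fp₂ ∧
      ks = ks₁ ++ ks₂ ∧ fp = fp₁ ++ fp₂ := by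
  cases t with
  | leaf => omega
  | node => omega
  | cons t₁ t₂ => exact ⟨_, _, _, _, _, t₁, t₂, rfl, rfl⟩

/-- The root of a tree has its largest key and its right neighbour. -/
theorem root (t : Tree m h n y r ks fp) (hn : n = 1) :
    (∃ ks' v, ks = ks' ++ [(m (16 * y + 3), v)]) ∧ m (16 * y + 5) = r := by
  cases t with
  | leaf => exact ⟨⟨[], _, rfl⟩, rfl⟩
  | node _ _ _ _ hk => exact ⟨hk, rfl⟩
  | cons _ t₂ => have := t₂.pos; omega

theorem append {n₁ n₂ z : ℕ} {ks₁ ks₂ : List (ℕ × ℕ)} {fp₁ fp₂ : List ℕ}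
    (t₁ : Tree m h n₁ y z ks₁ fp₁) (t₂ : Tree m h n₂ z r ks₂ fp₂) :
    Tree m h (n₁ + n₂) y r (ks₁ ++ ks₂) (fp₁ ++ fp₂) := by
  induction n₁ generalizing y ks₁ fp₁ with
  | zero => exact absurd t₁.pos (lt_irrefl _)
  | succ n₁ ih =>
    rcases Nat.eq_zero_or_pos n₁ with rfl | hpos
    · rw [zero_add, Nat.add_comm]
      exact .cons t₁ t₂
    · obtain ⟨z', k₁, k₂, f₁, f₂, a, b, rfl, rfl⟩ := t₁.cons_inv (by omega)
      rw [List.append_assoc, List.append_assoc, show n₁ + 1 + n₂ = (n₁ + n₂) + 1 by omega]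
      exact .cons a (ih b)

/-- An inner node joins at least two trees into one, so each inner node is paid for by a decrease in
the number of trees. This bounds the space by the number of keys. -/
theorem length_fp (t : Tree m h n y r ks fp) : fp.length + n ≤ 2 * ks.length := by
  induction t with
  | leaf => simp
  | node _ _ h2 _ _ ih => simp; omega
  | cons _ _ ih₁ ih₂ => simp; omega

theorem pow_le (t : Tree m h n y r ks fp) : n * 2 ^ h ≤ ks.length := by
  induction t with
  | leaf => simp
  | @node h n x r ks fp _ _ h2 _ _ ih =>
    refine le_trans ?_ ih
    rw [one_mul, pow_succ, mul_comm]
    exact Nat.mul_le_mul_right _ h2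
  | cons _ _ ih₁ ih₂ =>
    rw [List.length_append, add_mul, add_comm]
    exact add_le_add ih₁ ih₂

theorem ks_ne_nil (t : Tree m h n y r ks fp) : ks ≠ [] := by
  rintro rfl
  have h1 := t.pow_le
  have h2 := Nat.mul_pos t.pos (Nat.two_pow_pos h)
  simp only [List.length_nil] at h1
  omega

end Tree

/-- Keys are increasing. -/
def Increasing (ks : List (ℕ × ℕ)) : Prop := ks.Pairwise fun a b => a.1 < b.1

/-- `s'` differs from `s` only in the registers `xs`, in the time and in the space. -/
structure SameBut (xs : List ℕ) (s s' : State) : Prop where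
  reg : ∀ x ∉ xs, s'.reg x = s.reg x
  revealed : s'.revealed = s.revealed
  drawn : s'.drawn = s.drawn
  out : s'.out = s.out

theorem SameBut.trans {xs : List ℕ} {s s' s'' : State} (h : SameBut xs s s')
    (h' : SameBut xs s' s'') : SameBut xs s s'' :=
  ⟨fun x hx => (h'.reg x hx).trans (h.reg x hx), h'.revealed.trans h.revealed,
    h'.drawn.trans h.drawn, h'.out.trans h.out⟩

/-- One step of the search for the key in register 41 from the cell in register 50. -/
def skipFindStep : Program :=
  .seq (.instr (.load 53 (fieldAddr 3 (.reg 50)))) <|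
  .ite (.bin .lt (.reg 53) (.reg 41)) (.instr (.load 50 (fieldAddr 5 (.reg 50))))
    (.seq (.instr (.load 54 (fieldAddr 7 (.reg 50)))) <|
      .ite (.reg 54) (.instr (.assign 50 (.reg 54)))
        (.seq (.instr (.assign 51 (.const 0))) <|
          .ite (.bin .eq (.reg 53) (.reg 41)) (.instr (.load 42 (fieldAddr 9 (.reg 50)))) .skip))

/-- The search for the value of the key in register 41, in the tree of register 40. -/
def skipFind : Program :=
  .seq (.instr (.load 50 (fieldAddr 1 (.reg 40)))) <| .seq (.instr (.assign 42 (.const 0))) <|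
  .seq (.instr (.assign 51 (.reg 50))) <| .loop (.reg 51) skipFindStep

section find

variable {w : ℕ} {T : List ℕ} {ω : ℕ → ℕ}

/-- The effect of a search in the tree with the keys and values `ks`. -/
structure SkipFound (ks : List (ℕ × ℕ)) (B t : ℕ) (s s' : State) : Prop where
  same : SameBut [42, 50, 51, 53, 54] s s'
  mem : s'.mem = s.mem
  res : (s.reg 41, s'.reg 42) ∈ ks ∨ (∀ e, (s.reg 41, e) ∉ ks) ∧ s'.reg 42 = s.reg 42
  time : s'.time ≤ s.time + t
  space : s'.space ≤ max s.space B

/-- The potential 5 * h + n drops in every step. A step to the right lowers n by one; a step down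
replaces 5 * (h + 1) + 1 by 5 * h + n with n ≤ 4. The assumption of a key that is not smaller, which
the sentinel provides, keeps the search from running off the end. -/
theorem skipFindLoop_spec {m : ℕ → ℕ} {B h n y r : ℕ} {ks : List (ℕ × ℕ)} {fp : List ℕ}
    (t : Tree m h n y r ks fp) (hfp : ∀ i ∈ fp, 16 * i + 16 ≤ 2 ^ w ∧ 16 * i + 16 ≤ B) :
    ∀ s : State, s.mem = m → s.reg 50 = y → s.reg 51 ≠ 0 → Increasing ks →
      (∃ k ∈ ks, s.reg 41 ≤ k.1) →
      Program.wp w T ω (.loop (.reg 51) skipFindStep)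
        (SkipFound ks B (50 * (5 * h + n)) s) s := by
  induction t with
  | @leaf x h0 h7 =>
    intro s hm h50 h51 hinc hle
    have hx := hfp x (by simp)
    have hx1 := hx.1
    simp only [List.mem_singleton, exists_eq_left] at hle
    rw [wp_loop]
    refine ⟨fun _ => ?_, fun h => absurd h h51⟩
    simp only [skipFindStep, wp_seq, wp_instr, wp_ite, wp_skip, Instr.effect, State.touch,
      State.setReg, State.tick, Expr.eval, BinOp.eval, fieldAddr, Instr.cost, Expr.cost]
    simp [h50, hm, h7, addr_mod hx1]
    refine ⟨fun hlt => by omega, fun _ => ⟨fun heq => ?_, fun hne => ?_⟩⟩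
    · rw [wp_loop]
      refine ⟨fun h => by simp [Expr.eval] at h, fun _ => ?_⟩
      simp only [State.tick, Expr.cost]
      refine ⟨⟨fun z hz => ?_, rfl, rfl, rfl⟩, ?_, ?_, ?_, ?_⟩
      · simp at hz; simp [hz]
      · simp [hm]
      · left
        have heq : m (16 * x + 3) = s.reg 41 := by by_contra hne; simp [hne] at heq
        simp [heq]
      · simp only []; omega
      · simp; omega
    · rw [wp_loop]
      refine ⟨fun h => by simp [Expr.eval] at h, fun _ => ?_⟩
      simp only [State.tick, Expr.cost]
      refine ⟨⟨fun z hz => ?_, rfl, rfl, rfl⟩, ?_, ?_, ?_, ?_⟩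
      · simp at hz; simp [hz]
      · simp [hm]
      · right
        have hne : m (16 * x + 3) ≠ s.reg 41 := by intro h; simp [h] at hne
        simp; intro h; exact hne h.symm
      · simp only []; omega
      · simp; omega
  | @node h n x r ks fp h0 t' h2 h4 hk ih =>
    intro s hm h50 h51 hinc hle
    have hx := hfp x (by simp)
    have hx1 := hx.1
    have h7 := t'.ne_zero
    obtain ⟨ks', v, hks⟩ := hk
    have hle' : s.reg 41 ≤ m (16 * x + 3) := by
      obtain ⟨k, hk, hle⟩ := hle
      rw [hks] at hk hinc
      rcases List.mem_append.1 hk with hk | hk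
      · have := (List.pairwise_append.1 hinc).2.2 k hk _ (List.mem_singleton_self _)
        simp at this; omega
      · simp at hk; simpa [hk] using hle
    rw [wp_loop]
    refine ⟨fun _ => ?_, fun h => absurd h h51⟩
    simp only [skipFindStep, wp_seq, wp_instr, wp_ite, wp_skip, Instr.effect, State.touch,
      State.setReg, State.tick, Expr.eval, BinOp.eval, fieldAddr, Instr.cost, Expr.cost]
    simp [h50, hm, h7, addr_mod hx1]
    refine ⟨fun hlt => by omega, fun _ => ?_⟩
    refine Program.wp_mono (ih (fun i hi => hfp i (by simp [hi])) _ ?_ ?_ ?_ hinc ?_)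
      fun s' h' => ?_
    · simp
    · simp
    · simpa using h51
    · simpa using hle
    · refine ⟨⟨fun z hz => ?_, h'.same.revealed, h'.same.drawn, h'.same.out⟩, ?_, ?_, ?_, ?_⟩
      · rw [h'.same.reg z hz]; simp at hz; simp [hz]
      · rw [h'.mem, hm]
      · simpa using h'.res
      · have := h'.time
        simp only at this
        omega
      · have := h'.space
        simp at this ⊢
        omega
  | @cons h n y z r ks₁ ks₂ fp₁ fp₂ t₁ t₂ ih₁ ih₂ =>
    intro s hm h50 h51 hinc hle
    obtain ⟨⟨ks', v, hks⟩, hr⟩ := t₁.root rfl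
    obtain ⟨hinc₁, hinc₂, hinc₁₂⟩ := List.pairwise_append.1 hinc
    have hlast : ∀ k ∈ ks₁, k.1 ≤ m (16 * y + 3) := by
      intro k hk
      rw [hks] at hk hinc₁
      rcases List.mem_append.1 hk with hk | hk
      · have := (List.pairwise_append.1 hinc₁).2.2 k hk _ (List.mem_singleton_self _)
        exact this.le
      · simp at hk; simp [hk]
    have hmem : (m (16 * y + 3), v) ∈ ks₁ := by simp [hks]
    -- If the key is at most the largest one of the first tree, the search never leaves this tree,
    -- and the run is the same as if the others were absent.
    by_cases hc : s.reg 41 ≤ m (16 * y + 3)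
    · refine Program.wp_mono (ih₁ (fun i hi => hfp i (by simp [hi])) s hm h50 h51 hinc₁
        ⟨_, hmem, hc⟩) fun s' h' => ?_
      refine ⟨h'.same, h'.mem, ?_, ?_, h'.space⟩
      · rcases h'.res with h | ⟨h, h42⟩
        · exact .inl (by simp [h])
        · refine .inr ⟨fun e he => ?_, h42⟩
          rcases List.mem_append.1 he with he | he
          · exact h e he
          · have := hinc₁₂ _ hmem _ he
            simp at this; omega
      · have := h'.time
        omega
    · have hx := hfp y (by simp [t₁.mem_fp])
      have hx1 := hx.1
      have hlt : m (16 * y + 3) < s.reg 41 := by omega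
      rw [wp_loop]
      refine ⟨fun _ => ?_, fun h => absurd h h51⟩
      simp only [skipFindStep, wp_seq, wp_instr, wp_ite, wp_skip, Instr.effect, State.touch,
        State.setReg, State.tick, Expr.eval, BinOp.eval, fieldAddr, Instr.cost, Expr.cost]
      simp [h50, hm, addr_mod hx1, hlt, hr]
      refine Program.wp_mono (ih₂ (fun i hi => hfp i (by simp [hi])) _ ?_ ?_ ?_ hinc₂ ?_)
        fun s' h' => ?_
      · simp
      · simp
      · simpa using h51
      · obtain ⟨k, hk, hle⟩ := hle
        rcases List.mem_append.1 hk with hk | hk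
        · have := hlast k hk; omega
        · exact ⟨k, hk, by simpa using hle⟩
      · refine ⟨⟨fun z hz => ?_, h'.same.revealed, h'.same.drawn, h'.same.out⟩, ?_, ?_, ?_, ?_⟩
        · rw [h'.same.reg z hz]; simp at hz; simp [hz]
        · rw [h'.mem, hm]
        · have := h'.res
          simp at this
          rcases this with h | ⟨h, h42⟩
          · exact .inl (by simp [h])
          · refine .inr ⟨fun e he => ?_, h42⟩
            rcases List.mem_append.1 he with he | he
            · have := hlast _ he; simp at this; omega
            · exact h e he
        · have := h'.time
          simp only at this
          omega
        · have := h'.space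
          simp at this ⊢
          omega

end find

end WordRAM

/-! ### Insertion into skip lists: single steps and their effect on adjacent trees. -/

namespace WordRAM

/-- The memory `m'` arises from `m` by the insertion of the key `c` with the value `e` into `n`
adjacent trees, which become at most `N` adjacent trees. The cells in use are those up to `cnt`
before the insertion, and those up to `cnt'` afterwards. -/
def Inserted (m m' : ℕ → ℕ) (cnt cnt' h n y r : ℕ) (ks : List (ℕ × ℕ)) (fp : List ℕ)
    (c e N : ℕ) : Prop :=
  cnt ≤ cnt' ∧
  (∀ i j, j < 16 → (j ≠ 3 ∧ j ≠ 5 ∧ j ≠ 7 ∧ j ≠ 9 ∨ i ∉ fp ∧ i ≤ cnt) →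
    m' (16 * i + j) = m (16 * i + j)) ∧
  ∃ n' p q fp', n ≤ n' ∧ n' ≤ N ∧ ks = p ++ q ∧ q ≠ [] ∧ (∀ k ∈ p, k.1 < c) ∧
    (∀ k ∈ q, c < k.1) ∧ Tree m' h n' y r (p ++ (c, e) :: q) fp' ∧ fp'.Nodup ∧
    (∀ i ∈ fp', i ∈ fp ∨ cnt < i ∧ i ≤ cnt') ∧ fp'.length + cnt = fp.length + cnt'

section inserted

variable {m m' : ℕ → ℕ} {cnt cnt' h n y z r c e N : ℕ} {ks ks₁ ks₂ : List (ℕ × ℕ)}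
  {fp fp₁ fp₂ : List ℕ}

theorem Inserted.mono {N' : ℕ} (hi : Inserted m m' cnt cnt' h n y r ks fp c e N) (hN : N ≤ N') :
    Inserted m m' cnt cnt' h n y r ks fp c e N' := by
  obtain ⟨h1, h2, n', p, q, fp', h3, h4, h5⟩ := hi
  exact ⟨h1, h2, n', p, q, fp', h3, h4.trans hN, h5⟩

/-- The trees to the right occupy old cells outside of the changed footprint, so they survive. The
first of them is still the right neighbour, since an insertion keeps `r`. -/
theorem Inserted.cons_left (hi : Inserted m m' cnt cnt' h 1 y z ks₁ fp₁ c e N)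
    (t₂ : Tree m h n z r ks₂ fp₂) (hnd : (fp₁ ++ fp₂).Nodup) (hfp : ∀ i ∈ fp₂, i ≤ cnt)
    (hinc : Increasing (ks₁ ++ ks₂)) :
    Inserted m m' cnt cnt' h (n + 1) y r (ks₁ ++ ks₂) (fp₁ ++ fp₂) c e (N + n) := by
  obtain ⟨h1, h2, n', p, q, fp', h3, h4, rfl, hq, hp1, hq1, t', hnd', hmem, hlen⟩ := hi
  rw [List.nodup_append] at hnd
  have t₂' : Tree m' h n z r ks₂ fp₂ := t₂.congr fun i hi j hj =>
    h2 i j (by omega) (.inr ⟨fun hi' => hnd.2.2 i hi' i hi rfl, hfp i hi⟩)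
  have := t'.append t₂'
  refine ⟨h1, fun i j hj hij => h2 i j hj (hij.imp_right fun h => ⟨?_, h.2⟩), n' + n, p, q ++ ks₂,
    fp' ++ fp₂, by omega, by omega, by simp, by simp [hq], hp1, ?_, by simpa using this, ?_, ?_, ?_⟩
  · exact fun h' => h.1 (by simp [h'])
  · intro k hk
    rcases List.mem_append.1 hk with hk | hk
    · exact hq1 k hk
    · obtain ⟨k', hk'⟩ := List.exists_mem_of_ne_nil _ hq
      exact (hq1 k' hk').trans ((List.pairwise_append.1 hinc).2.2 k' (by simp [hk']) k hk)
  · refine List.nodup_append.2 ⟨hnd', hnd.2.1, fun a ha b hb hab => ?_⟩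
    subst hab
    rcases hmem a ha with h | h
    · exact hnd.2.2 a h a hb rfl
    · have := hfp a hb
      omega
  · intro i hi
    rcases List.mem_append.1 hi with hi | hi
    · exact (hmem i hi).imp_left fun h => by simp [h]
    · simp [hi]
  · simp; omega

theorem Inserted.cons_right (hi : Inserted m m' cnt cnt' h n z r ks₂ fp₂ c e N)
    (t₁ : Tree m h 1 y z ks₁ fp₁) (hnd : (fp₁ ++ fp₂).Nodup) (hfp : ∀ i ∈ fp₁, i ≤ cnt)
    (hlt : ∀ k ∈ ks₁, k.1 < c) :
    Inserted m m' cnt cnt' h (n + 1) y r (ks₁ ++ ks₂) (fp₁ ++ fp₂) c e (N + 1) := by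
  obtain ⟨h1, h2, n', p, q, fp', h3, h4, rfl, hq, hp1, hq1, t', hnd', hmem, hlen⟩ := hi
  rw [List.nodup_append] at hnd
  have t₁' : Tree m' h 1 y z ks₁ fp₁ := t₁.congr fun i hi j hj =>
    h2 i j (by omega) (.inr ⟨fun hi' => hnd.2.2 i hi i hi' rfl, hfp i hi⟩)
  have := Tree.cons t₁' t'
  refine ⟨h1, fun i j hj hij => h2 i j hj (hij.imp_right fun h => ⟨?_, h.2⟩), n' + 1, ks₁ ++ p, q,
    fp₁ ++ fp', by omega, by omega, by simp, hq, ?_, hq1, by simpa using this, ?_, ?_, ?_⟩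
  · exact fun h' => h.1 (by simp [h'])
  · intro k hk
    rcases List.mem_append.1 hk with hk | hk
    · exact hlt k hk
    · exact hp1 k hk
  · refine List.nodup_append.2 ⟨hnd.1, hnd', fun a ha b hb hab => ?_⟩
    subst hab
    rcases hmem a hb with h | h
    · exact hnd.2.2 a ha a h rfl
    · have := hfp a ha
      omega
  · intro i hi
    rcases List.mem_append.1 hi with hi | hi
    · simp [hi]
    · exact (hmem i hi).imp_left fun h => by simp [h]
  · simp; omega

/-- The parent need not be changed. Its first child keeps its cell, because an insertion keeps `y`,
and its largest key remains the same, because the new key precedes an old one (`q ≠ []`). -/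
theorem Inserted.node {x : ℕ} (hi : Inserted m m' cnt cnt' h n (m (16 * x + 7)) r ks fp c e 4)
    (h0 : x ≠ 0) (hn : 2 ≤ n) (hk : ∃ ks' v, ks = ks' ++ [(m (16 * x + 3), v)])
    (hnd : (x :: fp).Nodup) (hx : x ≤ cnt) :
    Inserted m m' cnt cnt' (h + 1) 1 x (m (16 * x + 5)) ks (x :: fp) c e 1 := by
  obtain ⟨h1, h2, n', p, q, fp', h3, h4, rfl, hq, hp1, hq1, t', hnd', hmem, hlen⟩ := hi
  rw [List.nodup_cons] at hnd
  have hxm : ∀ j < 16, m' (16 * x + j) = m (16 * x + j) := fun j hj =>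
    h2 x j hj (.inr ⟨hnd.1, hx⟩)
  rw [← hxm 7 (by norm_num)] at t'
  rw [← hxm 3 (by norm_num)] at hk
  rw [← hxm 5 (by norm_num)]
  refine ⟨h1, fun i j hj hij => h2 i j hj (hij.imp_right fun h => ⟨?_, h.2⟩), 1, p, q,
    x :: fp', le_rfl, le_rfl, rfl, hq, hp1, hq1, .node h0 t' (by omega) h4 ?_, ?_, ?_, ?_⟩
  · exact fun h' => h.1 (by simp [h'])
  · obtain ⟨ks', v, hk⟩ := hk
    have hl := List.dropLast_append_getLast hq
    rw [← hl, ← List.append_assoc] at hk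
    have := (List.append_inj' hk rfl).2
    exact ⟨p ++ (c, e) :: q.dropLast, v, by
      rw [List.append_assoc, List.cons_append, ← this, hl]⟩
  · refine List.nodup_cons.2 ⟨fun h => ?_, hnd'⟩
    rcases hmem x h with h | h
    · exact hnd.1 h
    · omega
  · intro i hi
    rcases List.mem_cons.1 hi with rfl | hi
    · simp
    · exact (hmem i hi).imp_left fun h => by simp [h]
  · simp; omega

/-- A split uses the cell `cnt + 1` before the insertion goes on, so seen from the memory before the
split this cell counts as new. -/
theorem Inserted.of_split {m₁ : ℕ → ℕ} {n₁ : ℕ}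
    (hi : Inserted m₁ m' (cnt + 1) cnt' h n₁ y r ks fp₁ c e N) (hn : n ≤ n₁)
    (hfp : ∀ i, i ∈ fp₁ ↔ i = cnt + 1 ∨ i ∈ fp) (hlen : fp₁.length = fp.length + 1)
    (hm : ∀ i j, j < 16 → (j ≠ 3 ∧ j ≠ 5 ∧ j ≠ 7 ∧ j ≠ 9 ∨ i ∉ fp ∧ i ≤ cnt) →
      m₁ (16 * i + j) = m (16 * i + j)) :
    Inserted m m' cnt cnt' h n y r ks fp c e N := by
  obtain ⟨h1, h2, n', p, q, fp', h3, h4, rfl, hq, hp1, hq1, t', hnd', hmem, hlen'⟩ := hi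
  refine ⟨by omega, fun i j hj hij => (h2 i j hj (hij.imp_right fun h => ⟨?_, by omega⟩)).trans
    (hm i j hj hij), n', p, q, fp', by omega, h4, rfl, hq, hp1, hq1, t', hnd', ?_, by omega⟩
  · rw [hfp]
    rintro (h' | h')
    · omega
    · exact h.1 h'
  · intro i hi
    rcases hmem i hi with h | h
    · rcases (hfp i).1 h with h | h
      · right; omega
      · exact .inl h
    · right; omega

end inserted

/-- The insertion of the key in register 41 with the value in register 43 before the leaf in
register 50. Register 52 counts the cells. -/
def skipInsertLeaf : Program :=
  .seq (.instr (.assign 52 (.bin .add (.reg 52) (.const 1)))) <|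
  .seq (.instr (.load 59 (fieldAddr 5 (.reg 50)))) <|
  .seq (.instr (.load 60 (fieldAddr 9 (.reg 50)))) <|
  .seq (.instr (.store (fieldAddr 5 (.reg 52)) (.reg 59))) <|
  .seq (.instr (.store (fieldAddr 9 (.reg 52)) (.reg 60))) <|
  .seq (.instr (.store (fieldAddr 7 (.reg 52)) (.const 0))) <|
  .seq (.instr (.store (fieldAddr 3 (.reg 52)) (.reg 53))) <|
  .seq (.instr (.store (fieldAddr 5 (.reg 50)) (.reg 52))) <|
  .seq (.instr (.store (fieldAddr 3 (.reg 50)) (.reg 41))) <|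
  .seq (.instr (.store (fieldAddr 9 (.reg 50)) (.reg 43))) (.instr (.assign 51 (.const 0)))

/-- The separation of the last two of the four children of the node in register 50. -/
def skipSplit : Program :=
  .seq (.instr (.assign 52 (.bin .add (.reg 52) (.const 1)))) <|
  .seq (.instr (.load 59 (fieldAddr 5 (.reg 50)))) <|
  .seq (.instr (.store (fieldAddr 5 (.reg 52)) (.reg 59))) <|
  .seq (.instr (.store (fieldAddr 7 (.reg 52)) (.reg 57))) <|
  .seq (.instr (.store (fieldAddr 3 (.reg 52)) (.reg 53))) <|
  .seq (.instr (.store (fieldAddr 5 (.reg 50)) (.reg 52)))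
    (.instr (.store (fieldAddr 3 (.reg 50)) (.reg 56)))

/-- The first child of the node in register 50, which is in register 54, becomes the next cell,
but a node with four children is split instead. -/
def skipDescend : Program :=
  .seq (.instr (.load 55 (fieldAddr 5 (.reg 54)))) <|
  .seq (.instr (.load 56 (fieldAddr 3 (.reg 55)))) <|
  .ite (.bin .eq (.reg 56) (.reg 53)) (.instr (.assign 50 (.reg 54)))
    (.seq (.instr (.load 57 (fieldAddr 5 (.reg 55)))) <|
      .seq (.instr (.load 58 (fieldAddr 3 (.reg 57)))) <|
      .ite (.bin .eq (.reg 58) (.reg 53)) (.instr (.assign 50 (.reg 54))) skipSplit)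

/-- One step of the insertion of the key in register 41. -/
def skipInsertStep : Program :=
  .seq (.instr (.load 53 (fieldAddr 3 (.reg 50)))) <|
  .ite (.bin .lt (.reg 53) (.reg 41)) (.instr (.load 50 (fieldAddr 5 (.reg 50))))
    (.seq (.instr (.load 54 (fieldAddr 7 (.reg 50)))) <| .ite (.reg 54) skipDescend skipInsertLeaf)

section insert

variable {w : ℕ} {T : List ℕ} {ω : ℕ → ℕ}

/-- Hiding the postcondition behind a variable keeps the simplifier from unfolding it while a
program is executed symbolically. -/
theorem Program.wp_intro {p : Program} {Q : State → Prop} {s : State}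
    (h : ∀ Q', (∀ s', Q s' → Q' s') → Program.wp w T ω p Q' s) : Program.wp w T ω p Q s :=
  h Q fun _ => id

/-- The effect of an insertion into `n` adjacent trees. -/
structure SkipInserted (h n y r : ℕ) (ks : List (ℕ × ℕ)) (fp : List ℕ) (N d t : ℕ) (s s' : State) :
    Prop where
  same : SameBut [50, 51, 52, 53, 54, 55, 56, 57, 58, 59, 60] s s'
  ins : Inserted s.mem s'.mem (s.reg 52) (s'.reg 52) h n y r ks fp (s.reg 41) (s.reg 43) N
  count : s'.reg 52 ≤ s.reg 52 + d
  time : s'.time ≤ s.time + t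
  space : s'.space ≤ max s.space (16 * s'.reg 52 + 16)

/-- What is known when an insertion into `n` adjacent trees starts. -/
structure SkipInsertPre (h n y r : ℕ) (ks : List (ℕ × ℕ)) (fp : List ℕ) (s : State) : Prop where
  tree : Tree s.mem h n y r ks fp
  nodup : fp.Nodup
  bound : ∀ i ∈ fp, i ≤ s.reg 52
  cell : s.reg 50 = y
  go : s.reg 51 ≠ 0
  inc : Increasing ks
  lt : ∃ k ∈ ks, s.reg 41 < k.1
  ne : ∀ k ∈ ks, s.reg 41 ≠ k.1

/-- The old entry moves to a new right neighbour and the new entry takes over the old cell. So no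
pointer to the left neighbour or from the parent has to change. -/
theorem skipInsertLoop_leaf {x r : ℕ} {ks : List (ℕ × ℕ)} {fp : List ℕ} {s : State}
    (hs : SkipInsertPre 0 1 x r ks fp s) (hw : 16 * (s.reg 52 + 1) + 16 ≤ 2 ^ w) :
    Program.wp w T ω (.loop (.reg 51) skipInsertStep) (SkipInserted 0 1 x r ks fp 2 1 100 s) s := by
  obtain ⟨t, hnd, hb, h50, h51, hinc, hlt, hne⟩ := hs
  generalize hm : s.mem = m at t
  cases t with
  | cons t₁ t₂ => exact absurd t₂.pos (by omega)
  | leaf h0 h7 =>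
    have hxc := hb x (by simp)
    have hx1 : 16 * x + 16 ≤ 2 ^ w := by omega
    have hc1 : 16 * (s.reg 52 + 1) + 16 ≤ 2 ^ w := by omega
    have hc2 : (s.reg 52 + 1) % 2 ^ w = s.reg 52 + 1 := Nat.mod_eq_of_lt (by omega)
    simp only [List.mem_singleton, exists_eq_left] at hlt
    rw [wp_loop]
    refine ⟨fun _ => ?_, fun h => absurd h h51⟩
    generalize hQ : Program.wp w T ω (.loop (.reg 51) skipInsertStep) _ = Q
    simp only [skipInsertStep, wp_seq, wp_instr, wp_ite, Instr.effect, State.touch,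
      State.setReg, State.tick, Expr.eval, BinOp.eval, fieldAddr, Instr.cost, Expr.cost]
    simp [h50, hm, h7, addr_mod hx1, hlt.not_gt]
    simp only [skipInsertLeaf, wp_seq, wp_instr, Instr.effect, State.touch,
      State.setReg, State.tick, Expr.eval, BinOp.eval, fieldAddr, Instr.cost, Expr.cost]
    simp [h50, addr_mod hx1, addr_mod hc1, hc2]
    subst hQ
    rw [wp_loop]
    refine ⟨fun h => by simp [Expr.eval] at h, fun _ => ?_⟩
    simp only [State.tick, Expr.cost]
    refine ⟨⟨fun z hz => ?_, rfl, rfl, rfl⟩, ?_, ?_, ?_, ?_⟩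
    · simp at hz; simp [hz]
    · simp [hm]
      have hxc' : x ≠ s.reg 52 + 1 := by omega
      set m' : ℕ → ℕ := Function.update _ _ _ with hm'
      have e1 : ∀ i j, j < 16 → (j ≠ 3 ∧ j ≠ 5 ∧ j ≠ 7 ∧ j ≠ 9 ∨ i ∉ [x] ∧ i ≤ s.reg 52) →
          m' (16 * i + j) = m (16 * i + j) := by
        intro i j hj hij
        simp only [List.mem_singleton] at hij
        rw [hm']
        repeat rw [Function.update_of_ne (by omega)]
      have e2 : m' (16 * x + 7) = 0 := by simp [hm', update_field, hxc', h7]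
      have e3 : m' (16 * x + 3) = s.reg 41 := by simp [hm']
      have e4 : m' (16 * x + 9) = s.reg 43 := by simp [hm']
      have e5 : m' (16 * x + 5) = s.reg 52 + 1 := by simp [hm']
      have e6 : m' (16 * (s.reg 52 + 1) + 3) = m (16 * x + 3) := by
        simp [hm', update_field, hxc'.symm]
      have e7 : m' (16 * (s.reg 52 + 1) + 5) = m (16 * x + 5) := by
        simp [hm', update_field, hxc'.symm]
      have e8 : m' (16 * (s.reg 52 + 1) + 7) = 0 := by
        simp [hm', update_field, hxc'.symm]
      have e9 : m' (16 * (s.reg 52 + 1) + 9) = m (16 * x + 9) := by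
        simp [hm', update_field, hxc'.symm]
      have t1 := Tree.leaf h0 e2
      have t2 := Tree.leaf (by omega) e8
      rw [e3, e4, e5] at t1
      rw [e6, e7, e9] at t2
      refine ⟨by omega, e1, 2, [], _, _, by omega, le_rfl, rfl,
        by simp, by simp, by simpa using hlt, t1.cons t2, ?_, ?_, ?_⟩
      · simp; omega
      · simp
      · simp; omega
    · simp
    · simp only []; omega
    · simp; omega

/-- The chain of children runs on into the next node, so its end is not visible from the pointers.
The last child is recognized by its largest key, which is that of the parent; keys increase, so no
earlier child has it. -/
theorem skipDescend_spec {B h n y r : ℕ} {ks : List (ℕ × ℕ)} {fp : List ℕ} {s : State}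
    (t : Tree s.mem h n y r ks fp) (h54 : s.reg 54 = y) (hn : n = 2 ∨ n = 3)
    (h53 : ∃ ks' v, ks = ks' ++ [(s.reg 53, v)]) (hinc : Increasing ks)
    (hfp : ∀ i ∈ fp, 16 * i + 16 ≤ 2 ^ w ∧ 16 * i + 16 ≤ B) :
    Program.wp w T ω skipDescend (fun s' => SameBut [50, 55, 56, 57, 58] s s' ∧ s'.mem = s.mem ∧
      s'.reg 50 = y ∧ s'.time ≤ s.time + 40 ∧ s'.space ≤ max s.space B) s := by
  obtain ⟨y₂, k₁, k₂, f₁, f₂, t₁, t₂, rfl, rfl⟩ := t.cons_inv (by omega)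
  obtain ⟨ks', v, h53⟩ := h53
  have hr₁ := (t₁.root rfl).2
  have hy := hfp y (by simp [t₁.mem_fp])
  have hy₂ := hfp y₂ (by simp [t₂.mem_fp])
  generalize hm : s.mem = m at *
  refine Program.wp_intro fun Q hQ => ?_
  rcases hn with rfl | rfl
  · obtain ⟨⟨l, u, hl⟩, -⟩ := t₂.root rfl
    rw [hl, ← List.append_assoc] at h53
    have hk : m (16 * y₂ + 3) = s.reg 53 := by
      have := (List.append_inj' h53 rfl).2
      simp at this
      exact this.1
    simp only [skipDescend, wp_seq, wp_instr, wp_ite, Instr.effect, State.touch,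
      State.setReg, State.tick, Expr.eval, BinOp.eval, fieldAddr, Instr.cost, Expr.cost]
    simp [h54, hm, hr₁, addr_mod hy.1, addr_mod hy₂.1, hk]
    refine hQ _ ⟨⟨fun z hz => ?_, rfl, rfl, rfl⟩, rfl, by simp, ?_, ?_⟩
    · simp at hz; simp [hz]
    · simp only []; omega
    · simp only []; omega
  · obtain ⟨y₃, k₃, k₄, f₃, f₄, t₃, t₄, rfl, rfl⟩ := t₂.cons_inv (by omega)
    have hr₂ := (t₃.root rfl).2
    have hy₃ := hfp y₃ (by simp [t₄.mem_fp])
    obtain ⟨⟨l, u, hl⟩, -⟩ := t₄.root rfl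
    obtain ⟨⟨l', u', hl'⟩, -⟩ := t₃.root rfl
    have hk : m (16 * y₃ + 3) = s.reg 53 := by
      rw [hl, ← List.append_assoc, ← List.append_assoc] at h53
      have := (List.append_inj' h53 rfl).2
      simp at this
      exact this.1
    have hk' : m (16 * y₂ + 3) ≠ s.reg 53 := by
      rw [← hk]
      have := (List.pairwise_append.1 (List.pairwise_append.1 hinc).2.1).2.2
        (m (16 * y₂ + 3), u') (by simp [hl']) (m (16 * y₃ + 3), u) (by simp [hl])
      exact this.ne
    simp only [skipDescend, wp_seq, wp_instr, wp_ite, Instr.effect, State.touch,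
      State.setReg, State.tick, Expr.eval, BinOp.eval, fieldAddr, Instr.cost, Expr.cost]
    simp [h54, hm, hr₁, hr₂, addr_mod hy.1, addr_mod hy₂.1, addr_mod hy₃.1, hk, hk']
    refine hQ _ ⟨⟨fun z hz => ?_, rfl, rfl, rfl⟩, rfl, by simp, ?_, ?_⟩
    · simp at hz; simp [hz]
    · simp only []; omega
    · simp only []; omega

-- With four children, neither the second nor the third has the largest key of the parent. The new
-- cell becomes the parent of the last two; the chain of children itself is not cut. Fields 9 are
-- not touched, so the trees below remain valid.
set_option maxHeartbeats 1000000 in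
theorem skipDescend_split {B h x y r : ℕ} {ks : List (ℕ × ℕ)} {fp : List ℕ} {s : State}
    (t : Tree s.mem h 4 y r ks fp) (h50 : s.reg 50 = x) (h54 : s.reg 54 = y)
    (h53 : ∃ ks' v, ks = ks' ++ [(s.reg 53, v)]) (hinc : Increasing ks)
    (hfp : ∀ i ∈ x :: fp, 16 * i + 16 ≤ 2 ^ w ∧ 16 * i + 16 ≤ B ∧ i ≤ s.reg 52)
    (hc : 16 * (s.reg 52 + 1) + 16 ≤ 2 ^ w) (hB : 16 * (s.reg 52 + 1) + 16 ≤ B) :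
    Program.wp w T ω skipDescend (fun s' => SameBut [52, 55, 56, 57, 58, 59] s s' ∧
      s'.reg 52 = s.reg 52 + 1 ∧ s'.time ≤ s.time + 100 ∧ s'.space ≤ max s.space B ∧
      ∃ z k₁ k₂ f₁ f₂, Tree s.mem h 2 y z k₁ f₁ ∧ Tree s.mem h 2 z r k₂ f₂ ∧ ks = k₁ ++ k₂ ∧
        fp = f₁ ++ f₂ ∧ (∃ ks' v, k₁ = ks' ++ [(s'.mem (16 * x + 3), v)]) ∧
        s'.mem (16 * x + 5) = s.reg 52 + 1 ∧ s'.mem (16 * x + 7) = s.mem (16 * x + 7) ∧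
        s'.mem (16 * (s.reg 52 + 1) + 3) = s.reg 53 ∧
        s'.mem (16 * (s.reg 52 + 1) + 5) = s.mem (16 * x + 5) ∧
        s'.mem (16 * (s.reg 52 + 1) + 7) = z ∧
        ∀ i j, j < 16 → (j ≠ 3 ∧ j ≠ 5 ∧ j ≠ 7 ∨ i ≠ x ∧ i ≠ s.reg 52 + 1) →
          s'.mem (16 * i + j) = s.mem (16 * i + j)) s := by
  obtain ⟨y₂, k₁, k₂, f₁, f₂, t₁, t₂, rfl, rfl⟩ := t.cons_inv (by omega)
  obtain ⟨y₃, k₃, k₄, f₃, f₄, t₃, t₄, rfl, rfl⟩ := t₂.cons_inv (by omega)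
  obtain ⟨y₄, k₅, k₆, f₅, f₆, t₅, t₆, rfl, rfl⟩ := t₄.cons_inv (by omega)
  obtain ⟨ks', v, h53⟩ := h53
  have hr₁ := (t₁.root rfl).2
  have hr₂ := (t₃.root rfl).2
  have hx := hfp x (by simp)
  have hy := hfp y (by simp [t₁.mem_fp])
  have hy₂ := hfp y₂ (by simp [t₃.mem_fp])
  have hy₃ := hfp y₃ (by simp [t₅.mem_fp])
  obtain ⟨⟨l, u, hl⟩, -⟩ := t₃.root rfl
  obtain ⟨⟨l', u', hl'⟩, -⟩ := t₅.root rfl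
  obtain ⟨⟨l'', u'', hl''⟩, -⟩ := t₆.root rfl
  have hk : s.mem (16 * y₄ + 3) = s.reg 53 := by
    rw [hl'', ← List.append_assoc, ← List.append_assoc, ← List.append_assoc] at h53
    have := (List.append_inj' h53 rfl).2
    simp at this
    exact this.1
  have hinc₂ := (List.pairwise_append.1 hinc).2.1
  have hinc₃ := (List.pairwise_append.1 hinc₂).2.1
  have hk₂ : s.mem (16 * y₂ + 3) ≠ s.reg 53 := by
    rw [← hk]
    exact ((List.pairwise_append.1 hinc₂).2.2 (s.mem (16 * y₂ + 3), u) (by simp [hl])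
      (s.mem (16 * y₄ + 3), u'') (by simp [hl''])).ne
  have hk₃ : s.mem (16 * y₃ + 3) ≠ s.reg 53 := by
    rw [← hk]
    exact ((List.pairwise_append.1 hinc₃).2.2 (s.mem (16 * y₃ + 3), u') (by simp [hl'])
      (s.mem (16 * y₄ + 3), u'') (by simp [hl''])).ne
  generalize hm : s.mem = m at *
  refine Program.wp_intro fun Q hQ => ?_
  have hc2 : (s.reg 52 + 1) % 2 ^ w = s.reg 52 + 1 := Nat.mod_eq_of_lt (by omega)
  have hxc : x ≠ s.reg 52 + 1 := by omega
  simp only [skipDescend, wp_seq, wp_instr, wp_ite, Instr.effect, State.touch,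
    State.setReg, State.tick, Expr.eval, BinOp.eval, fieldAddr, Instr.cost, Expr.cost]
  simp [h54, hm, hr₁, hr₂, addr_mod hy.1, addr_mod hy₂.1, addr_mod hy₃.1, hk₂, hk₃]
  simp only [skipSplit, wp_seq, wp_instr, Instr.effect, State.touch,
      State.setReg, State.tick, Expr.eval, BinOp.eval, fieldAddr, Instr.cost, Expr.cost]
  simp [h50, addr_mod hx.1, addr_mod hc, hc2]
  generalize hm' : Function.update (Function.update (Function.update (Function.update
    (Function.update m _ _) _ _) _ _) _ _) _ _ = m'
  have e3 : m' (16 * x + 3) = m (16 * y₂ + 3) := by simp [← hm']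
  have e5 : m' (16 * x + 5) = s.reg 52 + 1 := by simp [← hm']
  have e7 : m' (16 * x + 7) = m (16 * x + 7) := by simp [← hm', update_field, hxc]
  have f3 : m' (16 * (s.reg 52 + 1) + 3) = s.reg 53 := by simp [← hm', update_field, hxc.symm]
  have f5 : m' (16 * (s.reg 52 + 1) + 5) = m (16 * x + 5) := by
    simp [← hm', update_field, hxc.symm]
  have f7 : m' (16 * (s.reg 52 + 1) + 7) = y₃ := by simp [← hm', update_field, hxc.symm]
  have fr : ∀ i j, j < 16 → (j ≠ 3 ∧ j ≠ 5 ∧ j ≠ 7 ∨ i ≠ x ∧ i ≠ s.reg 52 + 1) →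
      m' (16 * i + j) = m (16 * i + j) := by
    intro i j hj hij
    rw [← hm']
    repeat rw [Function.update_of_ne (by omega)]
  clear hm'
  refine hQ _ ⟨⟨fun z hz => ?_, rfl, rfl, rfl⟩, by simp, ?_, ?_, y₃, k₁ ++ k₃, k₅ ++ k₆, f₁ ++ f₃, f₅ ++ f₆,
    t₁.cons t₃, t₅.cons t₆, by simp, by simp, ⟨k₁ ++ l, u, by simp [hl, e3]⟩,
    e5, e7, f3, f5, f7, fr⟩
  · simp at hz; simp [hz]
  · simp only []; omega
  · repeat' refine max_le ?_ ?_
    all_goals first | exact le_max_left _ _ | exact le_max_of_le_right (by omega)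

end insert

end WordRAM

/-! ### Insertion into skip lists: induction on the height. -/

namespace WordRAM

section insert

variable {w : ℕ} {T : List ℕ} {ω : ℕ → ℕ}

theorem SameBut.mono {xs ys : List ℕ} {s s' : State} (h : SameBut xs s s') (hxy : xs ⊆ ys) :
    SameBut ys s s' :=
  ⟨fun x hx => h.reg x fun hx' => hx (hxy hx'), h.revealed, h.drawn, h.out⟩

theorem SkipInserted.shift {h n y r N d t t' : ℕ} {ks : List (ℕ × ℕ)} {fp : List ℕ}
    {s s₁ s' : State} (hi : SkipInserted h n y r ks fp N d t s₁ s')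
    (hb : SameBut [50, 53, 54, 55, 56, 57, 58] s s₁) (hm : s₁.mem = s.mem)
    (ht : s₁.time + t ≤ s.time + t') (hsp : s₁.space ≤ max s.space (16 * s.reg 52 + 16)) :
    SkipInserted h n y r ks fp N d t' s s' := by
  have h41 := hb.reg 41 (by simp)
  have h43 := hb.reg 43 (by simp)
  have h52 := hb.reg 52 (by simp)
  obtain ⟨h1, h2, h3, h4, h5⟩ := hi
  rw [h41, h43, h52, hm] at h2
  refine ⟨(hb.mono (by simp)).trans h1, h2, by omega, by omega, h5.trans ?_⟩
  have := h2.1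
  omega

theorem SkipInsertPre.of_agree {h n y r h' n' y' r' : ℕ} {ks ks' : List (ℕ × ℕ)} {fp fp' : List ℕ}
    {s s₁ : State} (hp : SkipInsertPre h' n' y' r' ks' fp' s)
    (hb : SameBut [50, 53, 54, 55, 56, 57, 58] s s₁) (t : Tree s₁.mem h n y r ks fp)
    (h50 : s₁.reg 50 = y) (hfp : fp.Sublist fp') (hks : ks.Sublist ks')
    (hlt : ∃ k ∈ ks, s.reg 41 < k.1) : SkipInsertPre h n y r ks fp s₁ := by
  have h41 := hb.reg 41 (by simp)
  have h51 := hb.reg 51 (by simp)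
  have h52 := hb.reg 52 (by simp)
  refine ⟨t, hp.nodup.sublist hfp, fun i hi => h52 ▸ hp.bound i (hfp.subset hi), h50, ?_,
    hp.inc.sublist hks, h41 ▸ hlt, fun k hk => h41 ▸ hp.ne k (hks.subset hk)⟩
  rw [h51]
  exact hp.go

theorem skipInsertStep_right {x : ℕ} {s : State} (h50 : s.reg 50 = x)
    (hx : 16 * x + 16 ≤ 2 ^ w) (hlt : s.mem (16 * x + 3) < s.reg 41) :
    Program.wp w T ω skipInsertStep (fun s' => SameBut [50, 53] s s' ∧ s'.mem = s.mem ∧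
      s'.reg 50 = s.mem (16 * x + 5) ∧ s'.time ≤ s.time + 40 ∧
      s'.space ≤ max s.space (16 * x + 16)) s := by
  refine Program.wp_intro fun Q hQ => ?_
  simp only [skipInsertStep, wp_seq, wp_instr, wp_ite, Instr.effect, State.touch,
    State.setReg, State.tick, Expr.eval, BinOp.eval, fieldAddr, Instr.cost, Expr.cost]
  simp [h50, addr_mod hx, hlt]
  refine hQ _ ⟨⟨fun z hz => ?_, rfl, rfl, rfl⟩, rfl, by simp, ?_, ?_⟩
  · simp at hz; simp [hz]
  · simp only []; omega
  · simp only []; omega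

theorem skipInsertStep_down {x : ℕ} {s : State} {Q : State → Prop} (h50 : s.reg 50 = x)
    (hx : 16 * x + 16 ≤ 2 ^ w) (hlt : ¬ s.mem (16 * x + 3) < s.reg 41)
    (h7 : s.mem (16 * x + 7) ≠ 0)
    (hQ : ∀ s₁, SameBut [53, 54] s s₁ → s₁.mem = s.mem → s₁.reg 53 = s.mem (16 * x + 3) →
      s₁.reg 54 = s.mem (16 * x + 7) → s₁.time ≤ s.time + 40 →
      s₁.space ≤ max s.space (16 * x + 16) → Program.wp w T ω skipDescend Q s₁) :
    Program.wp w T ω skipInsertStep Q s := by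
  simp only [skipInsertStep, wp_seq, wp_instr, wp_ite, Instr.effect, State.touch,
    State.setReg, State.tick, Expr.eval, BinOp.eval, fieldAddr, Instr.cost, Expr.cost]
  simp only [not_lt] at hlt
  simp [h50, addr_mod hx, hlt.not_gt, h7]
  refine hQ _ ⟨fun z hz => ?_, rfl, rfl, rfl⟩ rfl (by simp) (by simp) ?_ ?_
  · simp at hz; simp [hz]
  · simp only []; omega
  · simp only []; omega

theorem Increasing.le_last {ks ks' : List (ℕ × ℕ)} {k : ℕ × ℕ} (h : Increasing ks)
    (hk : ks = ks' ++ [k]) : ∀ k' ∈ ks, k'.1 ≤ k.1 := by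
  subst hk
  intro k' hk'
  rcases List.mem_append.1 hk' with hk' | hk'
  · exact ((List.pairwise_append.1 h).2.2 k' hk' k (List.mem_singleton_self _)).le
  · simp at hk'; simp [hk']

/-- The insertion into `n` adjacent trees of height `h` takes at most `t` steps. -/
def SkipInsertSpec (w : ℕ) (T : List ℕ) (ω : ℕ → ℕ) (h n t : ℕ) : Prop :=
  ∀ (y r : ℕ) (ks : List (ℕ × ℕ)) (fp : List ℕ) (s : State), SkipInsertPre h n y r ks fp s →
    16 * (s.reg 52 + h + 1) + 16 ≤ 2 ^ w →
    Program.wp w T ω (.loop (.reg 51) skipInsertStep)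
      (SkipInserted h n y r ks fp (n + 1) (h + 1) t s) s

theorem wp_loop_of_ne {e : Expr} {p : Program} {Q : State → Prop} {s : State}
    (h : e.eval w s.reg ≠ 0)
    (hp : Program.wp w T ω p (Program.wp w T ω (.loop e p) Q) (s.tick (e.cost + 1))) :
    Program.wp w T ω (.loop e p) Q s :=
  wp_loop.2 ⟨fun _ => hp, fun h' => absurd h' h⟩

/-- The insertion walks to the first tree with a larger key, at a cost of at most 50 per tree, and
changes only this one. So a bound for single trees suffices at every height. -/
theorem skipInsertSpec_chain {h t : ℕ} (h1 : SkipInsertSpec w T ω h 1 t) (n : ℕ) :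
    SkipInsertSpec w T ω h (n + 1) (t + 50 * n) := by
  induction n with
  | zero => exact h1
  | succ n ih =>
    intro y r ks fp s hs hw
    obtain ⟨z, k₁, k₂, f₁, f₂, t₁, t₂, rfl, rfl⟩ := hs.tree.cons_inv (by omega)
    simp only [Nat.add_sub_cancel] at t₂
    obtain ⟨⟨ks', v, hks⟩, hr⟩ := t₁.root rfl
    have hinc := List.pairwise_append.1 hs.inc
    have hmem : (s.mem (16 * y + 3), v) ∈ k₁ := by simp [hks]
    have hle := Increasing.le_last hinc.1 hks
    have hne := hs.ne _ (List.mem_append_left _ hmem)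
    have hbl : ∀ i ∈ f₁, i ≤ s.reg 52 := fun i hi => hs.bound i (by simp [hi])
    have hbr : ∀ i ∈ f₂, i ≤ s.reg 52 := fun i hi => hs.bound i (by simp [hi])
    have hy := hbl y t₁.mem_fp
    by_cases hc : s.reg 41 < s.mem (16 * y + 3)
    · have hp : SkipInsertPre h 1 y z k₁ f₁ s := hs.of_agree
        ⟨fun _ _ => rfl, rfl, rfl, rfl⟩ t₁ hs.cell (by simp) (by simp) ⟨_, hmem, hc⟩
      refine Program.wp_mono (h1 _ _ _ _ s hp hw) fun s' h' => ?_
      refine ⟨h'.same, ?_, h'.count, by have := h'.time; omega, h'.space⟩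
      exact (h'.ins.cons_left t₂ hs.nodup hbr hs.inc).mono (by omega)
    · refine wp_loop_of_ne hs.go ?_
      have hlt : s.mem (16 * y + 3) < s.reg 41 := by simp only [] at hne; omega
      refine Program.wp_mono (skipInsertStep_right hs.cell (by omega) hlt) ?_
      rintro s₁ ⟨hb, hm, h50, ht, hsp⟩
      have hb : SameBut [50, 53] s s₁ := ⟨hb.reg, hb.revealed, hb.drawn, hb.out⟩
      have hm : s₁.mem = s.mem := hm
      have h52 := hb.reg 52 (by simp)
      have hp : SkipInsertPre h (n + 1) z r k₂ f₂ s₁ := by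
        refine hs.of_agree (hb.mono (by simp)) (by rw [hm]; exact t₂) (h50.trans hr) (by simp)
          (by simp) ?_
        obtain ⟨k, hk, hlt'⟩ := hs.lt
        rcases List.mem_append.1 hk with hk | hk
        · have := hle k hk
          simp only [] at this
          omega
        · exact ⟨k, hk, hlt'⟩
      refine Program.wp_mono (ih _ _ _ _ s₁ hp (by omega)) fun s' h' => ?_
      have h' := h'.shift (t' := t + 50 * (n + 1)) (hb.mono (by simp)) hm
        (by simp only [State.tick, Expr.cost] at ht; omega)
        (by simp only [State.tick] at hsp; omega)
      refine ⟨h'.same, ?_, h'.count, h'.time, h'.space⟩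
      refine h'.ins.cons_right t₁ hs.nodup hbl fun k hk => ?_
      have := hle k hk
      simp only [] at this
      omega

/-- Among two or three children the insertion creates at most one more, which makes at most four, so
the node stays whole. This is why full nodes are split before they are entered. -/
theorem skipInsertLoop_node {h n t x r : ℕ} {ks : List (ℕ × ℕ)} {fp : List ℕ} {s : State}
    (hn : n = 2 ∨ n = 3) (ih : SkipInsertSpec w T ω h n t) (h0 : x ≠ 0)
    (hc : Tree s.mem h n (s.mem (16 * x + 7)) r ks fp)
    (hk : ∃ ks' v, ks = ks' ++ [(s.mem (16 * x + 3), v)])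
    (hs : SkipInsertPre (h + 1) 1 x (s.mem (16 * x + 5)) ks (x :: fp) s)
    (hw : 16 * (s.reg 52 + h + 1) + 16 ≤ 2 ^ w) :
    Program.wp w T ω (.loop (.reg 51) skipInsertStep)
      (SkipInserted (h + 1) 1 x (s.mem (16 * x + 5)) ks (x :: fp) 1 (h + 1) (t + 100) s) s := by
  have hx := hs.bound x (by simp)
  refine wp_loop_of_ne hs.go ?_
  have hlt : ¬ s.mem (16 * x + 3) < s.reg 41 := by
    obtain ⟨k, hk', hlt⟩ := hs.lt
    obtain ⟨ks', v, hk⟩ := hk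
    have := hs.inc.le_last hk k hk'
    simp only [] at this
    omega
  refine skipInsertStep_down hs.cell (by omega) hlt hc.ne_zero ?_
  intro s₁ hb hm h53 h54 ht hsp
  have hb : SameBut [53, 54] s s₁ := ⟨hb.reg, hb.revealed, hb.drawn, hb.out⟩
  have hm : s₁.mem = s.mem := hm
  have h52 := hb.reg 52 (by simp)
  have hc₁ := hc
  rw [← hm] at hc₁
  refine Program.wp_mono (skipDescend_spec (B := 16 * s.reg 52 + 16) hc₁ ?_ hn ?_ hs.inc ?_) ?_
  · rw [hm]; exact h54
  · rw [h53]; exact hk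
  · intro i hi
    have := hs.bound i (by simp [hi])
    omega
  · rintro s₂ ⟨hb₂, hm₂, h50, ht₂, hsp₂⟩
    have hbb : SameBut [50, 53, 54, 55, 56, 57, 58] s s₂ :=
      (hb.mono (by simp)).trans (hb₂.mono (by simp))
    have hp : SkipInsertPre h n (s.mem (16 * x + 7)) r ks fp s₂ := by
      refine hs.of_agree hbb (by rw [hm₂, hm]; exact hc) ?_ (by simp) (by simp) hs.lt
      rw [h50, hm]
    have h52' := hbb.reg 52 (by simp)
    refine Program.wp_mono (ih _ _ _ _ s₂ hp (by omega)) fun s' h' => ?_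
    have h' := h'.shift (t' := t + 100) hbb (hm₂.trans hm)
      (by simp only [State.tick, Expr.cost] at ht; omega)
      (by simp only [State.tick] at hsp; omega)
    exact ⟨h'.same, (h'.ins.mono (by omega)).node h0 (by omega) hk hs.nodup hx, h'.count, h'.time,
      h'.space⟩

-- After the split there are two adjacent nodes with two children each, and the insertion continues
-- at the first of them. Whichever of the two receives the key does not have to be split again.
set_option maxHeartbeats 1000000 in
theorem skipInsertLoop_split {h t x r : ℕ} {ks : List (ℕ × ℕ)} {fp : List ℕ} {s : State}
    (ih : SkipInsertSpec w T ω h 2 t) (h0 : x ≠ 0)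
    (hc : Tree s.mem h 4 (s.mem (16 * x + 7)) r ks fp)
    (hk : ∃ ks' v, ks = ks' ++ [(s.mem (16 * x + 3), v)])
    (hs : SkipInsertPre (h + 1) 1 x (s.mem (16 * x + 5)) ks (x :: fp) s)
    (hw : 16 * (s.reg 52 + h + 2) + 16 ≤ 2 ^ w) :
    Program.wp w T ω (.loop (.reg 51) skipInsertStep)
      (SkipInserted (h + 1) 1 x (s.mem (16 * x + 5)) ks (x :: fp) 2 (h + 2) (t + 400) s) s := by
  have hx := hs.bound x (by simp)
  have hnd := List.nodup_cons.1 hs.nodup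
  refine wp_loop_of_ne hs.go ?_
  have hlt : ¬ s.mem (16 * x + 3) < s.reg 41 := by
    obtain ⟨k, hk', hlt⟩ := hs.lt
    obtain ⟨ks', v, hk⟩ := hk
    have := hs.inc.le_last hk k hk'
    simp only [] at this
    omega
  refine skipInsertStep_down hs.cell (by omega) hlt hc.ne_zero ?_
  intro s₁ hb hm h53 h54 ht hsp
  have hb : SameBut [53, 54] s s₁ := ⟨hb.reg, hb.revealed, hb.drawn, hb.out⟩
  have hm : s₁.mem = s.mem := hm
  have h52 := hb.reg 52 (by simp)
  have hc₁ := hc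
  rw [← hm] at hc₁
  refine Program.wp_mono (skipDescend_split (x := x) (B := 16 * (s.reg 52 + 1) + 16) hc₁
    (by rw [hb.reg 50 (by simp), hs.cell]) (by rw [hm]; exact h54) (by rw [h53]; exact hk) hs.inc
    ?_ (by omega) (by omega)) ?_
  · intro i hi
    have := hs.bound i hi
    omega
  rintro s₂ ⟨hb₂, h52', ht₂, hsp₂, z, k₁, k₂, f₁, f₂, t₁, t₂, rfl, rfl, hk₁, e5, e7, g3, g5, g7, fr⟩
  have ht' : s₂.time ≤ s.time + 142 := by simp only [State.tick, Expr.cost] at ht; omega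
  have hsp' : s₂.space ≤ max s.space (16 * (s.reg 52 + 1) + 16) := by
    simp only [State.tick] at hsp; omega
  simp only [State.tick] at h53
  clear ht hsp ht₂ hsp₂ hc₁
  rw [h52] at h52' g3 g5 g7 fr e5
  rw [hm] at t₁ t₂ e7 g5 fr
  have ebound : ∀ i ∈ f₁ ++ f₂, i ≠ x ∧ i ≠ s.reg 52 + 1 := fun i hi =>
    ⟨fun h => hnd.1 (h ▸ hi), by have := hs.bound i (by simp [List.mem_append.1 hi]); omega⟩
  have t₁' : Tree s₂.mem h 2 (s₂.mem (16 * x + 7)) z k₁ f₁ := by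
    rw [e7]
    exact t₁.congr fun i hi j hj => fr i j (by omega) (.inr (ebound i (by simp [hi])))
  have t₂' : Tree s₂.mem h 2 (s₂.mem (16 * (s.reg 52 + 1) + 7)) r k₂ f₂ := by
    rw [g7]
    exact t₂.congr fun i hi j hj => fr i j (by omega) (.inr (ebound i (by simp [hi])))
  have hk₂ : ∃ ks' v, k₂ = ks' ++ [(s₂.mem (16 * (s.reg 52 + 1) + 3), v)] := by
    rw [g3, h53]
    obtain ⟨ks', v, hk⟩ := hk
    have hl := List.dropLast_append_getLast t₂.ks_ne_nil
    rw [← hl, ← List.append_assoc] at hk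
    have := (List.append_inj' hk rfl).2
    exact ⟨k₂.dropLast, v, by rw [← hl, ← this]; simp⟩
  have u₁ := Tree.node h0 t₁' le_rfl (by norm_num) hk₁
  have u₂ := Tree.node (by omega) t₂' le_rfl (by norm_num) hk₂
  rw [e5] at u₁
  rw [g5] at u₂
  have h41 : s₂.reg 41 = s.reg 41 := (hb₂.reg 41 (by simp)).trans (hb.reg 41 (by simp))
  have h43 : s₂.reg 43 = s.reg 43 := (hb₂.reg 43 (by simp)).trans (hb.reg 43 (by simp))
  have h50 : s₂.reg 50 = x :=
    (hb₂.reg 50 (by simp)).trans ((hb.reg 50 (by simp)).trans hs.cell)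
  have h51 : s₂.reg 51 ≠ 0 := by
    rw [hb₂.reg 51 (by simp), hb.reg 51 (by simp)]
    exact hs.go
  have hbb : SameBut [50, 51, 52, 53, 54, 55, 56, 57, 58, 59, 60] s s₂ :=
    (hb.mono (by simp)).trans (hb₂.mono (by simp))
  have hnd₂ : ((x :: f₁) ++ (s.reg 52 + 1) :: f₂).Nodup := by
    have : ((s.reg 52 + 1) :: x :: (f₁ ++ f₂)).Nodup := by
      refine List.nodup_cons.2 ⟨fun h => ?_, hs.nodup⟩
      have := hs.bound _ h
      omega
    refine this.perm ?_
    exact (List.perm_middle (l₁ := x :: f₁)).symm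
  have hbd : ∀ i ∈ (x :: f₁) ++ (s.reg 52 + 1) :: f₂, i ≤ s₂.reg 52 := by
    intro i hi
    rw [h52']
    have : i = s.reg 52 + 1 ∨ i ∈ x :: (f₁ ++ f₂) := by
      simp at hi ⊢; tauto
    rcases this with h | h
    · omega
    · have := hs.bound i h; omega
  have hinc := List.pairwise_append.1 hs.inc
  -- The insertion into the two halves, seen from before the split, is one into the single original
  -- node: the cell of the second half is new, and its cost is added.
  have key : ∀ s', SkipInserted (h + 1) 2 x (s.mem (16 * x + 5)) (k₁ ++ k₂)
      ((x :: f₁) ++ (s.reg 52 + 1) :: f₂) 2 (h + 1) (t + 250) s₂ s' →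
      SkipInserted (h + 1) 1 x (s.mem (16 * x + 5)) (k₁ ++ k₂) (x :: (f₁ ++ f₂)) 2 (h + 2)
        (t + 400) s s' := by
    rintro s' ⟨a1, a2, a3, a4, a5⟩
    rw [h41, h43, h52'] at a2
    refine ⟨hbb.trans a1, a2.of_split (by norm_num) ?_ ?_ ?_, by omega, ?_, ?_⟩
    · intro i; simp; tauto
    · simp; omega
    · intro i j hj hij
      refine fr i j hj (hij.imp (fun h => ⟨h.1, h.2.1, h.2.2.1⟩) fun h => ⟨?_, by omega⟩)
      rintro rfl
      exact h.1 (by simp)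
    · exact a4.trans (by clear * - ht'; omega)
    · refine a5.trans ?_
      have := a2.1
      clear * - this hsp'
      omega
  have hnd' := List.nodup_append.1 hnd₂
  obtain ⟨l, v, hl⟩ := hk₁
  have hmem : (s₂.mem (16 * x + 3), v) ∈ k₁ := by simp [hl]
  have hle := Increasing.le_last hinc.1 hl
  have hne := hs.ne _ (List.mem_append_left _ hmem)
  by_cases hcx : s.reg 41 < s₂.mem (16 * x + 3)
  · have hp : SkipInsertPre (h + 1) 1 x (s₂.mem (16 * x + 5)) k₁ (x :: f₁) s₂ :=
      ⟨by rw [e5]; exact u₁, hnd'.1, fun i hi => hbd i (by simp at hi ⊢; tauto), h50, h51, hinc.1,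
        ⟨_, hmem, by rw [h41]; exact hcx⟩, fun k hk => h41 ▸ hs.ne k (by simp [hk])⟩
    refine Program.wp_mono (skipInsertLoop_node (.inl rfl) ih h0 t₁' ⟨l, v, hl⟩ hp (by omega))
      fun s' h' => key s' ?_
    have hi := h'.ins
    rw [e5] at hi
    refine ⟨h'.same, hi.cons_left u₂ hnd₂ (fun i hi => hbd i ?_) hs.inc, h'.count,
      by have := h'.time; omega, h'.space⟩
    exact List.mem_append_right _ hi
  · have hlt : s₂.mem (16 * x + 3) < s.reg 41 := by simp only [] at hne; omega
    refine wp_loop_of_ne h51 ?_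
    refine Program.wp_mono (skipInsertStep_right h50 (by omega) (by rw [← h41] at hlt; exact hlt)) ?_
    rintro s₃ ⟨hb₃, hm₃, h50₃, ht₃, hsp₃⟩
    have hb₃ : SameBut [50, 53] s₂ s₃ := ⟨hb₃.reg, hb₃.revealed, hb₃.drawn, hb₃.out⟩
    have hm₃ : s₃.mem = s₂.mem := hm₃
    have h52₃ := hb₃.reg 52 (by simp)
    have h41₃ := hb₃.reg 41 (by simp)
    have h51₃ := hb₃.reg 51 (by simp)
    have hp : SkipInsertPre (h + 1) 1 (s.reg 52 + 1) (s₃.mem (16 * (s.reg 52 + 1) + 5)) k₂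
        ((s.reg 52 + 1) :: f₂) s₃ := by
      refine ⟨by rw [hm₃, g5]; exact u₂, hnd'.2.1,
        fun i hi => h52₃ ▸ hbd i (List.mem_append_right _ hi), h50₃.trans e5, h51₃ ▸ h51, hinc.2.1,
        ?_, fun k hk => by rw [h41₃, h41]; exact hs.ne k (by simp [hk])⟩
      obtain ⟨k, hk, hlt'⟩ := hs.lt
      rw [h41₃, h41]
      rcases List.mem_append.1 hk with hk | hk
      · have := hle k hk
        simp only [] at this
        omega
      · exact ⟨k, hk, hlt'⟩
    refine Program.wp_mono (skipInsertLoop_node (.inl rfl) ih (by omega) (by rw [hm₃]; exact t₂')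
      (by rw [hm₃]; exact hk₂) hp (by omega)) fun s' h' => key s' ?_
    have h' := h'.shift (t' := t + 250) (hb₃.mono (by simp)) hm₃
      (by simp only [State.tick, Expr.cost] at ht₃; omega)
      (by simp only [State.tick] at hsp₃; omega)
    have hi := h'.ins
    rw [hm₃, g5] at hi
    refine ⟨h'.same, hi.cons_right u₁ hnd₂ (fun i hi => hbd i (List.mem_append_left _ hi))
      fun k hk => ?_, h'.count, h'.time, h'.space⟩
    have := hle k hk
    simp only [] at this
    omega

/-- A level costs at most a split, a walk along at most four cells and a step down, for which 1000
is ample. -/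
theorem skipInsertSpec (h : ℕ) : ∀ n, SkipInsertSpec w T ω h (n + 1) (1000 * h + 100 + 50 * n) := by
  induction h with
  | zero =>
    refine skipInsertSpec_chain fun y r ks fp s hs hw => ?_
    exact skipInsertLoop_leaf hs (by omega)
  | succ h ih =>
    refine skipInsertSpec_chain fun y r ks fp s hs hw => ?_
    have ht := hs.tree
    generalize hm : s.mem = m at ht
    cases ht with
    | cons t₁ t₂ => exact absurd t₂.pos (by omega)
    | @node h n x r ks fp h0 hc h2 h4 hk =>
      subst hm
      by_cases hn : n = 4
      · subst hn
        have h₂ : SkipInsertSpec w T ω h 2 (1000 * h + 150) := by simpa using ih 1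
        refine Program.wp_mono (skipInsertLoop_split h₂ h0 hc hk hs (by omega)) fun s' h' => ?_
        exact ⟨h'.same, h'.ins, h'.count.trans (by omega), h'.time.trans (by clear * -; omega),
          h'.space⟩
      · obtain ⟨n, rfl⟩ : ∃ n', n = n' + 1 := ⟨n - 1, by omega⟩
        refine Program.wp_mono (skipInsertLoop_node (by omega) (ih n) h0 hc hk hs (by omega))
          fun s' h' => ?_
        exact ⟨h'.same, h'.ins.mono (by omega), h'.count.trans (by omega),
          h'.time.trans (by clear * - h4 hn; omega), h'.space⟩

end insert

end WordRAM

/-! ### The forest of skip lists: creating a tree, growing a root, and replacing one tree. -/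

namespace WordRAM

/-- All skip lists in the memory: the tree of `u` has the keys and values `kv u` and the cells
`fp u`. Every tree ends with the sentinel `2 ^ w - 1`. -/
structure SkipShape (w L : ℕ) (kv : ℕ → List (ℕ × ℕ)) (fp : ℕ → List ℕ) (s : State) : Prop where
  tree : ∀ u, (kv u = [] ∧ fp u = [] ∧ s.mem (16 * u + 1) = 0) ∨
    (∃ h, Tree s.mem h 1 (s.mem (16 * u + 1)) 0 (kv u) (fp u)) ∧
      ∃ l v, kv u = l ++ [(2 ^ w - 1, v)]
  inc : ∀ u, Increasing (kv u)
  nodup : ∀ u, (fp u).Nodup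
  disj : ∀ u u', ∀ i ∈ fp u, i ∈ fp u' → u = u'
  bound : ∀ u, ∀ i ∈ fp u, i ≤ s.reg 52
  cells : s.reg 52 = ∑ u ∈ Finset.range (L + 2), (fp u).length

theorem sum_update_add {S : Finset ℕ} {u : ℕ} (hu : u ∈ S) (f : ℕ → ℕ) (v : ℕ) :
    ∑ i ∈ S, Function.update f u v i + f u = ∑ i ∈ S, f i + v := by
  rw [Finset.sum_update_of_mem hu, Finset.sum_eq_sum_sdiff_singleton_add hu f]
  omega

section dictionary

variable {w L : ℕ} {T : List ℕ} {ω : ℕ → ℕ} {kv : ℕ → List (ℕ × ℕ)} {fp : ℕ → List ℕ}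

/-- An operation on the tree of `u` changes only its own cells, new cells and its root field 1,
which no tree reads. Footprints are disjoint, so all other trees persist. -/
theorem SkipShape.update {s s' : State} (hs : SkipShape w L kv fp s) {u h : ℕ} (hu : u < L + 2)
    {ks : List (ℕ × ℕ)} {f : List ℕ} (hc : s.reg 52 ≤ s'.reg 52)
    (hh : ∀ u', u' ≠ u → s'.mem (16 * u' + 1) = s.mem (16 * u' + 1))
    (hm : ∀ i j, j < 16 → j ≠ 1 → i ∉ fp u → i ≤ s.reg 52 →
      s'.mem (16 * i + j) = s.mem (16 * i + j))
    (ht : Tree s'.mem h 1 (s'.mem (16 * u + 1)) 0 ks f) (hl : ∃ l v, ks = l ++ [(2 ^ w - 1, v)])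
    (hinc : Increasing ks) (hf : f.Nodup)
    (hfp : ∀ i ∈ f, i ∈ fp u ∨ s.reg 52 < i ∧ i ≤ s'.reg 52)
    (hlen : f.length + s.reg 52 = (fp u).length + s'.reg 52) :
    SkipShape w L (Function.update kv u ks) (Function.update fp u f) s' := by
  -- New cells have numbers above the counter and so belong to no other tree.
  have key : ∀ u', u' ≠ u → ∀ i ∈ fp u', i ∉ f := by
    intro u' hu' i hi hi'
    rcases hfp i hi' with h | h
    · exact hu' (hs.disj u' u i hi h)
    · have := hs.bound u' i hi
      omega
  refine ⟨fun u' => ?_, fun u' => ?_, fun u' => ?_, fun u₁ u₂ i h₁ h₂ => ?_, fun u' i hi => ?_, ?_⟩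
  · by_cases h' : u' = u
    · subst h'
      simp only [Function.update_self]
      exact .inr ⟨⟨h, ht⟩, hl⟩
    · simp only [Function.update_of_ne h', hh u' h']
      refine (hs.tree u').imp_right fun ⟨⟨h, t⟩, hl⟩ => ⟨⟨h, t.congr fun i hi j hj => ?_⟩, hl⟩
      exact hm i j (by omega) (by omega) (fun hi' => h' (hs.disj u' u i hi hi'))
        (hs.bound u' i hi)
  · by_cases h' : u' = u
    · subst h'; simpa using hinc
    · simpa [Function.update_of_ne h'] using hs.inc u'
  · by_cases h' : u' = u
    · subst h'; simpa using hf
    · simpa [Function.update_of_ne h'] using hs.nodup u'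
  · by_cases e₁ : u₁ = u <;> by_cases e₂ : u₂ = u
    · rw [e₁, e₂]
    · subst e₁
      rw [Function.update_self] at h₁
      rw [Function.update_of_ne e₂] at h₂
      exact absurd h₁ (key _ e₂ i h₂)
    · subst e₂
      rw [Function.update_self] at h₂
      rw [Function.update_of_ne e₁] at h₁
      exact absurd h₂ (key _ e₁ i h₁)
    · rw [Function.update_of_ne e₁] at h₁
      rw [Function.update_of_ne e₂] at h₂
      exact hs.disj _ _ i h₁ h₂
  · by_cases h' : u' = u
    · subst h'
      rw [Function.update_self] at hi
      rcases hfp i hi with h | h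
      · exact (hs.bound _ i h).trans hc
      · exact h.2
    · rw [Function.update_of_ne h'] at hi
      exact (hs.bound _ i hi).trans hc
  · have h1 := sum_update_add (Finset.mem_range.2 hu) (fun i => (fp i).length) f.length
    have h2 : ∀ i, (Function.update fp u f i).length =
        Function.update (fun i => (fp i).length) u f.length i := by
      intro i
      by_cases h' : i = u
      · subst h'; simp
      · simp [Function.update_of_ne h']
    simp only [h2]
    have := hs.cells
    omega

/-- The sentinel. -/
def maxWord : Expr := .bin .sub (.const 0) (.const 1)

theorem eval_maxWord {ρ : ℕ → ℕ} (hw : 2 ≤ 2 ^ w) : maxWord.eval w ρ = 2 ^ w - 1 := by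
  simp only [maxWord, Expr.eval, BinOp.eval, Nat.zero_mod, zero_add]
  rw [Nat.mod_eq_of_lt (a := 1) (by omega), Nat.mod_eq_of_lt (by omega)]

/-- Creation of an empty tree for the number in register 40, if there is none. -/
def skipCreate : Program :=
  .seq (.instr (.load 50 (fieldAddr 1 (.reg 40)))) <|
  .ite (.reg 50) .skip
    (.seq (.instr (.assign 52 (.bin .add (.reg 52) (.const 1)))) <|
      .seq (.instr (.store (fieldAddr 3 (.reg 52)) maxWord)) <|
      .seq (.instr (.store (fieldAddr 5 (.reg 52)) (.const 0))) <|
      .seq (.instr (.store (fieldAddr 7 (.reg 52)) (.const 0))) <|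
      .seq (.instr (.store (fieldAddr 1 (.reg 40)) (.reg 52))) (.instr (.assign 50 (.reg 52))))

/-- A root with a neighbour gets a parent. -/
def skipGrow : Program :=
  .seq (.instr (.load 54 (fieldAddr 1 (.reg 40)))) <|
  .seq (.instr (.load 55 (fieldAddr 5 (.reg 54)))) <|
  .ite (.reg 55)
    (.seq (.instr (.assign 52 (.bin .add (.reg 52) (.const 1)))) <|
      .seq (.instr (.store (fieldAddr 3 (.reg 52)) maxWord)) <|
      .seq (.instr (.store (fieldAddr 5 (.reg 52)) (.const 0))) <|
      .seq (.instr (.store (fieldAddr 7 (.reg 52)) (.reg 54)))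
      (.instr (.store (fieldAddr 1 (.reg 40)) (.reg 52)))) .skip

/-- The insertion of the key in register 41 with the value in register 43 into the tree of
register 40. -/
def skipInsert : Program :=
  .seq skipCreate <| .seq (.instr (.assign 51 (.const 1))) <|
  .seq (.loop (.reg 51) skipInsertStep) skipGrow

/-- A new tree consists of the sentinel alone. The value field of its leaf is not written, because
the value of the sentinel is never of interest. -/
theorem skipCreate_spec {s : State} {u : ℕ} (hs : SkipShape w L kv fp s) (h40 : s.reg 40 = u)
    (hu : u < L + 2) (hw : 16 * (s.reg 52 + 1) + 16 ≤ 2 ^ w) (hw' : 16 * u + 16 ≤ 2 ^ w) :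
    Program.wp w T ω skipCreate (fun s' => SameBut [50, 52] s s' ∧ s'.time ≤ s.time + 100 ∧
      s'.space ≤ max s.space (max (16 * u + 16) (16 * s'.reg 52 + 16)) ∧
      (∀ i, s'.mem (2 * i) = s.mem (2 * i)) ∧ s'.reg 50 = s'.mem (16 * u + 1) ∧
      s'.reg 52 ≤ s.reg 52 + 1 ∧
      ∃ ks f, ks ≠ [] ∧ (ks = kv u ∨ kv u = [] ∧ ∃ v, ks = [(2 ^ w - 1, v)]) ∧
        SkipShape w L (Function.update kv u ks) (Function.update fp u f) s') s := by
  have hne : (2 : ℕ) ≤ 2 ^ w := by omega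
  rcases hs.tree u with ⟨hk, hf, h1⟩ | ⟨⟨h, t⟩, hl⟩
  · refine Program.wp_intro fun Q hQ => ?_
    have hc2 : (s.reg 52 + 1) % 2 ^ w = s.reg 52 + 1 := Nat.mod_eq_of_lt (by omega)
    simp only [skipCreate, wp_seq, wp_instr, wp_ite, wp_skip, Instr.effect, State.touch,
      State.setReg, State.tick, eval_maxWord hne]
    simp only [Expr.eval, BinOp.eval, fieldAddr, Instr.cost, Expr.cost, maxWord]
    simp [h40, h1, addr_mod hw, addr_mod hw', hc2]
    generalize hm' : Function.update (Function.update (Function.update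
      (Function.update s.mem _ _) _ _) _ _) _ _ = m'
    have e1 : m' (16 * u + 1) = s.reg 52 + 1 := by simp [← hm']
    have e3 : m' (16 * (s.reg 52 + 1) + 3) = 2 ^ w - 1 := by simp [← hm', update_field]
    have e5 : m' (16 * (s.reg 52 + 1) + 5) = 0 := by simp [← hm', update_field]
    have e7 : m' (16 * (s.reg 52 + 1) + 7) = 0 := by simp [← hm', update_field]
    have fr : ∀ i j, j < 16 → (j ≠ 1 ∨ i ≠ u) → (j = 1 ∨ i ≠ s.reg 52 + 1 ∨ j % 2 = 0) →
        m' (16 * i + j) = s.mem (16 * i + j) := by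
      intro i j hj hij hij'
      rw [← hm']
      repeat rw [Function.update_of_ne (by omega)]
    clear hm'
    have t := Tree.leaf (m := m') (Nat.succ_ne_zero (s.reg 52)) e7
    simp only [Nat.succ_eq_add_one, e3, e5] at t
    refine hQ _ ⟨⟨fun z hz => ?_, rfl, rfl, rfl⟩, ?_, ?_, fun i => ?_, by simp [e1], by simp,
      [(2 ^ w - 1, m' (16 * (s.reg 52 + 1) + 9))], [s.reg 52 + 1], by simp, .inr ⟨hk, _, rfl⟩, ?_⟩
    · simp at hz; simp [hz]
    · simp only []; omega
    · simp; omega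
    · have := fr (i / 8) (2 * (i % 8)) (by omega) (by omega) (by omega)
      rwa [show 16 * (i / 8) + 2 * (i % 8) = 2 * i by omega] at this
    · refine hs.update hu (by simp) (fun u' hu' => fr u' 1 (by norm_num) (.inr hu') (.inl rfl))
        (fun i j hj hj' _ hi => fr i j hj (.inl hj') (.inr (.inl (by omega)))) (h := 0) (by simpa only [e1] using t)
        ⟨[], _, rfl⟩ (List.pairwise_singleton _ _) (List.nodup_singleton _) ?_ ?_
      · simp
      · simp [hf]; omega
  · refine Program.wp_intro fun Q hQ => ?_
    simp only [skipCreate, wp_seq, wp_instr, wp_ite, wp_skip, Instr.effect, State.touch,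
      State.setReg, State.tick, Expr.eval, BinOp.eval, fieldAddr, Instr.cost, Expr.cost]
    simp [h40, addr_mod hw', t.ne_zero]
    refine hQ _ ⟨⟨fun z hz => ?_, rfl, rfl, rfl⟩, ?_, ?_, fun i => rfl, by simp, by simp,
      kv u, fp u, t.ks_ne_nil, .inl rfl, ?_⟩
    · simp at hz; simp [hz]
    · simp only []; omega
    · simp; omega
    · rw [Function.update_eq_self, Function.update_eq_self]
      exact ⟨hs.tree, hs.inc, hs.nodup, hs.disj, hs.bound, hs.cells⟩

/-- An insertion at the root leaves at most two trees. The last one has the right neighbour 0, so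
the first root has a neighbour exactly if there are two, and then a new root with two children is
put above them. Its largest key is the sentinel. -/
theorem skipGrow_spec {s : State} {u y h n : ℕ} {ks : List (ℕ × ℕ)} {f : List ℕ}
    (h40 : s.reg 40 = u) (h1 : s.mem (16 * u + 1) = y) (t : Tree s.mem h n y 0 ks f) (hn : n ≤ 2)
    (hl : ∃ l v, ks = l ++ [(2 ^ w - 1, v)]) (hnd : f.Nodup) (hf : ∀ i ∈ f, i ≤ s.reg 52)
    (hw : 16 * (s.reg 52 + 1) + 16 ≤ 2 ^ w) (hw' : 16 * u + 16 ≤ 2 ^ w) :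
    Program.wp w T ω skipGrow (fun s' => SameBut [52, 54, 55] s s' ∧ s'.time ≤ s.time + 100 ∧
      s'.space ≤ max s.space (max (16 * u + 16) (16 * s'.reg 52 + 16)) ∧
      s.reg 52 ≤ s'.reg 52 ∧
      (∀ i, s'.mem (2 * i) = s.mem (2 * i)) ∧
      (∀ u', u' ≠ u → s'.mem (16 * u' + 1) = s.mem (16 * u' + 1)) ∧
      (∀ i j, j < 16 → j ≠ 1 → i ≤ s.reg 52 → s'.mem (16 * i + j) = s.mem (16 * i + j)) ∧
      ∃ h' f', Tree s'.mem h' 1 (s'.mem (16 * u + 1)) 0 ks f' ∧ f'.Nodup ∧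
        (∀ i ∈ f', i ∈ f ∨ s.reg 52 < i ∧ i ≤ s'.reg 52) ∧
        f'.length + s.reg 52 = f.length + s'.reg 52) s := by
  have hne : (2 : ℕ) ≤ 2 ^ w := by omega
  have hy := hf y t.mem_fp
  have hy' : 16 * y + 16 ≤ 2 ^ w := by omega
  refine Program.wp_intro fun Q hQ => ?_
  have hc2 : (s.reg 52 + 1) % 2 ^ w = s.reg 52 + 1 := Nat.mod_eq_of_lt (by omega)
  obtain rfl | rfl : n = 1 ∨ n = 2 := by have := t.pos; omega
  · have h5 := (t.root rfl).2
    simp only [skipGrow, wp_seq, wp_instr, wp_ite, wp_skip, Instr.effect, State.touch,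
      State.setReg, State.tick, eval_maxWord hne]
    simp only [Expr.eval, BinOp.eval, fieldAddr, Instr.cost, Expr.cost, maxWord]
    simp [h40, h1, addr_mod hw', addr_mod hy', h5]
    refine hQ _ ⟨⟨fun z hz => ?_, rfl, rfl, rfl⟩, ?_, ?_, by simp, fun i => rfl, fun _ _ => rfl,
      fun _ _ _ _ _ => rfl, h, f, ?_, hnd, ?_, ?_⟩
    · simp at hz; simp [hz]
    · simp only []; omega
    · simp; omega
    · simp only [h1]; exact t
    · intro i hi; exact .inl hi
    · simp
  · obtain ⟨z, k₁, k₂, f₁, f₂, t₁, t₂, hk, hff⟩ := t.cons_inv le_rfl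
    have h5 := (t₁.root rfl).2
    have hz := t₂.ne_zero
    simp only [skipGrow, wp_seq, wp_instr, wp_ite, wp_skip, Instr.effect, State.touch,
      State.setReg, State.tick, eval_maxWord hne]
    simp only [Expr.eval, BinOp.eval, fieldAddr, Instr.cost, Expr.cost, maxWord]
    simp [h40, h1, addr_mod hw', addr_mod hy', addr_mod hw, h5, hz, hc2]
    generalize hm' : Function.update (Function.update (Function.update
      (Function.update s.mem _ _) _ _) _ _) _ _ = m'
    have e1 : m' (16 * u + 1) = s.reg 52 + 1 := by simp [← hm']
    have e3 : m' (16 * (s.reg 52 + 1) + 3) = 2 ^ w - 1 := by simp [← hm', update_field]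
    have e5 : m' (16 * (s.reg 52 + 1) + 5) = 0 := by simp [← hm', update_field]
    have e7 : m' (16 * (s.reg 52 + 1) + 7) = y := by simp [← hm', update_field]
    have fr : ∀ i j, j < 16 → (j ≠ 1 ∨ i ≠ u) → (j = 1 ∨ i ≠ s.reg 52 + 1 ∨ j % 2 = 0) →
        m' (16 * i + j) = s.mem (16 * i + j) := by
      intro i j hj hij hij'
      rw [← hm']
      repeat rw [Function.update_of_ne (by omega)]
    clear hm'
    have t' : Tree m' h 2 (m' (16 * (s.reg 52 + 1) + 7)) 0 ks f := by
      rw [e7]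
      refine t.congr fun i hi j hj => fr i j (by omega) (by omega) ?_
      have := hf i hi
      omega
    have t'' := Tree.node (Nat.succ_ne_zero (s.reg 52)) t' le_rfl (by norm_num)
      (by simp only [Nat.succ_eq_add_one, e3]; exact hl)
    simp only [Nat.succ_eq_add_one, e5] at t''
    refine hQ _ ⟨⟨fun z hz => ?_, rfl, rfl, rfl⟩, ?_, ?_, by simp, fun i => ?_, fun u' hu' => ?_,
      fun i j hj hj' hi => ?_, h + 1, (s.reg 52 + 1) :: f, ?_, ?_, ?_, ?_⟩
    · simp at hz; simp [hz]
    · simp only []; omega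
    · simp; omega
    · have := fr (i / 8) (2 * (i % 8)) (by omega) (by omega) (by omega)
      rwa [show 16 * (i / 8) + 2 * (i % 8) = 2 * i by omega] at this
    · exact fr u' 1 (by norm_num) (.inr hu') (.inl rfl)
    · exact fr i j hj (.inl hj') (.inr (.inl (by omega)))
    · simpa only [e1] using t''
    · refine List.nodup_cons.2 ⟨fun h' => ?_, hnd⟩
      have := hf _ h'
      omega
    · intro i hi
      rcases List.mem_cons.1 hi with rfl | hi
      · right; simp
      · exact .inl hi
    · simp; omega

end dictionary

end WordRAM

/-! ### The skip lists as a dictionary. -/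

namespace WordRAM

/-- The skip lists contain the keys `ks` with their positions. -/
def SkipInv (w L : ℕ) (ks : List (ℕ × ℕ)) (s : State) : Prop :=
  ∃ (kv : ℕ → List (ℕ × ℕ)) (fp : ℕ → List ℕ), SkipShape w L kv fp s ∧
    (∀ u c e, c ≠ 2 ^ w - 1 → ((c, e) ∈ kv u ↔ keyIndex ks (u, c) = e ∧ e ≠ 0)) ∧
    ∑ u ∈ Finset.range (L + 2), (kv u).length ≤ 2 * ks.length

section dictionary

variable {w L : ℕ} {T : List ℕ} {ω : ℕ → ℕ} {kv : ℕ → List (ℕ × ℕ)} {fp : ℕ → List ℕ}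
  {A : Finset ℕ}

theorem SkipShape.congr {s s' : State} (hs : SkipShape w L kv fp s) (h52 : s'.reg 52 = s.reg 52)
    (hm : ∀ i, s'.mem (2 * i + 1) = s.mem (2 * i + 1)) : SkipShape w L kv fp s' := by
  have hm' : ∀ i j, j % 2 = 1 → s'.mem (16 * i + j) = s.mem (16 * i + j) := by
    intro i j hj
    rw [show 16 * i + j = 2 * (8 * i + j / 2) + 1 by omega, hm]
  refine ⟨fun u => ?_, hs.inc, hs.nodup, hs.disj, ?_, ?_⟩
  · rw [hm' u 1 (by norm_num)]
    refine (hs.tree u).imp_right fun ⟨⟨h, t⟩, hl⟩ => ⟨⟨h, t.congr fun i _ j hj => ?_⟩, hl⟩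
    exact hm' i j (by omega)
  · rw [h52]; exact hs.bound
  · rw [h52]; exact hs.cells

theorem SkipShape.reg_le {s : State} (hs : SkipShape w L kv fp s) :
    s.reg 52 ≤ 2 * ∑ u ∈ Finset.range (L + 2), (kv u).length := by
  rw [hs.cells, Finset.mul_sum]
  refine Finset.sum_le_sum fun u _ => ?_
  rcases hs.tree u with ⟨-, hf, -⟩ | ⟨⟨h, t⟩, -⟩
  · simp [hf]
  · have := t.length_fp
    omega

/-- There is at most one sentinel per inserted key, and at most two cells per leaf. -/
theorem SkipInv.reg_le {s : State} {ks : List (ℕ × ℕ)} (hs : SkipInv w L ks s) :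
    s.reg 52 ≤ 4 * ks.length := by
  obtain ⟨kv, fp, hs, -, hle⟩ := hs
  have := hs.reg_le
  omega

/-- The entries of one tree have different keys, which are characters of `A` or the sentinel. This
bounds the height by the logarithm of σ + 1 and not of the number of all keys. -/
theorem length_le_of_keyIndex {u : ℕ} {ks l : List (ℕ × ℕ)} (hinc : Increasing l)
    (hA : ∀ k ∈ ks, k.2 ∈ A)
    (hm : ∀ c e, c ≠ 2 ^ w - 1 → (c, e) ∈ l → keyIndex ks (u, c) = e ∧ e ≠ 0) :
    l.length ≤ A.card + 1 := by
  have hnd : (l.map Prod.fst).Nodup := by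
    rw [List.Nodup, List.pairwise_map]
    exact hinc.imp fun h => h.ne
  have hsub : (l.map Prod.fst).toFinset ⊆ insert (2 ^ w - 1) A := by
    intro c hc
    simp only [List.mem_toFinset, List.mem_map] at hc
    obtain ⟨⟨c, e⟩, hk, rfl⟩ := hc
    rw [Finset.mem_insert]
    by_cases h : c = 2 ^ w - 1
    · exact .inl h
    · obtain ⟨h1, h2⟩ := hm c e h hk
      refine .inr (hA (u, c) ?_)
      by_contra hn
      exact h2 (h1 ▸ keyIndex_eq_zero.2 hn)
  have := Finset.card_le_card hsub
  rw [List.toFinset_card_of_nodup hnd, List.length_map] at this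
  exact this.trans (Finset.card_insert_le _ _)

theorem exists_eq_append_of_append {α : Type*} {p q l : List α} {k : α} (hq : q ≠ [])
    (h : p ++ q = l ++ [k]) : ∃ l', q = l' ++ [k] := by
  have hl := List.dropLast_append_getLast hq
  rw [← hl, ← List.append_assoc] at h
  have := (List.append_inj' h rfl).2
  exact ⟨q.dropLast, by rw [← this, hl]⟩

theorem Increasing.insert {p q : List (ℕ × ℕ)} {c e : ℕ} (h : Increasing (p ++ q))
    (hp : ∀ k ∈ p, k.1 < c) (hq : ∀ k ∈ q, c < k.1) : Increasing (p ++ (c, e) :: q) := by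
  obtain ⟨h1, h2, h3⟩ := List.pairwise_append.1 h
  refine List.pairwise_append.2 ⟨h1, List.pairwise_cons.2 ⟨hq, h2⟩, fun a ha b hb => ?_⟩
  rcases List.mem_cons.1 hb with rfl | hb
  · exact hp a ha
  · exact h3 a ha b hb

/-- If the number has no tree, its root field is 0 and the loop does not start, with the answer 0.
Otherwise the sentinel exceeds every character, so `skipFindLoop_spec` applies. -/
theorem skipFind_spec {s : State} {ks : List (ℕ × ℕ)} {u c : ℕ} (hW : 128 * (L + 2) ≤ 2 ^ w)
    (hs : SkipInv w L ks s) (hL : Legal A L ks) (hu : u ≤ ks.length + 1) (hc : c + 1 < 2 ^ w)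
    (h40 : s.reg 40 = u) (h41 : s.reg 41 = c) :
    Program.wp w T ω skipFind (fun s' => SkipInv w L ks s' ∧
      MainAgree (s.setReg 42 (keyIndex ks (u, c))) s' ∧
      s'.time ≤ s.time + (1000 * Nat.log 2 (A.card + 1) + 400) ∧
      s'.space ≤ max s.space (128 * (ks.length + 2))) s := by
  have hcnt := hs.reg_le
  obtain ⟨kv, fp, hsh, hmem, hle⟩ := hs
  have hlen := hL.length_le
  have hu' : 16 * u + 16 ≤ 2 ^ w := by omega
  refine Program.wp_intro fun Q hQ => ?_
  rcases hsh.tree u with ⟨hk, hf, h1⟩ | ⟨⟨h, t⟩, hl⟩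
  · have h0 : keyIndex ks (u, c) = 0 := by
      by_contra hne
      have := (hmem u c _ (by omega)).2 ⟨rfl, hne⟩
      rw [hk] at this
      exact absurd this (by simp)
    simp only [skipFind, wp_seq, wp_instr, Instr.effect, State.touch,
      State.setReg, State.tick, Expr.eval, BinOp.eval, fieldAddr, Instr.cost, Expr.cost]
    rw [wp_loop]
    simp [h40, addr_mod hu', h1, Expr.eval]
    refine hQ _ ⟨⟨kv, fp, hsh.congr ?_ fun i => ?_, hmem, hle⟩, ⟨fun x hx => ?_, fun i => rfl, rfl,
      rfl, rfl⟩, ?_, ?_⟩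
    · simp [State.tick]
    · simp [State.tick]
    · simp only [State.tick, State.setReg, Function.update_apply, h0]
      split_ifs <;> omega
    · simp [State.tick, Expr.cost]; omega
    · simp [State.tick]; omega
  · simp only [skipFind, wp_seq, wp_instr, Instr.effect, State.touch,
      State.setReg, State.tick, Expr.eval, BinOp.eval, fieldAddr, Instr.cost, Expr.cost]
    simp [h40, addr_mod hu']
    have hcell : ∀ i ∈ fp u, 16 * i + 16 ≤ 2 ^ w ∧ 16 * i + 16 ≤ 128 * (ks.length + 2) := by
      intro i hi
      have := hsh.bound u i hi
      omega
    have hh : h ≤ Nat.log 2 (A.card + 1) := by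
      refine Nat.le_log_of_pow_le (by norm_num) ?_
      have h1 := t.pow_le
      have h2 := length_le_of_keyIndex (hsh.inc u) (fun k hk => (hL.bound k hk).2)
        (fun c e hc => (hmem u c e hc).1)
      omega
    refine Program.wp_mono (skipFindLoop_spec (B := 128 * (ks.length + 2)) t hcell _ rfl
      (by simp) (by simpa using t.ne_zero) (hsh.inc u) ?_) fun s' h' => ?_
    · obtain ⟨l, v, hl⟩ := hl
      exact ⟨(2 ^ w - 1, v), by simp [hl], by simp [h41]; omega⟩
    · obtain ⟨h1, h2, h3, h4, h5⟩ := h'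
      have h52 := h1.reg 52 (by simp)
      simp at h52 h3 h4 h5
      rw [h41] at h3
      refine hQ _ ⟨⟨kv, fp, hsh.congr h52 fun i => by rw [h2], hmem, hle⟩, ⟨fun x hx => ?_,
        fun i => by rw [h2]; rfl, h1.revealed, h1.drawn, h1.out⟩, by omega, by omega⟩
      by_cases hx : x = 42
      · subst hx
        simp only [State.setReg, Function.update_self]
        rcases h3 with h3 | ⟨h3, h42⟩
        · exact ((hmem u c _ (by omega)).1 h3).1.symm
        · rw [h42]
          by_contra hne
          exact h3 _ ((hmem u c _ (by omega)).2 ⟨rfl, fun h => hne h.symm⟩)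
      · rw [h1.reg x (by simp; omega)]
        simp only [State.setReg, Function.update_apply]
        split_ifs <;> omega

/-- The sentinel is always the largest key, so the new key always has a successor in its tree, and
it is inserted before it. The three phases each allocate cells from the counter in register 52; the
bound on space comes from the invariant at the end. -/
theorem skipInsert_spec {s : State} {ks : List (ℕ × ℕ)} {u c : ℕ} (hW : 128 * (L + 2) ≤ 2 ^ w)
    (hs : SkipInv w L ks s) (hL : Legal A L (ks ++ [(u, c)])) (hc : c + 1 < 2 ^ w)
    (h40 : s.reg 40 = u) (h41 : s.reg 41 = c) (h43 : s.reg 43 = ks.length + 1) :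
    Program.wp w T ω skipInsert (fun s' => SkipInv w L (ks ++ [(u, c)]) s' ∧ MainAgree s s' ∧
      s'.time ≤ s.time + (1000 * Nat.log 2 (A.card + 1) + 400) ∧
      s'.space ≤ max s.space (128 * (ks.length + 3))) s := by
  have hcnt := hs.reg_le
  obtain ⟨kv, fp, hsh, hmem, hle⟩ := hs
  have hlen := hL.length_le
  have hub := (hL.bound (u, c) (by simp)).1
  simp only [List.length_append, List.length_singleton] at hlen hub
  have hu' : 16 * u + 16 ≤ 2 ^ w := by omega
  have hmemu : u ∈ Finset.range (L + 2) := by simp; omega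
  have hnew : keyIndex ks (u, c) = 0 := by
    rw [keyIndex_eq_zero]
    have := hL.nodup
    rw [List.nodup_append] at this
    exact fun h => this.2.2 _ h _ (List.mem_singleton_self _) rfl
  simp only [skipInsert, wp_seq]
  refine Program.wp_mono (skipCreate_spec hsh h40 (by omega) (by omega) hu') ?_
  rintro s₁ ⟨hb₁, ht₁, hsp₁, hev₁, h50, hc₁, l, f, hl0, hl, hsh₁⟩
  rw [wp_seq, wp_instr, wp_seq]
  obtain ⟨s₁', hs₁'⟩ : ∃ s', (Instr.effect w T ω s₁ (.assign 51 (.const 1))).tick 2 = s' := ⟨_, rfl⟩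
  have hcost : (Instr.assign 51 (.const 1)).cost = 2 := rfl
  rw [hcost, hs₁']
  have hb₁' : SameBut [51] s₁ s₁' := by
    rw [← hs₁']
    refine ⟨fun z hz => ?_, rfl, rfl, rfl⟩
    simp at hz
    simp [Instr.effect, State.setReg, State.tick, hz]
  have h51 : s₁'.reg 51 ≠ 0 := by
    rw [← hs₁']
    simp only [Instr.effect, State.setReg, State.tick, Expr.eval, Function.update_self]
    rw [Nat.mod_eq_of_lt (by omega)]
    norm_num
  have hm₁ : s₁'.mem = s₁.mem := by rw [← hs₁']; rfl
  have ht₁' : s₁'.time = s₁.time + 2 := by rw [← hs₁']; rfl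
  have hsp₁' : s₁'.space = s₁.space := by rw [← hs₁']; rfl
  clear hs₁'
  have h52₁ := hb₁'.reg 52 (by simp)
  have hlinc : Increasing l := by simpa using hsh₁.inc u
  have hlmem : ∀ c' e', c' ≠ 2 ^ w - 1 → ((c', e') ∈ l ↔ keyIndex ks (u, c') = e' ∧ e' ≠ 0) := by
    intro c' e' hc'
    rw [← hmem u c' e' hc']
    rcases hl with rfl | ⟨h0, v, rfl⟩
    · rfl
    · simp [h0, hc']
  obtain ⟨⟨h, t⟩, l', v, hlast⟩ : (∃ h, Tree s₁.mem h 1 (s₁.mem (16 * u + 1)) 0 l f) ∧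
      ∃ l' v, l = l' ++ [(2 ^ w - 1, v)] := by
    have := hsh₁.tree u
    simp only [Function.update_self] at this
    exact this.resolve_left fun h => hl0 h.1
  have hllen : l.length ≤ (kv u).length + 1 := by
    rcases hl with rfl | ⟨h0, v, rfl⟩ <;> simp
  have hkvu : (kv u).length ≤ ∑ u ∈ Finset.range (L + 2), (kv u).length :=
    Finset.single_le_sum (f := fun u => (kv u).length) (fun _ _ => Nat.zero_le _) hmemu
  have hpow := t.pow_le
  have hlt2 := Nat.lt_two_pow_self (n := h)
  have hh : h ≤ Nat.log 2 (A.card + 1) := by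
    refine Nat.le_log_of_pow_le (by norm_num) ?_
    have h2 := length_le_of_keyIndex (A := A) hlinc
      (fun k hk => (hL.bound k (by simp [hk])).2) (fun c e hc => (hlmem c e hc).1)
    omega
  have hfb : ∀ i ∈ f, i ≤ s₁.reg 52 := by simpa using hsh₁.bound u
  have hfn : f.Nodup := by simpa using hsh₁.nodup u
  have h41' : s₁'.reg 41 = c := by rw [hb₁'.reg 41 (by simp), hb₁.reg 41 (by simp), h41]
  have h43' : s₁'.reg 43 = ks.length + 1 := by
    rw [hb₁'.reg 43 (by simp), hb₁.reg 43 (by simp), h43]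
  have hcl : ∀ e, (c, e) ∉ l := fun e he => by
    have := (hlmem c e (by omega)).1 he
    omega
  have hpre : SkipInsertPre h 1 (s₁.mem (16 * u + 1)) 0 l f s₁' := by
    refine ⟨by rw [hm₁]; exact t, hfn, by rw [h52₁]; exact hfb,
      (hb₁'.reg 50 (by simp)).trans h50, h51, hlinc,
      ⟨(2 ^ w - 1, v), by simp [hlast], by rw [h41']; simp only []; omega⟩, fun k hk hck => ?_⟩
    rw [h41'] at hck
    exact hcl k.2 (by rw [hck]; exact hk)
  refine Program.wp_mono (skipInsertSpec h 0 _ _ _ _ s₁' hpre (by omega)) fun s₂ h₂ => ?_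
  obtain ⟨hb₂, hins, hc₂, ht₂, hsp₂⟩ := h₂
  obtain ⟨hcc, hfr, n', p, q, f', hn1, hn2, hpq, hq, hp1, hq1, t₂, hnd₂, hf₂, hlen₂⟩ := hins
  rw [h41', h43'] at *
  rw [hm₁] at hfr
  rw [h52₁] at *
  have hh₂ : ∀ u, s₂.mem (16 * u + 1) = s₁.mem (16 * u + 1) := fun u =>
    hfr u 1 (by norm_num) (.inl (by norm_num))
  have hbb : SameBut [50, 51, 52, 53, 54, 55, 56, 57, 58, 59, 60] s s₂ :=
    ((hb₁.mono (by simp)).trans (hb₁'.mono (by simp))).trans hb₂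
  have hlast' : ∃ l v, p ++ (c, ks.length + 1) :: q = l ++ [(2 ^ w - 1, v)] := by
    obtain ⟨q', hq'⟩ := exists_eq_append_of_append hq (hpq.symm.trans hlast)
    exact ⟨p ++ (c, ks.length + 1) :: q', v, by rw [hq']; simp⟩
  refine Program.wp_mono (skipGrow_spec (u := u) (w := w) (by rw [hbb.reg 40 (by simp), h40])
    (hh₂ u) t₂ (by omega) hlast' hnd₂ ?_ (by omega) hu') ?_
  · intro i hi
    rcases hf₂ i hi with h' | h'
    · exact (hfb i h').trans hcc
    · exact h'.2
  rintro s₃ ⟨hb₃, ht₃, hsp₃, hc₃, hev₃, hhd₃, hm₃, h', f₃, t₃, hnd₃, hf₃, hlen₃⟩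
  have hshape := hsh₁.update (u := u) (s' := s₃) (by omega) (hcc.trans hc₃)
    (fun u' hu' => (hhd₃ u' hu').trans (hh₂ u')) (fun i j hj hj1 hi hic => by
      rw [Function.update_self] at hi
      exact (hm₃ i j hj hj1 (by omega)).trans (hfr i j hj (.inr ⟨hi, hic⟩))) t₃ hlast'
    (Increasing.insert (hpq ▸ hlinc) hp1 hq1) hnd₃ (fun i hi => by
      rw [Function.update_self]
      rcases hf₃ i hi with h1 | h1
      · exact (hf₂ i h1).imp_right fun h => ⟨h.1, h.2.trans hc₃⟩
      · exact .inr ⟨by omega, h1.2⟩) (by rw [Function.update_self]; omega)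
  rw [Function.update_idem, Function.update_idem] at hshape
  have hinv : SkipInv w L (ks ++ [(u, c)]) s₃ := by
    refine ⟨_, _, hshape, fun u' c' e' hc' => ?_, ?_⟩
    · by_cases hu : u' = u
      · subst hu
        rw [Function.update_self]
        have hin : (c', e') ∈ p ++ (c, ks.length + 1) :: q ↔
            (c', e') = (c, ks.length + 1) ∨ (c', e') ∈ l := by
          rw [hpq]; simp; tauto
        rw [hin]
        by_cases hcc' : c' = c
        · subst hcc'
          have hn : (u', c') ∉ ks := keyIndex_eq_zero.1 hnew
          simp only [hcl e', or_false, keyIndex_append_self hn, Prod.mk.injEq, true_and]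
          omega
        · rw [keyIndex_append_of_ne (by simp [hcc']), ← hlmem c' e' hc']
          simp [hcc']
      · rw [Function.update_of_ne hu, keyIndex_append_of_ne (by simp [hu]), hmem u' c' e' hc']
    · have h1 := sum_update_add hmemu (fun i => (kv i).length)
        (p ++ (c, ks.length + 1) :: q).length
      have h2 : ∀ i, (Function.update kv u (p ++ (c, ks.length + 1) :: q) i).length =
          Function.update (fun i => (kv i).length) u (p ++ (c, ks.length + 1) :: q).length i := by
        intro i
        by_cases h' : i = u
        · subst h'; simp
        · simp [Function.update_of_ne h']
      have h3 : (p ++ (c, ks.length + 1) :: q).length = l.length + 1 := by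
        rw [hpq]; simp; omega
      simp only [h2]
      simp only [List.length_append (bs := [(u, c)]), List.length_singleton]
      omega
  have hcnt₃ := hinv.reg_le
  simp only [List.length_append, List.length_singleton] at hcnt₃
  have hb : SameBut [50, 51, 52, 53, 54, 55, 56, 57, 58, 59, 60] s s₃ :=
    hbb.trans (hb₃.mono (by simp))
  refine ⟨hinv, ⟨fun x hx => hb.reg x (by simp; omega), fun i => ?_, hb.revealed, hb.drawn, hb.out⟩,
    ?_, ?_⟩
  · rw [hev₃, ← hev₁]
    have := hfr (i / 8) (2 * (i % 8)) (by omega) (.inl (by omega))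
    rwa [show 16 * (i / 8) + 2 * (i % 8) = 2 * i by omega] at this
  · clear * - ht₁ ht₁' ht₂ ht₃ hh
    omega
  · refine hsp₃.trans (max_le (hsp₂.trans (max_le ?_ ?_)) ?_)
    · rw [hsp₁']
      refine hsp₁.trans (max_le_max le_rfl ?_)
      clear * - hcc hc₃ hcnt₃ hub
      omega
    · refine le_max_of_le_right ?_
      clear * - hcc hc₃ hcnt₃ hub
      omega
    · refine le_max_of_le_right ?_
      clear * - hcc hc₃ hcnt₃ hub
      omega

theorem skipInv_init : SkipInv w L [] State.init :=
  ⟨fun _ => [], fun _ => [], ⟨fun _ => .inl ⟨rfl, rfl, rfl⟩, fun _ => List.Pairwise.nil,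
    fun _ => List.nodup_nil, fun _ _ _ h => absurd h List.not_mem_nil,
    fun _ _ h => absurd h List.not_mem_nil, by simp [State.init]⟩,
    fun u c e _ => by simp [keyIndex]; omega, by simp⟩

/-- Skip lists are a dictionary. -/
def skipDictionary (hW : 128 * (L + 2) ≤ 2 ^ w) (hA : ∀ a ∈ A, a + 1 < 2 ^ w) :
    Dictionary w T A L (fun (_ : Unit) (_ : ℕ) => 0) (1000 * Nat.log 2 (A.card + 1) + 400) 0
      .skip skipFind skipInsert where
  Inv _ := SkipInv w L
  credit _ := 0
  cost _ _ _ := 1000 * Nat.log 2 (A.card + 1) + 400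
  inv_congr := fun ⟨kv, fp, h, h'⟩ ha => ⟨kv, fp, h.congr (ha.reg 52 (by norm_num)) ha.mem, h'⟩
  cost_le _ _ _ := by simp
  init_spec _ := ⟨_, .skip _, skipInv_init, .refl _, by simp [State.init], by simp [State.init]⟩
  find_spec hs hL hu hc h40 h41 := by
    obtain ⟨s', h1, h2, h3, h4, h5⟩ := skipFind_spec hW hs hL hu (hA _ hc) h40 h41
    exact ⟨s', h1, h2, h3, h4, h5⟩
  insert_spec hs hL h40 h41 h43 := by
    obtain ⟨s', h1, h2, h3, h4, h5⟩ := skipInsert_spec hW hs hL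
      (hA _ (hL.bound _ (by simp)).2) h40 h41 h43
    exact ⟨s', h1, h2, h3, h4, h5⟩

end dictionary

end WordRAM

namespace WordRAM

/-! ## Hashing

A dictionary with two random words `a₁` and `a₂`: the key `(u, c)` has the hash value
`(a₁ * u + a₂ * c) % 2 ^ w / d`. The keys with the same hash value are kept in a linked list. The
number of lists is doubled whenever it becomes less than the number of keys. The field at
`16 * b + 1` is the first entry of the list of the hash value `b`. The other fields of the entry of
a key are its successor in its list (3) and the two components of the key (5 and 7). -/

/-- The hash value of `k`. -/
def hash (w a₁ a₂ d : ℕ) (k : ℕ × ℕ) : ℕ :=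
  (a₁ * k.1 % 2 ^ w + a₂ * k.2 % 2 ^ w) % 2 ^ w / d

/-- The size of a block of words with the same hash value, when there are `M` hash values. -/
def blockSize (w M : ℕ) : ℕ := (2 ^ w - 1) / M + 1

/-- `blockSize` is rounded up, so M blocks cover all words. -/
theorem hash_lt {w a₁ a₂ M : ℕ} {k : ℕ × ℕ} (hM : 0 < M) : hash w a₁ a₂ (blockSize w M) k < M := by
  have hN : 0 < 2 ^ w := Nat.two_pow_pos w
  rw [hash, Nat.div_lt_iff_lt_mul (show 0 < blockSize w M from Nat.succ_pos _), blockSize]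
  have h1 := Nat.mod_lt (a₁ * k.1 % 2 ^ w + a₂ * k.2 % 2 ^ w) hN
  have h2 := Nat.lt_div_mul_add (a := 2 ^ w - 1) hM
  rw [mul_add, mul_one, mul_comm M]
  omega

theorem eval_lt_eq_zero {w : ℕ} {ρ : ℕ → ℕ} {e₁ e₂ : Expr} :
    (Expr.bin .lt e₁ e₂).eval w ρ = 0 ↔ e₂.eval w ρ ≤ e₁.eval w ρ := by
  simp [Expr.eval, BinOp.eval]

/-- The hash value of the key with the components `e₁` and `e₂`. -/
def hashExpr (e₁ e₂ : Expr) : Expr :=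
  .bin .div (.bin .add (.bin .mul (.reg 50) e₁) (.bin .mul (.reg 51) e₂)) (.reg 53)

theorem eval_hashExpr {w : ℕ} {ρ : ℕ → ℕ} {e₁ e₂ : Expr} : (hashExpr e₁ e₂).eval w ρ =
    hash w (ρ 50) (ρ 51) (ρ 53) (e₁.eval w ρ, e₂.eval w ρ) := rfl

/-- In the memory `m`, the entries `l` are a linked list that starts with `y`. -/
inductive Linked (m : ℕ → ℕ) : ℕ → List ℕ → Prop
  | nil : Linked m 0 []
  | cons {y : ℕ} {l : List ℕ} : y ≠ 0 → Linked m (m (16 * y + 3)) l → Linked m y (y :: l)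

theorem Linked.congr {m m' : ℕ → ℕ} {y : ℕ} {l : List ℕ} (h : Linked m y l)
    (hm : ∀ i ∈ l, m' (16 * i + 3) = m (16 * i + 3)) : Linked m' y l := by
  induction h with
  | nil => exact .nil
  | cons h0 _ ih =>
    refine .cons h0 ?_
    rw [hm _ (by simp)]
    exact ih fun i hi => hm i (by simp [hi])

/-- The lists contain the entries `1, ..., n`. -/
structure HashShape (w n : ℕ) (s : State) : Prop where
  two_le : 2 ≤ s.reg 52
  block : s.reg 53 = blockSize w (s.reg 52)
  lists : ∀ b < s.reg 52, ∃ l, Linked s.mem (s.mem (16 * b + 1)) l ∧ l.Nodup ∧ ∀ i, i ∈ l ↔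
    1 ≤ i ∧ i ≤ n ∧
      hash w (s.reg 50) (s.reg 51) (s.reg 53) (s.mem (16 * i + 5), s.mem (16 * i + 7)) = b

/-- The entry in register 54 is put in front of its list. -/
def hashPush : Program :=
  .seq (.instr (.load 55 (fieldAddr 5 (.reg 54)))) <|
  .seq (.instr (.load 56 (fieldAddr 7 (.reg 54)))) <|
  .seq (.instr (.assign 57 (hashExpr (.reg 55) (.reg 56)))) <|
  .seq (.instr (.load 58 (fieldAddr 1 (.reg 57)))) <|
  .seq (.instr (.store (fieldAddr 3 (.reg 54)) (.reg 58))) <|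
  .seq (.instr (.store (fieldAddr 1 (.reg 57)) (.reg 54)))
    (.instr (.assign 54 (.bin .add (.reg 54) (.const 1))))

/-- The entries up to the one in register 43 are put in front of their lists. -/
def hashPushAll : Program :=
  .loop (.bin .lt (.reg 54) (.bin .add (.reg 43) (.const 1))) hashPush

/-- The lists become empty. -/
def hashClear : Program :=
  .loop (.bin .lt (.reg 54) (.reg 52))
    (.seq (.instr (.store (fieldAddr 1 (.reg 54)) (.const 0)))
      (.instr (.assign 54 (.bin .add (.reg 54) (.const 1)))))

/-- The size of the blocks is computed. -/
def hashBlock : Program :=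
  .instr (.assign 53 (.bin .add (.bin .div maxWord (.reg 52)) (.const 1)))

/-- The random words are drawn. -/
def hashInit : Program :=
  .seq (.instr (.rand 50)) <| .seq (.instr (.rand 51)) <| .seq (.instr (.assign 52 (.const 2)))
    hashBlock

/-- The insertion of the key in the registers 40 and 41 with the number in register 43. -/
def hashInsert : Program :=
  .seq (.instr (.store (fieldAddr 5 (.reg 43)) (.reg 40))) <|
  .seq (.instr (.store (fieldAddr 7 (.reg 43)) (.reg 41))) <|
  .seq (.ite (.bin .lt (.reg 52) (.reg 43))
    (.seq (.instr (.assign 52 (.bin .add (.reg 52) (.reg 52)))) <|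
      .seq hashBlock <| .seq (.instr (.assign 54 (.const 0))) <|
      .seq hashClear (.instr (.assign 54 (.const 1))))
    (.instr (.assign 54 (.reg 43)))) hashPushAll

/-- One step of the search in a list. -/
def hashFindStep : Program :=
  .seq (.instr (.load 55 (fieldAddr 5 (.reg 58)))) <|
  .seq (.instr (.load 56 (fieldAddr 7 (.reg 58)))) <|
  .ite (.bin .mul (.bin .eq (.reg 55) (.reg 40)) (.bin .eq (.reg 56) (.reg 41)))
    (.seq (.instr (.assign 42 (.reg 58))) (.instr (.assign 58 (.const 0))))
    (.instr (.load 58 (fieldAddr 3 (.reg 58))))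

/-- The search for the key in the registers 40 and 41. -/
def hashFind : Program :=
  .seq (.instr (.assign 57 (hashExpr (.reg 40) (.reg 41)))) <|
  .seq (.instr (.load 58 (fieldAddr 1 (.reg 57)))) <|
  .seq (.instr (.assign 42 (.const 0))) <| .loop (.reg 58) hashFindStep

section hashing

variable {w L : ℕ} {T : List ℕ} {ω : ℕ → ℕ}

theorem hashClear_spec {B : ℕ} (k : ℕ) : ∀ s : State, s.reg 52 = s.reg 54 + k →
    16 * s.reg 52 + 16 ≤ 2 ^ w → 16 * s.reg 52 ≤ B →
    Program.wp w T ω hashClear (fun s' => SameBut [54] s s' ∧ s'.time ≤ s.time + 20 * k + 10 ∧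
      s'.space ≤ max s.space B ∧
      (∀ b < s.reg 52, s.reg 54 ≤ b → s'.mem (16 * b + 1) = 0) ∧
      (∀ i j, j < 16 → j ≠ 1 ∨ i < s.reg 54 → s'.mem (16 * i + j) = s.mem (16 * i + j))) s := by
  induction k with
  | zero =>
    intro s h52 hw hB
    rw [hashClear, wp_loop]
    refine ⟨fun h => absurd ?_ h, fun _ => ⟨⟨fun _ _ => rfl, rfl, rfl, rfl⟩, ?_, ?_, ?_, ?_⟩⟩
    · rw [eval_lt_eq_zero]
      simp only [Expr.eval]
      omega
    · simp only [State.tick, Expr.cost]; omega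
    · simp [State.tick]
    · intro b hb hb'; omega
    · intro i j _ _; rfl
  | succ k ih =>
    intro s h52 hw hB
    have h54 : 16 * s.reg 54 + 16 ≤ 2 ^ w := by omega
    have hmod : (s.reg 54 + 1) % 2 ^ w = s.reg 54 + 1 := Nat.mod_eq_of_lt (by omega)
    rw [hashClear, wp_loop]
    refine ⟨fun _ => ?_, fun h => absurd h ?_⟩
    · rw [← hashClear]
      refine Program.wp_intro fun Q hQ => ?_
      simp only [wp_seq, wp_instr, Instr.effect, State.touch,
        State.setReg, State.tick, Expr.eval, BinOp.eval, fieldAddr, Instr.cost, Expr.cost]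
      simp [addr_mod h54, hmod]
      refine hQ _ (Program.wp_mono (ih _ ?_ ?_ ?_) ?_)
      · simp; omega
      · simpa using hw
      · simpa using hB
      rintro s' ⟨h1, h2, h3, h4, h5⟩
      simp at h2 h3 h4 h5
      refine ⟨⟨fun z hz => ?_, h1.revealed, h1.drawn, h1.out⟩, by omega, by omega, ?_, ?_⟩
      · rw [h1.reg z hz]
        simp at hz
        simp [hz]
      · intro b hb hb'
        rcases hb'.eq_or_lt with h | h
        · subst h
          rw [h5 _ 1 (by norm_num) (.inr (by omega))]
          simp
        · exact h4 b hb h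
      · intro i j hj hij
        rw [h5 i j hj (by omega), Function.update_of_ne (by omega)]
    · rw [eval_lt_eq_zero]
      simp only [Expr.eval]
      omega

theorem hashPush_spec {B n : ℕ} {s : State} (hs : HashShape w n s) (h54 : s.reg 54 = n + 1)
    (hw : 16 * s.reg 52 + 16 ≤ 2 ^ w) (hn : 16 * (n + 2) + 16 ≤ 2 ^ w) (hB : 16 * s.reg 52 ≤ B)
    (hB' : 16 * (n + 2) ≤ B) :
    Program.wp w T ω hashPush (fun s' => SameBut [54, 55, 56, 57, 58] s s' ∧
      HashShape w (n + 1) s' ∧ s'.reg 54 = n + 2 ∧ s'.time ≤ s.time + 60 ∧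
      s'.space ≤ max s.space B ∧
      (∀ i j, j < 16 → j ≠ 1 → j ≠ 3 → s'.mem (16 * i + j) = s.mem (16 * i + j))) s := by
  obtain ⟨h2, hd, hl⟩ := hs
  have hn1 : 16 * (n + 1) + 16 ≤ 2 ^ w := by omega
  have hmod : (n + 1 + 1) % 2 ^ w = n + 1 + 1 := Nat.mod_eq_of_lt (by omega)
  obtain ⟨b, hb⟩ : ∃ b, hash w (s.reg 50) (s.reg 51) (s.reg 53)
    (s.mem (16 * (n + 1) + 5), s.mem (16 * (n + 1) + 7)) = b := ⟨_, rfl⟩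
  have hbM : b < s.reg 52 := by rw [← hb, hd]; exact hash_lt (by omega)
  have hb1 : 16 * b + 16 ≤ 2 ^ w := by omega
  refine Program.wp_intro fun Q hQ => ?_
  simp only [hashPush, wp_seq, wp_instr, Instr.effect, State.touch,
    State.setReg, State.tick, eval_hashExpr]
  simp only [Expr.eval, BinOp.eval, fieldAddr, Instr.cost, Expr.cost, hashExpr]
  simp [h54, addr_mod hn1, hb, addr_mod hb1, hmod]
  generalize hm' : Function.update (Function.update s.mem _ _) _ _ = m'
  have e1 : m' (16 * b + 1) = n + 1 := by simp [← hm']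
  have e3 : m' (16 * (n + 1) + 3) = s.mem (16 * b + 1) := by simp [← hm', update_field]
  have fr : ∀ i j, j < 16 → (j ≠ 1 ∨ i ≠ b) → (j ≠ 3 ∨ i ≠ n + 1) →
      m' (16 * i + j) = s.mem (16 * i + j) := by
    intro i j hj hij hij'
    rw [← hm']
    repeat rw [Function.update_of_ne (by omega)]
  clear hm'
  refine hQ _ ⟨⟨fun z hz => ?_, rfl, rfl, rfl⟩, ⟨by simpa using h2, by simpa using hd, ?_⟩, by simp,
    ?_, ?_, ?_⟩
  · simp at hz; simp [hz]
  · intro b' hb'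
    simp at hb' ⊢
    obtain ⟨l, hl1, hl2, hl3⟩ := hl b' hb'
    have hnl : n + 1 ∉ l := fun h => by have := ((hl3 _).1 h).2.1; omega
    have hl1' : Linked m' (s.mem (16 * b' + 1)) l := hl1.congr fun i hi =>
      fr i 3 (by norm_num) (.inl (by norm_num)) (.inr fun h => hnl (h ▸ hi))
    have h5 : ∀ i, m' (16 * i + 5) = s.mem (16 * i + 5) := fun i =>
      fr i 5 (by norm_num) (.inl (by norm_num)) (.inl (by norm_num))
    have h7 : ∀ i, m' (16 * i + 7) = s.mem (16 * i + 7) := fun i =>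
      fr i 7 (by norm_num) (.inl (by norm_num)) (.inl (by norm_num))
    simp only [h5, h7]
    by_cases hbb : b' = b
    · subst hbb
      refine ⟨(n + 1) :: l, ?_, List.nodup_cons.2 ⟨hnl, hl2⟩, fun i => ?_⟩
      · rw [e1]
        exact .cons (Nat.succ_ne_zero n) (by rw [e3]; exact hl1')
      · rw [List.mem_cons, hl3]
        by_cases hi : i = n + 1
        · subst hi; simp [hb]
        · simp only [hi, false_or]
          exact and_congr_right fun _ => and_congr_left fun _ => by omega
    · refine ⟨l, ?_, hl2, fun i => ?_⟩
      · rw [fr b' 1 (by norm_num) (.inr hbb) (.inl (by norm_num))]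
        exact hl1'
      · rw [hl3]
        by_cases hi : i = n + 1
        · subst hi
          simp only [hb]
          constructor
          · rintro ⟨_, h, _⟩; omega
          · rintro ⟨_, _, h⟩; exact absurd h.symm hbb
        · exact and_congr_right fun _ => and_congr_left fun _ => by omega
  · simp only []; omega
  · simp only []
    repeat' refine max_le ?_ ?_
    all_goals first | exact le_max_left _ _ | exact le_max_of_le_right (by omega)
  · intro i j hj hj1 hj3
    exact fr i j hj (.inl hj1) (.inl hj3)

/-- This one loop serves both cases of an insertion: with n the number of old keys and k = 1 it adds
the new entry, and with n = 0 it fills an empty table again. -/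
theorem hashPushAll_spec {B : ℕ} (k : ℕ) : ∀ (n : ℕ) (s : State), HashShape w n s →
    s.reg 54 = n + 1 → s.reg 43 = n + k → 16 * s.reg 52 + 16 ≤ 2 ^ w →
    16 * (n + k + 2) + 16 ≤ 2 ^ w → 16 * s.reg 52 ≤ B → 16 * (n + k + 2) ≤ B →
    Program.wp w T ω hashPushAll (fun s' => SameBut [54, 55, 56, 57, 58] s s' ∧
      HashShape w (n + k) s' ∧ s'.time ≤ s.time + 70 * k + 10 ∧ s'.space ≤ max s.space B ∧
      (∀ i j, j < 16 → j ≠ 1 → j ≠ 3 → s'.mem (16 * i + j) = s.mem (16 * i + j))) s := by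
  induction k with
  | zero =>
    intro n s hs h54 h43 hw hn hB hB'
    rw [hashPushAll, wp_loop]
    refine ⟨fun h => absurd ?_ h, fun _ => ⟨⟨fun _ _ => rfl, rfl, rfl, rfl⟩,
      ⟨hs.two_le, hs.block, hs.lists⟩, ?_, ?_, fun _ _ _ _ _ => rfl⟩⟩
    · rw [eval_lt_eq_zero]
      simp only [Expr.eval, BinOp.eval]
      rw [Nat.mod_eq_of_lt (a := 1) (by omega), Nat.mod_eq_of_lt (by omega)]
      omega
    · simp only [State.tick, Expr.cost]; omega
    · simp [State.tick]
  | succ k ih =>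
    intro n s hs h54 h43 hw hn hB hB'
    rw [hashPushAll, wp_loop, ← hashPushAll]
    refine ⟨fun _ => ?_, fun h => absurd h ?_⟩
    · refine Program.wp_mono (hashPush_spec (B := B) (n := n)
        ⟨hs.two_le, hs.block, hs.lists⟩ h54 hw (by omega) hB (by omega)) ?_
      rintro s₁ ⟨hb₁, hs₁, h54₁, ht₁, hsp₁, hm₁⟩
      have h52₁ : s₁.reg 52 = s.reg 52 := hb₁.reg 52 (by simp)
      have h43₁ : s₁.reg 43 = s.reg 43 := hb₁.reg 43 (by simp)
      refine Program.wp_mono (ih (n + 1) s₁ hs₁ h54₁ (by omega) (by omega) (by omega) (by omega)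
        (by omega)) ?_
      rintro s₂ ⟨hb₂, hs₂, ht₂, hsp₂, hm₂⟩
      simp only [State.tick, Expr.cost] at ht₁ hsp₁
      refine ⟨⟨fun z hz => (hb₂.reg z hz).trans (hb₁.reg z hz), hb₂.revealed.trans hb₁.revealed,
        hb₂.drawn.trans hb₁.drawn, hb₂.out.trans hb₁.out⟩, ?_, by omega, by omega,
        fun i j hj h1 h3 => (hm₂ i j hj h1 h3).trans (hm₁ i j hj h1 h3)⟩
      rw [show n + (k + 1) = n + 1 + k by omega]
      exact hs₂
    · rw [eval_lt_eq_zero]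
      simp only [Expr.eval, BinOp.eval]
      rw [Nat.mod_eq_of_lt (a := 1) (by omega), Nat.mod_eq_of_lt (by omega)]
      omega

theorem hashBlock_eval {ρ : ℕ → ℕ} (hN : 4 ≤ 2 ^ w) (hM : 2 ≤ ρ 52) :
    (Expr.bin .add (.bin .div maxWord (.reg 52)) (.const 1)).eval w ρ = blockSize w (ρ 52) := by
  simp only [Expr.eval, BinOp.eval]
  have h : Expr.eval w ρ maxWord = 2 ^ w - 1 := eval_maxWord (by omega)
  rw [h, Nat.mod_eq_of_lt (a := 1) (by omega), blockSize]
  refine Nat.mod_eq_of_lt ?_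
  have := Nat.div_le_div_left hM (by norm_num) (a := 2 ^ w - 1)
  omega

end hashing

end WordRAM

namespace WordRAM

/-! ### Collisions -/

/-- The numbers a * δ + β are at least δ apart, so `a` is determined by their quotient by N together
with the block of length δ that contains their residue. There are δ + 1 possible quotients, as a * δ
+ β < N * (δ + 1), and E / δ + 1 possible blocks. -/
theorem card_mul_add_mod_lt {N δ β E : ℕ} (hδ : 0 < δ) (hβ : β < N) :
    (Finset.univ.filter fun a : Fin N => (a * δ + β) % N < E).card ≤ (δ + 1) * (E / δ + 1) := by
  have hN : 0 < N := by omega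
  have : ((Finset.range (δ + 1)) ×ˢ (Finset.range (E / δ + 1))).card = (δ + 1) * (E / δ + 1) := by
    simp
  rw [← this]
  refine Finset.card_le_card_of_injOn (fun a => ((a * δ + β) / N, (a * δ + β) % N / δ)) ?_ ?_
  · intro a ha
    simp only [Finset.coe_filter, Finset.mem_univ, true_and, Set.mem_ofPred_eq] at ha
    simp only [Finset.coe_product, Finset.coe_range, Set.mem_prod, Set.mem_Iio]
    refine ⟨?_, Nat.lt_succ_of_le (Nat.div_le_div_right ha.le)⟩
    rw [Nat.div_lt_iff_lt_mul hN]
    have : (a : ℕ) * δ ≤ N * δ := Nat.mul_le_mul_right _ a.2.le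
    nlinarith
  · intro a _ b _ hab
    simp only [Prod.mk.injEq] at hab
    have h1 := Nat.div_add_mod (a * δ + β) N
    have h2 := Nat.div_add_mod (b * δ + β) N
    have h3 := Nat.div_add_mod ((a * δ + β) % N) δ
    have h4 := Nat.div_add_mod ((b * δ + β) % N) δ
    have h5 := Nat.mod_lt ((a * δ + β) % N) hδ
    have h6 := Nat.mod_lt ((b * δ + β) % N) hδ
    rw [hab.1] at h1
    rw [hab.2] at h3
    refine Fin.ext (le_antisymm ?_ ?_)
    · by_contra h
      have : ((b : ℕ) + 1) * δ ≤ a * δ := Nat.mul_le_mul_right _ (by omega)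
      rw [add_mul, one_mul] at this
      omega
    · by_contra h
      have : ((a : ℕ) + 1) * δ ≤ b * δ := Nat.mul_le_mul_right _ (by omega)
      rw [add_mul, one_mul] at this
      omega

/-- If two values lie in the same block of length D, they differ by less than D, so a * (y - x) plus
a constant has a residue below 2 * D, and such `a` have been counted. The bound is 4 * D + δ + 2,
with y - x = δ + 1. Multiplied by M it is at most 5 * N + 5 * M: the condition on D controls the
first term and y * M ≤ N the second. -/
theorem card_collision_lt {N D M x y t t' : ℕ} (hxy : x < y) (ht : t < N)
    (hMN : M ≤ N) (hD0 : 0 < D) (hD : M * D ≤ N + M) (hy : y * M ≤ N) :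
    M * (Finset.univ.filter fun a : Fin N =>
      (a * x % N + t) % N / D = (a * y % N + t') % N / D).card ≤ 10 * N := by
  have hN : 0 < N := by omega
  obtain ⟨δ, rfl⟩ := Nat.exists_eq_add_of_lt hxy
  have hδ : 0 < δ + 1 := by omega
  have hsub : (Finset.univ.filter fun a : Fin N =>
      (a * x % N + t) % N / D = (a * (x + δ + 1) % N + t') % N / D) ⊆
      Finset.univ.filter fun a : Fin N =>
        (a * (δ + 1) + (t' + (N - t) + D) % N) % N < 2 * D := by
    intro a ha
    simp only [Finset.mem_filter, Finset.mem_univ, true_and] at ha ⊢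
    rw [Nat.add_mod_mod]
    rw [Nat.mod_add_mod, Nat.mod_add_mod] at ha
    obtain ⟨P, hP⟩ : ∃ P, (a * x + t) % N = P := ⟨_, rfl⟩
    obtain ⟨Q, hQ⟩ : ∃ Q, (a * (x + δ + 1) + t') % N = Q := ⟨_, rfl⟩
    rw [hP, hQ] at ha
    have h1 := Nat.div_add_mod P D
    have h2 := Nat.div_add_mod Q D
    have h3 := Nat.mod_lt P hD0
    have h4 := Nat.mod_lt Q hD0
    rw [ha] at h1
    -- Adding D makes the difference of the two values positive, and N - t stands for -t, so that
    -- all subtractions are between natural numbers in the right order.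
    have hmod : a * (δ + 1) + (t' + (N - t) + D) ≡ Q + D - P [MOD N] := by
      refine Nat.ModEq.add_right_cancel (Nat.ModEq.refl P) ?_
      rw [Nat.sub_add_cancel (by omega)]
      have e1 : P ≡ a * x + t [MOD N] := hP ▸ Nat.mod_modEq _ _
      have e2 : a * (x + δ + 1) + t' ≡ Q [MOD N] := hQ ▸ (Nat.mod_modEq _ _).symm
      calc a * (δ + 1) + (t' + (N - t) + D) + P
          ≡ a * (δ + 1) + (t' + (N - t) + D) + (a * x + t) [MOD N] := e1.add_left _
        _ = a * (x + δ + 1) + t' + D + N := by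
          have : N - t + t = N := Nat.sub_add_cancel ht.le
          calc _ = a * (x + δ + 1) + t' + D + (N - t + t) := by ring
            _ = _ := by rw [this]
        _ ≡ a * (x + δ + 1) + t' + D [MOD N] := Nat.add_modEq_right
        _ ≡ Q + D [MOD N] := e2.add_right _
    have : (a * (δ + 1) + (t' + (N - t) + D)) % N = (Q + D - P) % N := hmod
    rw [this]
    exact (Nat.mod_le _ _).trans_lt (by omega)
  have hc := (Finset.card_le_card hsub).trans (card_mul_add_mod_lt hδ (Nat.mod_lt _ hN))
  refine (Nat.mul_le_mul_left M hc).trans ?_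
  have h1 : (δ + 1) * (2 * D / (δ + 1)) ≤ 2 * D := Nat.mul_div_le _ _
  have h2 : (δ + 1 + 1) * (2 * D / (δ + 1) + 1) ≤ 4 * D + (δ + 2) := by nlinarith
  have h3 : (δ + 1) * M ≤ N := le_trans (Nat.mul_le_mul_right _ (by omega)) hy
  calc _ ≤ M * (4 * D + (δ + 2)) := Nat.mul_le_mul_left _ h2
    _ = 4 * (M * D) + ((δ + 1) * M + M) := by ring
    _ ≤ _ := by omega

theorem card_collision_ne {N D M x y t t' : ℕ} (hxy : x ≠ y) (ht : t < N) (ht' : t' < N)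
    (hMN : M ≤ N) (hD0 : 0 < D) (hD : M * D ≤ N + M) (hx : x * M ≤ N) (hy : y * M ≤ N) :
    M * (Finset.univ.filter fun a : Fin N =>
      (a * x % N + t) % N / D = (a * y % N + t') % N / D).card ≤ 10 * N := by
  rcases hxy.lt_or_gt with h | h
  · exact card_collision_lt h ht hMN hD0 hD hy
  · simpa only [eq_comm] using card_collision_lt (t := t') (t' := t) h ht' hMN hD0 hD hx

theorem blockSize_mul_le {w M : ℕ} : M * blockSize w M ≤ 2 ^ w + M := by
  rw [blockSize, mul_add, mul_one]
  exact Nat.add_le_add_right ((Nat.mul_div_le _ _).trans (Nat.sub_le _ _)) _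

/-- Two keys collide with a probability of at most `10 / M`. -/
theorem card_collision {w M : ℕ} {k k' : ℕ × ℕ} (hk : k ≠ k') (hMN : M ≤ 2 ^ w)
    (h1 : k.1 * M ≤ 2 ^ w) (h1' : k'.1 * M ≤ 2 ^ w) (h2 : k.2 * M ≤ 2 ^ w)
    (h2' : k'.2 * M ≤ 2 ^ w) :
    M * (Finset.univ.filter fun a : Fin (2 ^ w) × Fin (2 ^ w) =>
      hash w a.1 a.2 (blockSize w M) k = hash w a.1 a.2 (blockSize w M) k').card ≤
      10 * (2 ^ w * 2 ^ w) := by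
  have hN : 0 < 2 ^ w := Nat.two_pow_pos w
  rw [Finset.card_filter]
  -- The random multiplier of a component in which the keys differ produces the bound. The other
  -- random word is fixed, and its contribution enters as the shifts t and t'.
  by_cases hu : k.1 = k'.1
  · have hc : k.2 ≠ k'.2 := fun h => hk (Prod.ext hu h)
    rw [Fintype.sum_prod_type, Finset.mul_sum]
    refine (Finset.sum_le_card_nsmul _ _ (10 * 2 ^ w) fun a _ => ?_).trans ?_
    · rw [← Finset.card_filter]
      simp only [hash, Nat.add_comm (a.1 * _ % _)]
      exact card_collision_ne hc (Nat.mod_lt _ hN) (Nat.mod_lt _ hN) hMN (Nat.succ_pos _)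
        blockSize_mul_le h2 h2'
    · simp only [Finset.card_univ, Fintype.card_fin, smul_eq_mul]
      exact le_of_eq (by ring)
  · rw [Fintype.sum_prod_type_right, Finset.mul_sum]
    refine (Finset.sum_le_card_nsmul _ _ (10 * 2 ^ w) fun a _ => ?_).trans ?_
    · rw [← Finset.card_filter]
      simp only [hash]
      exact card_collision_ne hu (Nat.mod_lt _ hN) (Nat.mod_lt _ hN) hMN (Nat.succ_pos _)
        blockSize_mul_le h1 h1'
    · simp only [Finset.card_univ, Fintype.card_fin, smul_eq_mul]
      exact le_of_eq (by ring)

/-- The expected number of keys with the same hash value as `k` is bounded. -/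
theorem sum_length_filter_hash {w M : ℕ} {ks : List (ℕ × ℕ)} {k : ℕ × ℕ} (hnd : ks.Nodup)
    (hlen : ks.length ≤ M) (hM : 0 < M) (hMN : M ≤ 2 ^ w)
    (hks : ∀ k' ∈ k :: ks, k'.1 * M ≤ 2 ^ w ∧ k'.2 * M ≤ 2 ^ w) :
    ∑ a : Fin (2 ^ w) × Fin (2 ^ w), (ks.filter fun k' =>
      hash w a.1 a.2 (blockSize w M) k' = hash w a.1 a.2 (blockSize w M) k).length ≤
      11 * (2 ^ w * 2 ^ w) := by
  -- Each key other than `k` contributes at most 10 / M on average. If `k` itself is in the list, it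
  -- always collides and contributes 1, once, since there are no duplicates. With at most M keys, 10
  -- + 1 = 11.
  have key : ∀ l : List (ℕ × ℕ), l.Nodup →
      (∀ k' ∈ k :: l, k'.1 * M ≤ 2 ^ w ∧ k'.2 * M ≤ 2 ^ w) →
      M * ∑ a : Fin (2 ^ w) × Fin (2 ^ w), (l.filter fun k' =>
        hash w a.1 a.2 (blockSize w M) k' = hash w a.1 a.2 (blockSize w M) k).length ≤
        10 * (2 ^ w * 2 ^ w) * l.length + if k ∈ l then M * (2 ^ w * 2 ^ w) else 0 := by
    intro l
    induction l with
    | nil => simp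
    | cons x l ih =>
      intro hnd hb
      rw [List.nodup_cons] at hnd
      have ih := ih hnd.2 fun k' hk' => hb k' (by simp at hk' ⊢; tauto)
      have hsplit : ∀ a : Fin (2 ^ w) × Fin (2 ^ w), ((x :: l).filter fun k' =>
          hash w a.1 a.2 (blockSize w M) k' = hash w a.1 a.2 (blockSize w M) k).length =
          (if hash w a.1 a.2 (blockSize w M) x = hash w a.1 a.2 (blockSize w M) k then 1 else 0) +
          (l.filter fun k' =>
            hash w a.1 a.2 (blockSize w M) k' = hash w a.1 a.2 (blockSize w M) k).length := by
        intro a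
        rw [List.filter_cons]
        split <;> simp_all [Nat.add_comm]
      simp only [hsplit, Finset.sum_add_distrib, ← Finset.card_filter, mul_add, List.length_cons]
      by_cases hx : x = k
      · subst hx
        simp only [hnd.1, if_false, List.mem_cons, true_or, if_true] at ih ⊢
        simp only [Finset.filter_true, Finset.card_univ, Fintype.card_prod, Fintype.card_fin]
        omega
      · have hc := card_collision hx hMN (hb x (by simp)).1 (hb k (by simp)).1
          (hb x (by simp)).2 (hb k (by simp)).2
        simp only [List.mem_cons, Ne.symm hx, false_or]
        omega
  have h := key ks hnd hks
  have h' : M * ∑ a : Fin (2 ^ w) × Fin (2 ^ w), (ks.filter fun k' =>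
      hash w a.1 a.2 (blockSize w M) k' = hash w a.1 a.2 (blockSize w M) k).length ≤
      M * (11 * (2 ^ w * 2 ^ w)) := by
    have h1 : 10 * (2 ^ w * 2 ^ w) * ks.length ≤ 10 * (2 ^ w * 2 ^ w) * M :=
      Nat.mul_le_mul_left _ hlen
    have h2 : (if k ∈ ks then M * (2 ^ w * 2 ^ w) else 0) ≤ M * (2 ^ w * 2 ^ w) := by
      split <;> simp
    calc _ ≤ 10 * (2 ^ w * 2 ^ w) * M + M * (2 ^ w * 2 ^ w) := by omega
      _ = _ := by ring
  exact Nat.le_of_mul_le_mul_left h' hM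

/-! ### The dictionary -/

/-- The number of hash values when there are `n` keys. -/
def hashSize : ℕ → ℕ
  | 0 => 2
  | n + 1 => if hashSize n < n + 1 then hashSize n + hashSize n else hashSize n

theorem hashSize_bounds (n : ℕ) : 2 ≤ hashSize n ∧ n ≤ hashSize n ∧ hashSize n ≤ 2 * n + 2 := by
  induction n with
  | zero => simp [hashSize]
  | succ n ih =>
    rw [hashSize]
    split <;> omega

/-- The lists contain the keys `ks`. -/
structure HashInv (w a₁ a₂ : ℕ) (ks : List (ℕ × ℕ)) (s : State) : Prop where
  reg₁ : s.reg 50 = a₁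
  reg₂ : s.reg 51 = a₂
  size : s.reg 52 = hashSize ks.length
  shape : HashShape w ks.length s
  keys : ∀ (i : ℕ) (hi : i < ks.length),
    (s.mem (16 * (i + 1) + 5), s.mem (16 * (i + 1) + 7)) = ks[i]

end WordRAM

/-! ### The operations of the hash table. -/

namespace WordRAM

section hashing

variable {w L a₁ a₂ : ℕ} {T : List ℕ} {ω : ℕ → ℕ} {A : Finset ℕ}

theorem HashInv.congr {ks : List (ℕ × ℕ)} {s s' : State} (hs : HashInv w a₁ a₂ ks s)
    (hr : ∀ x, 50 ≤ x → x ≤ 53 → s'.reg x = s.reg x)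
    (hm' : ∀ i, s'.mem (2 * i + 1) = s.mem (2 * i + 1)) : HashInv w a₁ a₂ ks s' := by
  have hm : ∀ i j, j % 2 = 1 → s'.mem (16 * i + j) = s.mem (16 * i + j) := by
    intro i j hj
    rw [show 16 * i + j = 2 * (8 * i + j / 2) + 1 by omega, hm']
  have h50 := hr 50 (by norm_num) (by norm_num)
  have h51 := hr 51 (by norm_num) (by norm_num)
  have h52 := hr 52 (by norm_num) (by norm_num)
  have h53 := hr 53 (by norm_num) (by norm_num)
  refine ⟨h50.trans hs.reg₁, h51.trans hs.reg₂, h52.trans hs.size, ⟨h52 ▸ hs.shape.two_le, ?_,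
    fun b hb => ?_⟩, fun i hi => ?_⟩
  · rw [h53, h52]; exact hs.shape.block
  · rw [h52] at hb
    obtain ⟨l, h1, h2, h3⟩ := hs.shape.lists b hb
    refine ⟨l, ?_, h2, fun i => ?_⟩
    · rw [hm b 1 (by norm_num)]
      exact h1.congr fun i _ => hm i 3 (by norm_num)
    · rw [h50, h51, h53, hm i 5 (by norm_num), hm i 7 (by norm_num)]
      exact h3 i
  · rw [hm _ 5 (by norm_num), hm _ 7 (by norm_num)]
    exact hs.keys i hi

theorem wp_hashBlock {Q : State → Prop} {s : State} (hN : 4 ≤ 2 ^ w) (hM : 2 ≤ s.reg 52) :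
    Program.wp w T ω hashBlock Q s ↔ Q ((s.setReg 53 (blockSize w (s.reg 52))).tick 8) := by
  rw [hashBlock, wp_instr, Instr.effect, hashBlock_eval hN hM]
  rfl

theorem hashFindLoop_spec {m : ℕ → ℕ} {y B : ℕ} {l : List ℕ} (hl : Linked m y l)
    (hB : ∀ i ∈ l, 16 * i + 16 ≤ 2 ^ w ∧ 16 * i + 16 ≤ B) :
    ∀ s : State, s.mem = m → s.reg 58 = y → s.reg 42 = 0 →
      Program.wp w T ω (.loop (.reg 58) hashFindStep) (fun s' =>
        SameBut [42, 55, 56, 58] s s' ∧ s'.mem = m ∧ s'.time ≤ s.time + (60 * l.length + 10) ∧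
        s'.space ≤ max s.space B ∧
        (s'.reg 42 ∈ l ∧
          (m (16 * s'.reg 42 + 5), m (16 * s'.reg 42 + 7)) = (s.reg 40, s.reg 41) ∨
        s'.reg 42 = 0 ∧ ∀ i ∈ l, (m (16 * i + 5), m (16 * i + 7)) ≠ (s.reg 40, s.reg 41))) s := by
  induction hl with
  | nil =>
    intro s hm h58 h42
    rw [wp_loop]
    refine ⟨fun h => absurd h58 h, fun _ => ⟨⟨fun _ _ => rfl, rfl, rfl, rfl⟩, hm, ?_, ?_,
      .inr ⟨h42, by simp⟩⟩⟩
    · simp [State.tick, Expr.cost]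
    · simp [State.tick]
  | @cons y l h0 hl ih =>
    intro s hm h58 h42
    have hy := hB y (by simp)
    have hy1 := hy.1
    have h1 : 1 % 2 ^ w = 1 := Nat.mod_eq_of_lt (by omega)
    refine wp_loop_of_ne (by simpa [Expr.eval, h58] using h0) ?_
    refine Program.wp_intro fun Q hQ => ?_
    simp only [hashFindStep, wp_seq, wp_instr, wp_ite, Instr.effect, State.touch,
      State.setReg, State.tick, Expr.eval, BinOp.eval, fieldAddr, Instr.cost, Expr.cost]
    simp [h58, hm, addr_mod hy1]
    constructor
    · intro hne
      have hk : m (16 * y + 5) = s.reg 40 ∧ m (16 * y + 7) = s.reg 41 := by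
        by_cases e1 : m (16 * y + 5) = s.reg 40 <;> by_cases e2 : m (16 * y + 7) = s.reg 41 <;>
          simp [e1, e2] at hne ⊢
      refine hQ _ ?_
      rw [wp_loop]
      refine ⟨fun h => by simp [Expr.eval] at h, fun _ => ?_⟩
      refine ⟨⟨fun z hz => ?_, rfl, rfl, rfl⟩, rfl, ?_, ?_, .inl ?_⟩
      · simp at hz; simp [State.tick, hz]
      · simp only [State.tick, Expr.cost, List.length_cons]; omega
      · simp only [State.tick]; omega
      · simp [State.tick, hk.1, hk.2]
    · intro hne
      have hk : ¬ (m (16 * y + 5) = s.reg 40 ∧ m (16 * y + 7) = s.reg 41) := by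
        rintro ⟨e1, e2⟩
        simp [e1, e2, h1] at hne
      refine hQ _ (Program.wp_mono (ih (fun i hi => hB i (by simp [hi])) _ ?_ ?_ ?_) ?_)
      · simp
      · simp
      · simpa using h42
      · rintro s' ⟨b1, b2, b3, b4, b5⟩
        simp at b3 b4 b5
        refine ⟨⟨fun z hz => ?_, b1.revealed, b1.drawn, b1.out⟩, b2, ?_, by omega, ?_⟩
        · rw [b1.reg z hz]
          simp at hz; simp [hz]
        · simp only [List.length_cons]; omega
        · rcases b5 with ⟨e1, e2⟩ | ⟨e1, e2⟩
          · exact .inl ⟨by simp [e1], by simp [e2]⟩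
          · refine .inr ⟨e1, fun i hi => ?_⟩
            rcases List.mem_cons.1 hi with rfl | hi
            · simpa using hk
            · simpa using e2 i hi

/-- The keys with the same hash value as `k`. -/
def sameHash (w M a₁ a₂ : ℕ) (ks : List (ℕ × ℕ)) (k : ℕ × ℕ) : List (ℕ × ℕ) :=
  ks.filter fun k' => hash w a₁ a₂ (blockSize w M) k' = hash w a₁ a₂ (blockSize w M) k

/-- The cost is expressed by the keys with the same hash value and not by the list in memory,
because only the former can be averaged over the random words. -/
theorem hashFind_spec {s : State} {ks : List (ℕ × ℕ)} {k : ℕ × ℕ} (hW : 128 * (L + 2) ≤ 2 ^ w)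
    (hs : HashInv w a₁ a₂ ks s) (hL : Legal A L ks) (h40 : s.reg 40 = k.1) (h41 : s.reg 41 = k.2) :
    Program.wp w T ω hashFind (fun s' => HashInv w a₁ a₂ ks s' ∧
      MainAgree (s.setReg 42 (keyIndex ks k)) s' ∧
      s'.time ≤ s.time + (60 * (sameHash w (hashSize ks.length) a₁ a₂ ks k).length + 60) ∧
      s'.space ≤ max s.space (128 * (ks.length + 2))) s := by
  have hlen := hL.length_le
  have hM := hashSize_bounds ks.length
  have hd := hs.shape.block
  rw [hs.size] at hd
  obtain ⟨b, hb⟩ : ∃ b, hash w a₁ a₂ (blockSize w (hashSize ks.length)) k = b := ⟨_, rfl⟩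
  have hbM : b < hashSize ks.length := hb ▸ hash_lt (by omega)
  have hb1 : 16 * b + 16 ≤ 2 ^ w := by omega
  obtain ⟨l, hl1, hl2, hl3⟩ := hs.shape.lists b (by rw [hs.size]; exact hbM)
  rw [hs.reg₁, hs.reg₂, hd] at hl3
  have hkey : ∀ i ∈ l, ∃ hi : i - 1 < ks.length, 1 ≤ i ∧
      ks[i - 1] = (s.mem (16 * i + 5), s.mem (16 * i + 7)) := by
    intro i hi
    obtain ⟨h1, h2, -⟩ := (hl3 i).1 hi
    refine ⟨by omega, h1, ?_⟩
    have := hs.keys (i - 1) (by omega)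
    rw [Nat.sub_add_cancel h1] at this
    exact this.symm
  -- Different entries hold different keys, so the list in memory maps injectively into the keys
  -- with this hash value.
  have hlenl : l.length ≤ (sameHash w (hashSize ks.length) a₁ a₂ ks k).length := by
    rw [← List.length_map (f := fun i => (s.mem (16 * i + 5), s.mem (16 * i + 7)))]
    refine (List.subperm_of_subset (List.Nodup.map_on ?_ hl2) ?_).length_le
    · intro i hi j hj hij
      obtain ⟨hi', h1, h2⟩ := hkey i hi
      obtain ⟨hj', h3, h4⟩ := hkey j hj
      rw [← h2, ← h4] at hij
      have := (hL.nodup.getElem_inj_iff).1 hij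
      omega
    · intro k' hk'
      obtain ⟨i, hi, rfl⟩ := List.mem_map.1 hk'
      obtain ⟨hi', h1, h2⟩ := hkey i hi
      rw [sameHash, List.mem_filter, ← h2]
      refine ⟨List.getElem_mem _, ?_⟩
      rw [h2, hb, ((hl3 i).1 hi).2.2]
      simp
  have hcell : ∀ i ∈ l, 16 * i + 16 ≤ 2 ^ w ∧ 16 * i + 16 ≤ 128 * (ks.length + 2) := by
    intro i hi
    obtain ⟨h1, h2, -⟩ := (hl3 i).1 hi
    omega
  refine Program.wp_intro fun Q hQ => ?_
  simp only [hashFind, wp_seq, wp_instr, Instr.effect, State.touch,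
    State.setReg, State.tick, eval_hashExpr]
  simp only [Expr.eval, BinOp.eval, fieldAddr, Instr.cost, Expr.cost, hashExpr]
  simp [hs.reg₁, hs.reg₂, hd, h40, h41, hb, addr_mod hb1]
  refine Program.wp_mono (hashFindLoop_spec hl1 hcell _ rfl (by simp) (by simp)) ?_
  rintro s' ⟨b1, b2, b3, b4, b5⟩
  simp at b3 b4
  have h42 : s'.reg 42 = keyIndex ks k := by
    simp [h40, h41] at b5
    rcases b5 with ⟨e1, e2⟩ | ⟨e1, e2⟩
    · obtain ⟨hi, h1, h2⟩ := hkey _ e1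
      have : ks[s'.reg 42 - 1] = k := h2.trans e2
      rw [← this, keyIndex_of_getElem hL.nodup hi]
      omega
    · rw [e1]
      by_contra hne
      have hk : k ∈ ks := by_contra fun h => hne (keyIndex_eq_zero.2 h).symm
      obtain ⟨i, hi, hik⟩ := List.getElem_of_mem hk
      have hki := (hs.keys i hi).trans hik
      have := e2 (i + 1) ((hl3 _).2 ⟨by omega, by omega, by rw [hki, hb]⟩)
      rw [← hki] at this
      simp at this
  refine hQ _ ⟨hs.congr (fun x hx hx' => ?_) fun i => by rw [b2], ⟨fun x hx => ?_,
    fun i => by rw [b2]; rfl, b1.revealed, b1.drawn, b1.out⟩, by omega, by omega⟩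
  · rw [b1.reg x (by simp; omega)]
    simp only [Function.update_apply]
    split_ifs <;> omega
  · by_cases hx : x = 42
    · subst hx
      simpa [State.setReg] using h42
    · rw [b1.reg x (by simp; omega)]
      simp only [State.setReg, Function.update_apply]
      split_ifs <;> omega

/-- The credit is 110 * (2 * n + 2 - M) for n keys and M lists. Without doubling it grows by 220,
within the constant 1000. Doubling happens when M = n, and the credit then falls from 110 * (n + 2)
to 440. This pays for clearing 2 * n lists at 20 each and for pushing all entries at 70 each. -/
theorem hashInsert_spec {s : State} {ks : List (ℕ × ℕ)} {k : ℕ × ℕ} (hW : 128 * (L + 2) ≤ 2 ^ w)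
    (hs : HashInv w a₁ a₂ ks s) (hL : Legal A L (ks ++ [k])) (h40 : s.reg 40 = k.1)
    (h41 : s.reg 41 = k.2) (h43 : s.reg 43 = ks.length + 1) :
    Program.wp w T ω hashInsert (fun s' => HashInv w a₁ a₂ (ks ++ [k]) s' ∧ MainAgree s s' ∧
      s'.time + 110 * (2 * (ks.length + 1) + 2 - hashSize (ks.length + 1)) ≤
        s.time + 110 * (2 * ks.length + 2 - hashSize ks.length) + 1000 ∧
      s'.space ≤ max s.space (128 * (ks.length + 3))) s := by
  have hlen := hL.length_le
  simp only [List.length_append, List.length_singleton] at hlen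
  obtain ⟨n, hn⟩ : ∃ n, ks.length = n := ⟨_, rfl⟩
  have hM := hashSize_bounds n
  have hM' := hashSize_bounds (n + 1)
  obtain ⟨hr₁, hr₂, hsz, hsh, hkeys⟩ := hs
  rw [hn] at hlen h43 hsz hsh
  rw [hn]
  have hn1 : 16 * (n + 1) + 16 ≤ 2 ^ w := by omega
  -- the state before the entries are put into lists, of which the first `n₀` are in lists already
  have hpre : ∀ Q : State → Prop, (∀ s₁ n₀, n₀ ≤ n →
      (∀ z, z ∉ [52, 53, 54] → s₁.reg z = s.reg z) → s₁.revealed = s.revealed →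
      s₁.drawn = s.drawn → s₁.out = s.out → HashShape w n₀ s₁ → s₁.reg 52 = hashSize (n + 1) →
      s₁.reg 54 = n₀ + 1 →
      s₁.time + 70 * (n + 1 - n₀) + 110 * (2 * (n + 1) + 2 - hashSize (n + 1)) + 10 ≤
        s.time + 110 * (2 * n + 2 - hashSize n) + 1000 →
      s₁.space ≤ max s.space (128 * (n + 3)) →
      (∀ i j, j < 16 → j ≠ 1 → j ≠ 5 ∨ i ≠ n + 1 → j ≠ 7 ∨ i ≠ n + 1 →
        s₁.mem (16 * i + j) = s.mem (16 * i + j)) →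
      s₁.mem (16 * (n + 1) + 5) = k.1 → s₁.mem (16 * (n + 1) + 7) = k.2 →
      Program.wp w T ω hashPushAll Q s₁) → Program.wp w T ω hashInsert Q s := by
    intro Q hQ
    simp only [hashInsert, wp_seq, wp_instr, wp_ite]
    simp only [Instr.effect, State.touch, State.tick, State.setReg, Expr.eval, fieldAddr,
      BinOp.eval, Instr.cost, Expr.cost]
    simp [h43, addr_mod hn1, h40, h41, hsz]
    generalize hm' : Function.update (Function.update s.mem _ _) _ _ = m'
    have e5 : m' (16 * (n + 1) + 5) = k.1 := by simp [← hm']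
    have e7 : m' (16 * (n + 1) + 7) = k.2 := by simp [← hm']
    have fr : ∀ i j, j < 16 → j ≠ 5 ∨ i ≠ n + 1 → j ≠ 7 ∨ i ≠ n + 1 →
        m' (16 * i + j) = s.mem (16 * i + j) := by
      intro i j hj hij hij'
      rw [← hm']
      repeat rw [Function.update_of_ne (by omega)]
    clear hm'
    constructor
    -- The table is doubled. The size was at least n and is less than n + 1, so it was n.
    · intro hle
      have hs' : hashSize n = n := by omega
      have hs1 : hashSize (n + 1) = n + n := by rw [hashSize, if_pos (by omega), hs']
      rw [hs', Nat.mod_eq_of_lt (by omega), wp_hashBlock (by omega) (by simp; omega)]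
      simp only [wp_seq, wp_instr, Instr.effect, State.tick, State.setReg, Expr.eval, Instr.cost,
        Expr.cost]
      simp
      refine Program.wp_mono (hashClear_spec (B := 128 * (n + 3)) (n + n) _ ?_ ?_ ?_) ?_
      · simp
      · simp; omega
      · simp; omega
      rintro s₁ ⟨b1, b2, b3, b4, b5⟩
      simp at b2 b3 b4 b5
      have h52 := b1.reg 52 (by simp)
      have h53 := b1.reg 53 (by simp)
      simp at h52 h53
      rw [wp_instr]
      refine hQ _ 0 (by omega) (fun z hz => ?_) b1.revealed b1.drawn b1.out ⟨?_, ?_, ?_⟩ ?_ ?_ ?_ ?_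
        ?_ ?_ ?_
      · simp at hz
        simp only [Instr.effect, Expr.eval, State.tick, State.setReg]
        rw [Function.update_of_ne (by omega), b1.reg z (by simp; omega)]
        simp [hz]
      · simp [Instr.effect, Expr.eval, State.tick, State.setReg, h52]; omega
      · simp [Instr.effect, Expr.eval, State.tick, State.setReg, h52, h53]
      · intro b hb
        simp [Instr.effect, Expr.eval, State.tick, State.setReg, h52] at hb ⊢
        refine ⟨[], by rw [b4 b hb]; exact .nil, by simp, fun i => by simp; omega⟩
      · simp [Instr.effect, Expr.eval, State.tick, State.setReg, h52, hs1]
      · simp [Instr.effect, Expr.eval, State.tick, State.setReg]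
        by_contra hw
        rw [Nat.eq_zero_of_not_pos hw] at hn1
        omega
      · simp only [Instr.effect, Expr.eval, State.tick, State.setReg, hs1, hs', Instr.cost, Expr.cost]
        omega
      · simp only [Instr.effect, Expr.eval, State.tick, State.setReg]
        omega
      · intro i j hj h1 h5 h7
        exact (b5 i j hj h1).trans (fr i j hj h5 h7)
      · exact (b5 _ 5 (by norm_num) (by norm_num)).trans e5
      · exact (b5 _ 7 (by norm_num) (by norm_num)).trans e7
    · intro hlt
      have hs1 : hashSize (n + 1) = hashSize n := by rw [hashSize, if_neg (by omega)]
      refine hQ _ n le_rfl (fun z hz => ?_) rfl rfl rfl ⟨?_, ?_, ?_⟩ ?_ ?_ ?_ ?_ ?_ ?_ ?_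
      · simp at hz; simp [hz]
      · simpa using hsh.two_le
      · simpa using hsh.block
      · intro b hb
        simp at hb ⊢
        obtain ⟨l, l1, l2, l3⟩ := hsh.lists b hb
        refine ⟨l, ?_, l2, fun i => ?_⟩
        · rw [fr b 1 (by norm_num) (by simp) (by simp)]
          exact l1.congr fun i _ => fr i 3 (by norm_num) (by simp) (by simp)
        · rw [l3]
          refine and_congr_right fun _ => and_congr_right fun hi => ?_
          rw [fr i 5 (by norm_num) (.inr (by omega)) (.inr (by omega)),
            fr i 7 (by norm_num) (.inr (by omega)) (.inr (by omega))]
      · simp [hsz, hs1]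
      · simp
      · simp only [hs1]
        omega
      · simp; omega
      · intro i j hj _ h5 h7
        exact fr i j hj h5 h7
      · exact e5
      · exact e7
  refine hpre _ ?_
  intro s₁ n₀ hn₀ hreg hrev hdr hout hsh₁ hsz₁ h54 ht hsp hmem h5 h7
  obtain ⟨d, rfl⟩ := Nat.exists_eq_add_of_le hn₀
  have h43₁ : s₁.reg 43 = n₀ + (d + 1) := by rw [hreg 43 (by simp), h43]; omega
  refine Program.wp_mono (hashPushAll_spec (B := 128 * (n₀ + d + 3)) (d + 1) n₀ s₁ hsh₁ h54 h43₁
    (by omega) (by omega) (by omega) (by omega)) ?_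
  rintro s₂ ⟨hb, hsh₂, ht₂, hsp₂, hm₂⟩
  have hreg₂ : ∀ z, z ∉ [52, 53, 54, 55, 56, 57, 58] → s₂.reg z = s.reg z := fun z hz =>
    (hb.reg z (by simp at hz ⊢; omega)).trans (hreg z (by simp at hz ⊢; omega))
  refine ⟨⟨(hreg₂ 50 (by simp)).trans hr₁, (hreg₂ 51 (by simp)).trans hr₂, ?_, ?_, ?_⟩,
    ⟨fun x hx => hreg₂ x (by simp; omega), fun i => ?_, hb.revealed.trans hrev, hb.drawn.trans hdr,
      hb.out.trans hout⟩, by omega, by omega⟩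
  · rw [hb.reg 52 (by simp), hsz₁]
    simp [hn]
  · rw [List.length_append, List.length_singleton, hn]
    exact hsh₂
  · intro i hi
    rw [hm₂ _ 5 (by norm_num) (by norm_num) (by norm_num),
      hm₂ _ 7 (by norm_num) (by norm_num) (by norm_num)]
    simp only [List.length_append, List.length_singleton, hn] at hi
    by_cases h : i = n₀ + d
    · subst h
      rw [h5, h7]
      simp [← hn]
    · rw [hmem _ 5 (by norm_num) (by norm_num) (.inr (by omega)) (.inr (by omega)),
        hmem _ 7 (by norm_num) (by norm_num) (.inr (by omega)) (.inr (by omega)),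
        hkeys i (by omega), List.getElem_append_left]
  · have e1 := hm₂ (i / 8) (2 * (i % 8)) (by omega) (by omega) (by omega)
    have e2 := hmem (i / 8) (2 * (i % 8)) (by omega) (by omega) (by omega) (by omega)
    rw [show 16 * (i / 8) + 2 * (i % 8) = 2 * i by omega] at e1 e2
    exact e1.trans e2

theorem hashInit_spec (hN : 4 ≤ 2 ^ w) : Program.wp w T ω hashInit (fun s =>
    HashInv w (ω 0) (ω 1) [] s ∧ MainAgree { State.init with drawn := 2 } s ∧
      s.time + 110 * (2 * 0 + 2 - hashSize 0) ≤ 1000 ∧ s.space ≤ 256) State.init := by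
  have h2 : 2 % 2 ^ w = 2 := Nat.mod_eq_of_lt (by omega)
  simp only [hashInit, wp_seq, wp_instr, Instr.effect, State.tick, State.setReg, Expr.eval,
    Instr.cost, Expr.cost, h2]
  rw [wp_hashBlock hN (by simp)]
  refine ⟨⟨?_, ?_, ?_, ⟨?_, ?_, fun b _ => ⟨[], .nil, List.nodup_nil, fun i => ?_⟩⟩, ?_⟩,
    ⟨fun x hx => ?_, fun _ => rfl, rfl, rfl, rfl⟩, ?_, ?_⟩
  · simp [State.setReg, State.tick, State.init]
  · simp [State.setReg, State.tick, State.init]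
  · simp [State.setReg, State.tick, hashSize]
  · simp [State.setReg, State.tick]
  · simp [State.setReg, State.tick]
  · simp; omega
  · simp
  · simp only [State.setReg, State.tick]
    repeat rw [Function.update_of_ne (by omega)]
  · simp [State.setReg, State.tick, State.init, hashSize]
  · simp [State.setReg, State.tick, State.init]

/-- Hash tables are a dictionary. -/
def hashDictionary (hW : 128 * (L + 2) ≤ 2 ^ w) (hL : (L + 2) * (2 * L + 4) ≤ 2 ^ w)
    (hA : ∀ a ∈ A, a * (2 * L + 4) ≤ 2 ^ w) :
    Dictionary w T A L
      (fun (a : Fin (2 ^ w) × Fin (2 ^ w)) k => if k = 0 then (a.1 : ℕ) else a.2)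
      1000 2 hashInit hashFind hashInsert where
  Inv a := HashInv w a.1 a.2
  credit n := 110 * (2 * n + 2 - hashSize n)
  cost a ks k := 60 * (sameHash w (hashSize ks.length) a.1 a.2 ks k).length + 60
  inv_congr hs ha := hs.congr (fun x hx _ => ha.reg x hx) ha.mem
  cost_le {ks k} hks h1 h2 := by
    have hM := hashSize_bounds ks.length
    have hlen := hks.length_le
    have hb : ∀ k' ∈ k :: ks, k'.1 * hashSize ks.length ≤ 2 ^ w ∧
        k'.2 * hashSize ks.length ≤ 2 ^ w := by
      intro k' hk'
      have h : k'.1 ≤ L + 2 ∧ k'.2 ∈ A := by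
        rcases List.mem_cons.1 hk' with rfl | hk'
        · exact ⟨by omega, h2⟩
        · exact ⟨by have := (hks.bound k' hk').1; omega, (hks.bound k' hk').2⟩
      exact ⟨(Nat.mul_le_mul h.1 (by omega)).trans hL,
        (Nat.mul_le_mul_left _ (by omega)).trans (hA _ h.2)⟩
    -- The average cost of a search is at most 60 * 11 + 60 = 720, which is below 1000. The keys do
    -- not depend on the random words, so the average over these can be taken for a fixed list of
    -- keys.
    have := sum_length_filter_hash (k := k) hks.nodup hM.2.1 (by omega) (by omega) hb
    rw [Finset.sum_add_distrib, ← Finset.mul_sum]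
    simp only [sameHash, Finset.sum_const, Finset.card_univ, Fintype.card_prod, Fintype.card_fin,
      smul_eq_mul] at this ⊢
    omega
  init_spec a := hashInit_spec (ω := fun k => if k = 0 then (a.1 : ℕ) else a.2) (by omega)
  find_spec hs hL _ _ h40 h41 := hashFind_spec hW hs hL h40 h41
  insert_spec hs hL h40 h41 h43 := hashInsert_spec hW hs hL h40 h41 h43

end hashing

end WordRAM

/-! ### The word length, and the expectation as a finite average. -/

namespace WordRAM

theorem Program.Deterministic.compile {f g : Program} (hf : f.Deterministic)
    (hg : g.Deterministic) (c : Cmd) : (c.compile f g).Deterministic := by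
  induction c <;> simp_all [Cmd.compile, Program.Deterministic]

theorem WordsSuffice.length_le {w n : ℕ} {A : Finset ℕ} (h : WordsSuffice 16 w n A) :
    1024 * (n + 2) ≤ 2 ^ w := by
  refine le_trans ?_ h.1
  rw [pow_succ]
  exact Nat.mul_le_mul_right _ (le_trans (by norm_num) (Nat.pow_le_pow_left (Nat.le_add_left 2 n) 15))

/-- The analysis of collisions needs products of a key component and the size of the table to fit
into a word. Two of the 16 powers give the product, and the other 14 the factor 8. -/
theorem WordsSuffice.mul_le {w n : ℕ} {A : Finset ℕ} (h : WordsSuffice 16 w n A) {a b : ℕ}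
    (ha : a ≤ n ∨ a ∈ A) (hb : b ≤ n ∨ b ∈ A) : 8 * ((a + 2) * (b + 2)) ≤ 2 ^ w := by
  have key : ∀ x, x ≤ n ∨ x ∈ A → (x + 2) ^ 16 ≤ 2 ^ w := by
    rintro x (hx | hx)
    · exact (Nat.pow_le_pow_left (by omega) 16).trans h.1
    · exact h.2 x hx
  have hm : (max a b + 2) ^ 16 ≤ 2 ^ w := by
    rcases max_choice a b with h | h <;> rw [h]
    exacts [key a ha, key b hb]
  refine le_trans ?_ hm
  rw [show (max a b + 2) ^ 16 = (max a b + 2) ^ 14 * ((max a b + 2) * (max a b + 2)) by ring]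
  exact Nat.mul_le_mul (le_trans (by norm_num) (Nat.pow_le_pow_left (Nat.le_add_left 2 _) 14))
    (Nat.mul_le_mul (by omega) (by omega))

theorem runTime_le {p : Program} {w : ℕ} {T : List ℕ} {ω : ℕ → ℕ} {s : State}
    (h : Exec w T ω p State.init s) : runTime p w T ω ≤ s.time :=
  iInf₂_le s h

/-- The event is a cylinder, that is, a product over two coordinates, to which the formula for
infinite products of measures applies. -/
theorem randomWords_two {w : ℕ} (x y : Fin (2 ^ w)) :
    randomWords w {ω | (ω 0, ω 1) = (x, y)} = ((2 ^ w * 2 ^ w : ℕ) : ℝ≥0∞)⁻¹ := by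
  have : {ω : ℕ → Fin (2 ^ w) | (ω 0, ω 1) = (x, y)} =
      Set.pi ({0, 1} : Finset ℕ) fun i => if i = 0 then {x} else {y} := by
    ext ω
    simp
  rw [this, randomWords, Measure.infinitePi_pi _ (fun _ _ => .of_discrete),
    Finset.prod_pair (by norm_num)]
  simp
  rw [ENNReal.mul_inv (by simp) (by simp)]

/-- The expectation of a function of two random words. -/
theorem lintegral_randomWords {w : ℕ} (f : Fin (2 ^ w) × Fin (2 ^ w) → ℕ) :
    ∫⁻ ω, (f (ω 0, ω 1) : ℝ≥0∞) ∂(randomWords w) =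
      ((2 ^ w * 2 ^ w : ℕ) : ℝ≥0∞)⁻¹ * ((∑ a, f a : ℕ) : ℝ≥0∞) := by
  have hφ : Measurable fun ω : ℕ → Fin (2 ^ w) => (ω 0, ω 1) :=
    (measurable_pi_apply 0).prodMk (measurable_pi_apply 1)
  have h := lintegral_map (μ := randomWords w) (f := fun a => (f a : ℝ≥0∞)) .of_discrete hφ
  rw [← h, lintegral_fintype, Nat.cast_sum, Finset.mul_sum]
  refine Finset.sum_congr rfl fun a _ => ?_
  rw [Measure.map_apply hφ (.of_discrete), mul_comm]
  congr 1
  exact randomWords_two a.1 a.2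

/-- The final state depends on the first two random words only, so the integral is a finite average
over pairs of words, and a bound on the sum of the times over all pairs suffices. -/
theorem expectedTime_le {p : Program} {w B : ℕ} {T : List ℕ}
    {S : Fin (2 ^ w) × Fin (2 ^ w) → State}
    (hS : ∀ ω : ℕ → Fin (2 ^ w), Exec w T (fun k => (ω k : ℕ)) p State.init (S (ω 0, ω 1)))
    (hB : ∑ a, (S a).time ≤ Fintype.card (Fin (2 ^ w) × Fin (2 ^ w)) * B) :
    expectedTime p w T ≤ B := by
  rw [Fintype.card_prod, Fintype.card_fin] at hB
  calc expectedTime p w T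
      ≤ ∫⁻ ω, ((S (ω 0, ω 1)).time : ℝ≥0∞) ∂(randomWords w) :=
        lintegral_mono fun ω => runTime_le (hS ω)
    _ = ((2 ^ w * 2 ^ w : ℕ) : ℝ≥0∞)⁻¹ * ((∑ a, (S a).time : ℕ) : ℝ≥0∞) :=
        lintegral_randomWords fun a => (S a).time
    _ ≤ ((2 ^ w * 2 ^ w : ℕ) : ℝ≥0∞)⁻¹ * ((2 ^ w * 2 ^ w * B : ℕ) : ℝ≥0∞) := by gcongr
    _ = B := by
        rw [Nat.cast_mul (2 ^ w * 2 ^ w) B, ← mul_assoc, ENNReal.inv_mul_cancel, one_mul]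
        · exact_mod_cast (by positivity : 2 ^ w * 2 ^ w ≠ 0)
        · exact ENNReal.natCast_ne_top _

end WordRAM

namespace LZDPlus

open WordRAM

theorem deterministic_lzdPlus_skip :
    (Program.seq .skip (lzdPlus.compile skipFind skipInsert)).Deterministic :=
  ⟨trivial, .compile (by simp [skipFind, skipFindStep, Program.Deterministic])
    (by simp [skipInsert, skipCreate, skipGrow, skipInsertLeaf, skipSplit, skipDescend,
      skipInsertStep, Program.Deterministic]) _⟩

end LZDPlus

theorem theorem1 :
    -- expected linear time, by a randomized program that is correct for all random choices
    (∃ (p : WordRAM.Program) (c C : ℕ), ∀ (w : ℕ) (A : Finset ℕ) (T : List ℕ),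
      (∀ a ∈ T, a ∈ A) → WordRAM.WordsSuffice c w T.length A →
        (∀ ω : ℕ → Fin (2 ^ w), ∃ s : WordRAM.State,
          WordRAM.Exec w T (fun k => (ω k : ℕ)) p WordRAM.State.init s ∧
          LZDPlus.ComputedOnline C A T s) ∧
        WordRAM.expectedTime p w T ≤ ((C * (T.length + 1) : ℕ) : ENNReal)) ∧
    -- time O(n log σ) in the worst case, by a deterministic program
    (∃ (p : WordRAM.Program) (c C : ℕ), p.Deterministic ∧
      ∀ (w : ℕ) (A : Finset ℕ) (T : List ℕ),
      (∀ a ∈ T, a ∈ A) → WordRAM.WordsSuffice c w T.length A →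
        ∀ ω : ℕ → Fin (2 ^ w), ∃ s : WordRAM.State,
          WordRAM.Exec w T (fun k => (ω k : ℕ)) p WordRAM.State.init s ∧
          LZDPlus.ComputedOnline C A T s ∧
          s.time ≤ C * ((T.length + 1) * (Nat.log 2 A.card + 1))) := by
  constructor
  · refine ⟨.seq WordRAM.hashInit (LZDPlus.lzdPlus.compile WordRAM.hashFind WordRAM.hashInsert),
      16, 13000, fun w A T hT hw => ?_⟩
    have hW := hw.length_le
    -- The left side equals 8 * (n + 2) * (n + 2).
    have hL : (2 * T.length + 2 + 2) * (2 * (2 * T.length + 2) + 4) ≤ 2 ^ w := by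
      have := hw.mul_le (.inl (le_refl T.length)) (.inl (le_refl T.length))
      nlinarith
    have hA : ∀ a ∈ A, a * (2 * (2 * T.length + 2) + 4) ≤ 2 ^ w := fun a ha => by
      have := hw.mul_le (.inr ha) (.inl (le_refl T.length))
      nlinarith
    obtain ⟨S, hS, hC, hd, ht⟩ := LZDPlus.exists_exec_lzdPlus (C := 13000)
      (WordRAM.hashDictionary (by omega) hL hA) hW hT (by norm_num)
    have hex : ∀ ω : ℕ → Fin (2 ^ w), WordRAM.Exec w T (fun k => (ω k : ℕ))
        (.seq WordRAM.hashInit (LZDPlus.lzdPlus.compile WordRAM.hashFind WordRAM.hashInsert))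
        WordRAM.State.init (S (ω 0, ω 1)) := by
      -- The family was run with words determined by a pair. Exactly two words are drawn, so any
      -- sequence that starts with this pair gives the same run.
      refine fun ω => (hS (ω 0, ω 1)).congr_words fun k hk => ?_
      rw [hd] at hk
      interval_cases k <;> rfl
    -- With K = 1000 the average time is at most 12002 * n + 1050.
    exact ⟨fun ω => ⟨_, hex ω, hC _⟩, WordRAM.expectedTime_le hex
      (ht.trans (Nat.mul_le_mul_left _ (by omega)))⟩
  · refine ⟨_, 16, 20000, LZDPlus.deterministic_lzdPlus_skip, fun w A T hT hw ω => ?_⟩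
    have hW := hw.length_le
    have hA : ∀ a ∈ A, a + 1 < 2 ^ w := fun a ha => by
      have := hw.mul_le (.inr ha) (.inr ha)
      nlinarith
    obtain ⟨S, hS, hC, hd, ht⟩ := LZDPlus.exists_exec_lzdPlus (C := 20000)
      (WordRAM.skipDictionary (by omega) hA) hW hT (by norm_num)
    -- The run was made with all random words zero, but none is drawn, so the sequence does not
    -- matter.
    refine ⟨S (), (hS ()).congr_words fun k hk => ?_, hC _, ?_⟩
    · rw [hd] at hk
      omega
    · simp only [Finset.univ_unique, Finset.sum_singleton, Fintype.card_unit, one_mul] at ht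
      -- The sentinel costs at most one level, because σ + 1 ≤ 2 * σ unless the alphabet is empty.
      have hlog : Nat.log 2 (A.card + 1) ≤ Nat.log 2 A.card + 1 := by
        rcases Nat.eq_zero_or_pos A.card with h | h
        · simp [h]
        · rw [← Nat.log_mul_base (by norm_num) h.ne']
          exact Nat.log_mono_right (by omega)
      refine ht.trans ?_
      generalize Nat.log 2 (A.card + 1) = x at hlog ⊢
      generalize Nat.log 2 A.card = y at hlog ⊢
      have := Nat.mul_le_mul_right T.length hlog
      nlinarith
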